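/- **Setting.** Let $N\in\{2,3\}$, let $\Omega=([-1,1]|_{\{-1;1\}})^N$ be the flat torus (functions on $\mathbb R^N$ with period $2$ in each coordinate), and let $p\in C[0,\infty)\cap C^1(0,\infty)$ with $p(0)=0$ and $p'>0$ on $(0,\infty)$. Put $P(\varrho)=\varrho\int_1^\varrho p(z)z^{-2}\,dz$ (with $P(0)=0$). The barotropic Euler system is $$\partial_t\varrho+\operatorname{div}(\varrho u)=0,\qquad \partial_t(\varrho u)+\operatorname{div}(\varrho u\otimes u)+\nabla p(\varrho)=0 .$$ A *weak solution* on $[0,T]\times\Omega$ is a pair of bounded measurable functions $\varrho\ge 0$, $u$ (with $\varrho_0=\varrho(0,\cdot)>0$ a.e., $u_0=u(0,\cdot)$) such that for every $\tau\in[0,T]$ $$\int_\Omega\big(\varrho(\tau,\cdot)\varphi(\tau,\cdot)-\varrho_0\varphi(0,\cdot)\big)\,dx=\int_0^\tau\!\!\int_\Omega\big(\varrho\,\partial_t\varphi+\varrho u\cdot\nabla\varphi\big)\,dx\,dt$$ for all $\varphi\in C^\infty([0,T]\times\Omega)$, and $$\int_\Omega\big((\varrho u)(\tau,\cdot)\cdot\varphi(\tau,\cdot)-\varrho_0u_0\cdot\varphi(0,\cdot)\big)\,dx=\int_0^\tau\!\!\int_\Omega\big(\varrho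 u\cdot\partial_t\varphi+\varrho u\otimes u:\nabla\varphi+p(\varrho)\operatorname{div}\varphi\big)\,dx\,dt$$ for all $\varphi\in C^\infty([0,T]\times\Omega;\mathbb R^N)$. Thus $\varrho(\tau,\cdot)$ and $(\varrho u)(\tau,\cdot)$ are well defined a.e. in $\Omega$ for every $\tau$. It is *admissible* if, with $e=\tfrac12\varrho|u|^2+P(\varrho)$, $$\int_0^T\!\!\int_\Omega\big(e\,\partial_t\varphi+e\,u\cdot\nabla\varphi+p(\varrho)u\cdot\nabla\varphi\big)\,dx\,dt+\int_\Omega\big(\tfrac12\varrho_0|u_0|^2+P(\varrho_0)\big)\varphi(0,\cdot)\,dx\ge0$$ for all $0\le\varphi\in C_c^\infty([0,T)\times\Omega)$. Write $\int_\Omega E(\tau+)=\operatorname{ess\,lim}_{t\to\tau+}\int_\Omega e(t,\cdot)\,dx$, which exists for admissible solutions. An admissible solution $[\varrho,u]$ on $[0,T]$ *satisfies the principle of maximal dissipation* if, for every $\tau\in[0,T)$, every $T'\in(\tau,T]$ and every weak solution $[\varrho',u']$ on $[0,T']$ whose energy limits $\int_\Omega E'(t+)$ exist for $t\in(\tau,T')$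 and which satisfies $\varrho'=\varrho$, $\varrho'u'=\varrho u$ in $[0,\tau]\times\Omega$, there are $\tau_n\in(\tau,T')$, $\tau_n\to\tau$, with $\int_\Omega E'(\tau_n+)\ge\int_\Omega E(\tau_n+)$ for all $n$. A *smooth solution* on $[\tau_1,\tau_2]$ is a pair $[\tilde\varrho,\tilde u]$ of class $C^1([\tau_1,\tau_2]\times\Omega)$ with $\tilde\varrho>0$ that satisfies the system pointwise and along which the flux is regular: $p'$ is Lipschitz in a neighbourhood of each value of $\tilde\varrho$ (automatic if $p\in C^2(0,\infty)$). **Proposition 5.1.** Let $[\varrho,u]$ be an admissible weak solution on $[0,T]\times\Omega$ satisfying the principle of maximal dissipation. Let $0\le\tau_1<\tau_2\le T$ and let $[\tilde\varrho,\tilde u]$ be a smooth solution on $[\tau_1,\tau_2]$ with $$\varrho(\tau_1,\cdot)=\tilde\varrho(\tau_1,\cdot),\qquad u(\tau_1,\cdot)=\tilde u(\tau_1,\cdot)\quad\text{a.e. in }\Omega .$$ Then for every $t\in[\tau_1,\tau_2]$ $$\varrho(t,\cdot)=\tilde\varrho(t,\cdot),\qquad u(t,\cdot)=\tilde u(t,\cdot)\quad\text{a.e.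 in }\Omega .$$ -/

import Mathlib

open Set Filter Topology MeasureTheory
open scoped ContDiff RealInnerProductSpace

namespace BarotropicEuler

noncomputable section

/-- Physical space `ℝ^N` with the Euclidean norm. -/
abbrev Space (N : ℕ) : Type := EuclideanSpace ℝ (Fin N)

/-- The `j`-th unit vector. -/
def unitVec {N : ℕ} (j : Fin N) : Space N := EuclideanSpace.single j (1 : ℝ)

/-- The fundamental cell `[-1,1]^N` of the flat torus `Ω`.  Functions on `Ω` that are only
determined almost everywhere are represented by functions on this cell; functions on `Ω` that are
differentiated are represented by functions on `ℝ^N` with period `2` in every coordinate. -/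
def cell (N : ℕ) : Set (Space N) := {x | ∀ i, x i ∈ Icc (-1 : ℝ) 1}

/-- Lebesgue measure on the fundamental cell. -/
def cellMeasure (N : ℕ) : Measure (Space N) := volume.restrict (cell N)

/-- Periodicity with period `2` in each coordinate. -/
def IsPeriodic {N : ℕ} {F : Type*} (f : Space N → F) : Prop :=
  ∀ (i : Fin N) (x : Space N), f (x + (2 : ℝ) • unitVec i) = f x

/-- The divergence `∑ⱼ ∂ⱼ vⱼ` of a vector field. -/
def divergence {N : ℕ} (v : Space N → Space N) (x : Space N) : ℝ :=
  ∑ j, (fderiv ℝ v x (unitVec j)) j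

/-- `div (ρ u ⊗ u) = ∑ⱼ ∂ⱼ (ρ uⱼ u)`. -/
def momentumFluxDiv {N : ℕ} (ρ : Space N → ℝ) (u : Space N → Space N) (x : Space N) : Space N :=
  ∑ j, fderiv ℝ (fun y => (ρ y * u y j) • u y) x (unitVec j)

/-- The hypotheses on the pressure:
`p ∈ C[0,∞) ∩ C¹(0,∞)`, `p 0 = 0`, `p' > 0` on `(0,∞)`. -/
structure IsPressure (p : ℝ → ℝ) : Prop where
  continuousOn : ContinuousOn p (Ici 0)
  contDiffOn : ContDiffOn ℝ 1 p (Ioi 0)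
  map_zero : p 0 = 0
  deriv_pos : ∀ z : ℝ, 0 < z → 0 < deriv p z

/-- The pressure potential `P ρ = ρ ∫₁^ρ p(z)/z² dz`.  At `ρ = 0` this is `0`, which is also the
limit of `P ρ` as `ρ → 0+`, since `p 0 = 0`. -/
def pressurePotential (p : ℝ → ℝ) (ρ : ℝ) : ℝ := ρ * ∫ z in (1 : ℝ)..ρ, p z / z ^ 2

/-- The mechanical energy density `½ ρ |u|² + P(ρ)`. -/
def energyDensity {N : ℕ} (p : ℝ → ℝ) (ρ : ℝ) (u : Space N) : ℝ :=
  1 / 2 * ρ * ‖u‖ ^ 2 + pressurePotential p ρ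

/-- The total mechanical energy at time `t`. -/
def totalEnergy {N : ℕ} (p : ℝ → ℝ) (ρ : ℝ → Space N → ℝ) (u : ℝ → Space N → Space N)
    (t : ℝ) : ℝ :=
  ∫ x, energyDensity p (ρ t x) (u t x) ∂(cellMeasure N)

/-- Test functions: restrictions to the time interval at hand of functions that are smooth on
`ℝ × ℝ^N` and periodic in space. -/
structure IsTest {N : ℕ} {F : Type*} [NormedAddCommGroup F] [NormedSpace ℝ F]
    (φ : ℝ → Space N → F) : Prop where
  smooth : ContDiff ℝ ∞ (Function.uncurry φ)
  periodic : ∀ t, IsPeriodic (φ t)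

/-- `[ρ, u]` is a weak solution of the barotropic Euler system on `[0,T] × Ω` with the initial
data `ρ 0`, `u 0`, where `ρ 0 > 0`.  It is bounded and measurable and the density is nonnegative.
Since both equations are required at every time `τ ∈ [0,T]`, the slices `ρ τ` and `ρ τ • u τ` are
the instantaneous values of the weakly continuous density and momentum. -/
structure IsWeakSolution {N : ℕ} (p : ℝ → ℝ) (T : ℝ) (ρ : ℝ → Space N → ℝ)
    (u : ℝ → Space N → Space N) : Prop where
  measurable_density : Measurable (Function.uncurry ρ)
  measurable_velocity : Measurable (Function.uncurry u)
  bounded : ∃ C : ℝ, ∀ t ∈ Icc 0 T, ∀ᵐ x ∂(cellMeasure N),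
    0 ≤ ρ t x ∧ ρ t x ≤ C ∧ ‖u t x‖ ≤ C
  initial_pos : ∀ᵐ x ∂(cellMeasure N), 0 < ρ 0 x
  continuity : ∀ φ : ℝ → Space N → ℝ, IsTest φ → ∀ τ ∈ Icc 0 T,
    ∫ x, (ρ τ x * φ τ x - ρ 0 x * φ 0 x) ∂(cellMeasure N) =
      ∫ t in (0 : ℝ)..τ, ∫ x, (ρ t x * deriv (fun s => φ s x) t
        + ρ t x * fderiv ℝ (φ t) x (u t x)) ∂(cellMeasure N)
  momentum : ∀ φ : ℝ → Space N → Space N, IsTest φ → ∀ τ ∈ Icc 0 T,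
    ∫ x, (⟪ρ τ x • u τ x, φ τ x⟫ - ⟪ρ 0 x • u 0 x, φ 0 x⟫) ∂(cellMeasure N) =
      ∫ t in (0 : ℝ)..τ, ∫ x, (⟪ρ t x • u t x, deriv (fun s => φ s x) t⟫
        + ρ t x * ⟪u t x, fderiv ℝ (φ t) x (u t x)⟫
        + p (ρ t x) * divergence (φ t) x) ∂(cellMeasure N)

/-- An admissible weak solution: a weak solution that satisfies the weak form of the energy
inequality, tested with nonnegative smooth functions of compact support in `[0,T) × Ω`. -/
structure IsAdmissible {N : ℕ} (p : ℝ → ℝ) (T : ℝ) (ρ : ℝ → Space N → ℝ)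
    (u : ℝ → Space N → Space N) : Prop where
  weak : IsWeakSolution p T ρ u
  energy_inequality : ∀ φ : ℝ → Space N → ℝ, IsTest φ →
    (∀ t ∈ Icc 0 T, ∀ x, 0 ≤ φ t x) → (∃ T' < T, ∀ t, T' ≤ t → ∀ x, φ t x = 0) →
    0 ≤ (∫ t in (0 : ℝ)..T, ∫ x, (energyDensity p (ρ t x) (u t x) * deriv (fun s => φ s x) t
          + energyDensity p (ρ t x) (u t x) * fderiv ℝ (φ t) x (u t x)
          + p (ρ t x) * fderiv ℝ (φ t) x (u t x)) ∂(cellMeasure N))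
        + ∫ x, energyDensity p (ρ 0 x) (u 0 x) * φ 0 x ∂(cellMeasure N)

/-- `e = ∫_Ω E(τ+)`, that is, `e` is the essential limit of the total energy at `t` as
`t → τ+`. -/
def IsRightEnergy {N : ℕ} (p : ℝ → ℝ) (ρ : ℝ → Space N → ℝ) (u : ℝ → Space N → Space N)
    (τ e : ℝ) : Prop :=
  Tendsto (totalEnergy p ρ u) (𝓝[>] τ ⊓ ae volume) (𝓝 e)

/-- The principle of maximal dissipation on `[0,T]`.  A competitor is a weak solution `[ρ', u']`
on `[0,T']` that has the same density and momentum up to time `τ`, and whose energy `E'(t+)`,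
which enters the principle, exists for `t ∈ (τ,T')`; it need not be admissible. -/
def MaximalDissipation {N : ℕ} (p : ℝ → ℝ) (T : ℝ) (ρ : ℝ → Space N → ℝ)
    (u : ℝ → Space N → Space N) : Prop :=
  ∀ (τ T' : ℝ) (ρ' : ℝ → Space N → ℝ) (u' : ℝ → Space N → Space N),
    0 ≤ τ → τ < T' → T' ≤ T → IsWeakSolution p T' ρ' u' →
    (∀ t ∈ Icc 0 τ, ∀ᵐ x ∂(cellMeasure N),
      ρ t x = ρ' t x ∧ ρ t x • u t x = ρ' t x • u' t x) →
    (∀ t ∈ Ioo τ T', ∃ e', IsRightEnergy p ρ' u' t e') →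
    ∃ σ : ℕ → ℝ, (∀ n, σ n ∈ Ioo τ T') ∧ Tendsto σ atTop (𝓝 τ) ∧
      ∀ n, ∃ e e', IsRightEnergy p ρ u (σ n) e ∧ IsRightEnergy p ρ' u' (σ n) e' ∧ e ≤ e'

/-- `[r, U]` is a smooth solution of the Euler system on `[τ₁,τ₂] × Ω`: it is continuously
differentiable up to the end times, the density is positive, the equations hold pointwise, and the
flux is regular along the solution in the sense that `p'` is Lipschitz near every value
of `r` (which holds for every solution if `p` is twice continuously differentiable
on `(0,∞)`). -/
structure IsSmoothSolution {N : ℕ} (p : ℝ → ℝ) (τ₁ τ₂ : ℝ) (r : ℝ → Space N → ℝ)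
    (U : ℝ → Space N → Space N) : Prop where
  contDiffOn_density : ContDiffOn ℝ 1 (Function.uncurry r) (Icc τ₁ τ₂ ×ˢ univ)
  contDiffOn_velocity : ContDiffOn ℝ 1 (Function.uncurry U) (Icc τ₁ τ₂ ×ˢ univ)
  periodic_density : ∀ t ∈ Icc τ₁ τ₂, IsPeriodic (r t)
  periodic_velocity : ∀ t ∈ Icc τ₁ τ₂, IsPeriodic (U t)
  density_pos : ∀ t ∈ Icc τ₁ τ₂, ∀ x, 0 < r t x
  flux_regular : ∀ t ∈ Icc τ₁ τ₂, ∀ x, ∃ K, ∃ s ∈ 𝓝 (r t x), LipschitzOnWith K (deriv p) s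
  continuity : ∀ t ∈ Ioo τ₁ τ₂, ∀ x,
    deriv (fun s => r s x) t + divergence (fun y => r t y • U t y) x = 0
  momentum : ∀ t ∈ Ioo τ₁ τ₂, ∀ x,
    deriv (fun s => r s x • U s x) t + momentumFluxDiv (r t) (U t) x
      + gradient (fun y => p (r t y)) x = 0

end

end BarotropicEuler

open BarotropicEuler

set_option linter.unusedSectionVars false

/-! The proof is weak-strong uniqueness by the relative energy method; maximal dissipation supplies
the initial energy bound at `τ₁`. Admissibility alone does not give that bound when `τ₁ > 0`:
density and momentum are only weakly continuous in time, so the right limit of the energy at `τ₁`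
may exceed the energy of the slice at `τ₁`.

To exclude such a jump, the given solution up to `τ₁` is continued by the smooth one. This is a weak
solution (`IsBoundedWeakSolution.glue_smooth`) whose energy is continuous after `τ₁`, hence a
legitimate competitor. Maximal dissipation yields times `σ n → τ₁` at which the right energy of `[ρ,
u]` is at most the smooth energy. By admissibility the energy at almost every later time lies below
each of its earlier right limits (`ae_le_of_weakly_decreasing`). Letting `n → ∞` bounds the energy
at almost every `t > τ₁` by the smooth energy at `τ₁` (`IsAdmissible.ae_totalEnergy_le_smooth`).

The relative energy `½ρ|u - U|² + P(ρ) - P(r) - P'(r)(ρ - r)` equals the energy plus terms linear in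
`ρ` and `ρu` plus `p(r)` (`relEnergy_eq`). The linear terms evolve by the weak equations tested with
`½|U|² - P'(r)` and with `U`. These tests are only `C¹` on a closed time interval; they are frozen
in time outside it and mollified in space-time. By the smooth equations the resulting rate is
quadratic in the difference of the solutions (`IsSmoothSolution.relFlux_eq`): it contains `∇U`
applied to `u - U` and the first-order Taylor remainder of `p` at `r`.

Both terms are bounded by the relative energy. For the Taylor remainder this rests on `P'' = p'/ρ >
0` and on the local Lipschitz regularity of `p'`, with separate treatment of densities far from `r`,
vacuum included (`IsPressure.exists_pressureDefect_le`). Grönwall's lemma makes the relative energy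
vanish at almost every time. Equality at every time follows because both solutions then have the
same weak fluxes and the same data at `τ₁`, so their density and momentum slices have equal
integrals against all smooth periodic functions (`IsBoundedWeakSolution.eq_of_ae_eq`). -/

namespace BarotropicEuler

/-! ### Mollification: convergence and bounds for values and derivatives. -/

section Mollify

open scoped Convolution
open Metric

variable {E : Type*} [NormedAddCommGroup E] [NormedSpace ℝ E] [FiniteDimensional ℝ E]
  {F : Type*} [NormedAddCommGroup F] [NormedSpace ℝ F]

/-- Bump functions at the origin whose supports shrink to a point. -/
noncomputable def shrinkingBump (E : Type*) [NormedAddCommGroup E] [NormedSpace ℝ E] (n : ℕ) :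
    ContDiffBump (0 : E) where
  rIn := 1 / (2 * (n + 1))
  rOut := 1 / (n + 1)
  rIn_pos := by positivity
  rIn_lt_rOut := by
    have : (0 : ℝ) < n + 1 := by positivity
    exact one_div_lt_one_div_of_lt this (by linarith)

lemma shrinkingBump_rOut (n : ℕ) : (shrinkingBump E n).rOut = 1 / (n + 1) := rfl

lemma shrinkingBump_rOut_tendsto :
    Tendsto (fun n => (shrinkingBump E n).rOut) atTop (𝓝 0) :=
  tendsto_one_div_add_atTop_nhds_zero_nat

lemma shrinkingBump_rOut_le (n : ℕ) : (shrinkingBump E n).rOut ≤ 1 := by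
  rw [shrinkingBump_rOut, div_le_one (by positivity)]
  linarith [(Nat.cast_nonneg n : (0 : ℝ) ≤ n)]

/-- Comparable inner and outer radii are what the Lebesgue point argument behind
`ae_mollify_tendsto` requires. -/
lemma shrinkingBump_ratio (n : ℕ) :
    (shrinkingBump E n).rOut ≤ 2 * (shrinkingBump E n).rIn := by
  have : (0 : ℝ) < n + 1 := by positivity
  change 1 / ((n : ℝ) + 1) ≤ 2 * (1 / (2 * (n + 1)))
  apply le_of_eq
  field_simp

variable [MeasurableSpace E] [BorelSpace E]

/-- The convolution of `f` with the `n`-th normalized bump function. -/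
noncomputable def mollify (μ : Measure E) (n : ℕ) (f : E → F) : E → F :=
  (shrinkingBump E n).normed μ ⋆[ContinuousLinearMap.lsmul ℝ ℝ, μ] f

variable {μ : Measure E} [μ.IsAddHaarMeasure] {f g : E → F} {n : ℕ}

lemma mollify_apply (x : E) :
    mollify μ n f x = ∫ y, (shrinkingBump E n).normed μ y • f (x - y) ∂μ := rfl

lemma mollify_integrable (hf : LocallyIntegrable f μ) (x : E) :
    Integrable (fun y => (shrinkingBump E n).normed μ y • f (x - y)) μ :=
  (shrinkingBump E n).hasCompactSupport_normed.convolutionExists_left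
    (ContinuousLinearMap.lsmul ℝ ℝ) (shrinkingBump E n).continuous_normed hf x

lemma contDiff_mollify [CompleteSpace F] (hf : LocallyIntegrable f μ) :
    ContDiff ℝ ∞ (mollify μ n f) :=
  (shrinkingBump E n).hasCompactSupport_normed.contDiff_convolution_left _
    (shrinkingBump E n).contDiff_normed hf

lemma mollify_periodic {c : E} (hf : ∀ x, f (x + c) = f x) (x : E) :
    mollify μ n f (x + c) = mollify μ n f x := by
  rw [mollify_apply, mollify_apply]
  congr 1 with y
  rw [add_sub_right_comm, hf]

/-- Averages over the support of the bump function obey pointwise bounds. -/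
lemma norm_mollifier_integral_le {h : E → F} {C : ℝ}
    (hC : ∀ y, ‖y‖ < (shrinkingBump E n).rOut → ‖h y‖ ≤ C) :
    ‖∫ y, (shrinkingBump E n).normed μ y • h y ∂μ‖ ≤ C := by
  calc ‖∫ y, (shrinkingBump E n).normed μ y • h y ∂μ‖
      ≤ ∫ y, (shrinkingBump E n).normed μ y * C ∂μ := by
        refine norm_integral_le_of_norm_le
          ((shrinkingBump E n).integrable_normed.mul_const C) (ae_of_all _ fun y => ?_)
        have h0 := (shrinkingBump E n).nonneg_normed (μ := μ) y
        rw [norm_smul, Real.norm_of_nonneg h0]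
        by_cases hy : ‖y‖ < (shrinkingBump E n).rOut
        · exact mul_le_mul_of_nonneg_left (hC y hy) h0
        · have : (shrinkingBump E n).normed μ y = 0 := by
            rw [← Function.notMem_support, ContDiffBump.support_normed_eq]
            simpa using hy
          simp [this]
    _ = C := by rw [integral_mul_const, ContDiffBump.integral_normed, one_mul]

lemma norm_mollify_le {C : ℝ} {x : E} (hC : ∀ y, dist y x < 1 → ‖f y‖ ≤ C) :
    ‖mollify μ n f x‖ ≤ C := by
  rw [mollify_apply]
  refine norm_mollifier_integral_le fun y hy => hC _ ?_
  simpa using hy.trans_le (shrinkingBump_rOut_le n)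

/-- If `f - A` has Lipschitz constant `K` on a set, so has its mollification minus `A` on every
set whose neighbourhood of the size of the mollifier lies in the first one. -/
lemma norm_mollify_sub_le [CompleteSpace F] (hf : LocallyIntegrable f μ) (A : E →L[ℝ] F) {K : ℝ}
    {s : Set E} (hK : ∀ x ∈ s, ∀ y ∈ s, ‖f x - f y - A (x - y)‖ ≤ K * ‖x - y‖) {x y : E}
    (hx : ball x (shrinkingBump E n).rOut ⊆ s) (hy : ball y (shrinkingBump E n).rOut ⊆ s) :
    ‖mollify μ n f x - mollify μ n f y - A (x - y)‖ ≤ K * ‖x - y‖ := by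
  have hA : A (x - y) = ∫ z, (shrinkingBump E n).normed μ z • A (x - y) ∂μ := by
    rw [integral_smul_const, ContDiffBump.integral_normed, one_smul]
  have hi : Integrable (fun z => (shrinkingBump E n).normed μ z • A (x - y)) μ :=
    (shrinkingBump E n).integrable_normed.smul_const _
  have hxy : Integrable (fun z => (shrinkingBump E n).normed μ z • f (x - z)
      - (shrinkingBump E n).normed μ z • f (y - z)) μ :=
    (mollify_integrable hf x).sub (mollify_integrable hf y)
  rw [hA, mollify_apply, mollify_apply,
    ← integral_sub (mollify_integrable hf x) (mollify_integrable hf y), ← integral_sub hxy hi]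
  simp only [← smul_sub]
  refine norm_mollifier_integral_le fun z hz => ?_
  have := hK (x - z) (hx (by simpa using hz)) (y - z) (hy (by simpa using hz))
  simpa using this

lemma mollify_tendsto (hf : Continuous f) [CompleteSpace F] (x : E) :
    Tendsto (fun n => mollify μ n f x) atTop (𝓝 (f x)) :=
  ContDiffBump.convolution_tendsto_right_of_continuous shrinkingBump_rOut_tendsto hf x

lemma ae_mollify_tendsto [CompleteSpace F] (hf : LocallyIntegrable f μ) :
    ∀ᵐ x ∂μ, Tendsto (fun n => mollify μ n f x) atTop (𝓝 (f x)) :=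
  ContDiffBump.ae_convolution_tendsto_right_of_locallyIntegrable shrinkingBump_rOut_tendsto
    (.of_forall shrinkingBump_ratio) hf

/-- Averaging preserves the Lipschitz constant of `f - A`, and a local Lipschitz constant bounds the
derivative. With `A = 0` this gives gradient bounds uniform in `n`; with `A` a strict derivative and
`K` small it gives convergence of gradients. -/
lemma norm_fderiv_mollify_sub_le [CompleteSpace F] (hf : LocallyIntegrable f μ)
    (A : E →L[ℝ] F) {K : ℝ} (hK0 : 0 ≤ K) {s : Set E} {x : E}
    (hK : ∀ x ∈ s, ∀ y ∈ s, ‖f x - f y - A (x - y)‖ ≤ K * ‖x - y‖) {δ : ℝ} (hδ : 0 < δ)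
    (hx : ball x (δ + (shrinkingBump E n).rOut) ⊆ s) :
    ‖fderiv ℝ (mollify μ n f) x - A‖ ≤ K := by
  have hd : HasFDerivAt (fun y => mollify μ n f y - A y) (fderiv ℝ (mollify μ n f) x - A) x :=
    (((contDiff_mollify hf).differentiable (by simp)) x).hasFDerivAt.sub A.hasFDerivAt
  refine hd.le_of_lip' hK0 ?_
  filter_upwards [ball_mem_nhds x hδ] with y hy
  have hsub : ∀ z, dist z x < δ → ball z (shrinkingBump E n).rOut ⊆ s := fun z hz w hw => by
    refine hx ?_
    have := dist_triangle w z x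
    rw [mem_ball] at hw ⊢
    linarith
  have := norm_mollify_sub_le hf A hK (hsub y hy) (hsub x (by simpa using hδ))
  rw [map_sub] at this
  convert this using 2
  abel

/-- At points of strict differentiability the derivatives of the mollifications converge. -/
lemma fderiv_mollify_tendsto [CompleteSpace F] (hf : LocallyIntegrable f μ) {A : E →L[ℝ] F} {x : E}
    (hA : HasStrictFDerivAt f A x) :
    Tendsto (fun n => fderiv ℝ (mollify μ n f) x) atTop (𝓝 A) := by
  rw [Metric.tendsto_atTop]
  intro ε hε
  have hε2 : (0 : ℝ) < ε / 2 := by positivity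
  -- Strict differentiability says that `f - A` has arbitrarily small Lipschitz constant near `x`;
  -- half of `ε` turns the later `≤` into `<`.
  obtain ⟨s, hs, happ⟩ := hA.approximates_deriv_on_nhds (c := ⟨ε / 2, hε2.le⟩)
    (Or.inr (by exact_mod_cast hε2))
  obtain ⟨δ, hδ, hball⟩ := Metric.mem_nhds_iff.1 hs
  have hev := (shrinkingBump_rOut_tendsto (E := E)).eventually (gt_mem_nhds (half_pos hδ))
  obtain ⟨N, hN⟩ := eventually_atTop.1 hev
  refine ⟨N, fun n hn => ?_⟩
  rw [dist_eq_norm]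
  have := norm_fderiv_mollify_sub_le (n := n) hf A hε2.le (s := s) (x := x)
    (fun y hy z hz => happ y hy z hz) (half_pos hδ)
    ((ball_subset_ball (by linarith [hN n hn])).trans hball)
  linarith

end Mollify

/-! ### The fundamental cell: divergence theorem on the torus and periodic extension. -/

section Cell

variable {N : ℕ}

lemma cell_eq_preimage (N : ℕ) :
    cell N = WithLp.ofLp ⁻¹' (Icc (fun _ => -1) (fun _ => 1) : Set (Fin N → ℝ)) := by
  ext x
  simp [cell, Pi.le_def, forall_and]

lemma isCompact_cell (N : ℕ) : IsCompact (cell N) := by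
  rw [cell_eq_preimage]
  exact (PiLp.homeomorph 2 (fun _ : Fin N => ℝ)).isCompact_preimage.2 isCompact_Icc

lemma measurableSet_cell (N : ℕ) : MeasurableSet (cell N) :=
  (isCompact_cell N).isClosed.measurableSet

instance (N : ℕ) : IsFiniteMeasure (cellMeasure N) :=
  ⟨by rw [cellMeasure, Measure.restrict_apply_univ]; exact (isCompact_cell N).measure_lt_top⟩

lemma ae_mem_cell (N : ℕ) : ∀ᵐ x ∂(cellMeasure N), x ∈ cell N :=
  ae_restrict_mem (measurableSet_cell N)

lemma exists_cell_subset_ball (N : ℕ) : ∃ R, 0 < R ∧ cell N ⊆ Metric.ball 0 R :=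
  (isCompact_cell N).isBounded.subset_ball_lt 0 0 |>.imp fun _ h => ⟨h.1, h.2⟩

lemma setIntegral_cell (g : Space N → ℝ) :
    ∫ x, g x ∂(cellMeasure N) = ∫ y in Icc (fun _ => -1) (fun _ => 1), g (WithLp.toLp 2 y) := by
  have h := (PiLp.volume_preserving_ofLp (Fin N)).setIntegral_preimage_emb
    (MeasurableEquiv.toLp 2 (Fin N → ℝ)).symm.measurableEmbedding
    (fun y => g (WithLp.toLp 2 y)) (Icc (fun _ => -1) (fun _ => 1))
  rw [cellMeasure, cell_eq_preimage, ← h]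

/-- The integral over the torus of a divergence vanishes. -/
lemma integral_divergence_eq_zero {V : Space N → Space N} (hV : Differentiable ℝ V)
    (hper : IsPeriodic V) (hint : Integrable (divergence V) (cellMeasure N)) :
    ∫ x, divergence V x ∂(cellMeasure N) = 0 := by
  -- The divergence theorem on boxes is stated over `Fin (n + 1)`; over `Fin 0` the divergence is an
  -- empty sum.
  obtain _ | n := N
  · simp [divergence]
  let Λ := PiLp.continuousLinearEquiv 2 ℝ (fun _ : Fin (n + 1) => ℝ)
  let f : (Fin (n + 1) → ℝ) → (Fin (n + 1) → ℝ) := fun y => Λ (V (Λ.symm y))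
  let f' : (Fin (n + 1) → ℝ) → (Fin (n + 1) → ℝ) →L[ℝ] (Fin (n + 1) → ℝ) := fun y =>
    (Λ : _ →L[ℝ] _).comp ((fderiv ℝ V (Λ.symm y)).comp (Λ.symm : _ →L[ℝ] _))
  have hf : ∀ y, HasFDerivAt f (f' y) y := fun y =>
    Λ.hasFDerivAt.comp y (((hV _).hasFDerivAt).comp y Λ.symm.hasFDerivAt)
  have hdiv : ∀ y, ∑ i, f' y (Pi.single i 1) i = divergence V (WithLp.toLp 2 y) := fun y => rfl
  have hle : (fun _ => -1 : Fin (n + 1) → ℝ) ≤ fun _ => 1 := fun _ => by norm_num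
  have hint' : IntegrableOn (fun y => ∑ i, f' y (Pi.single i 1) i)
      (Icc (fun _ => -1) (fun _ => 1)) := by
    simp only [hdiv]
    rw [← (PiLp.volume_preserving_ofLp (Fin (n + 1))).integrableOn_comp_preimage
      (MeasurableEquiv.toLp 2 (Fin (n + 1) → ℝ)).symm.measurableEmbedding, ← cell_eq_preimage]
    exact hint
  have key := integral_divergence_of_hasFDerivAt_off_countable (fun _ => -1) (fun _ => 1) hle f f'
    ∅ countable_empty (fun y _ => (hf y).continuousAt.continuousWithinAt) (fun y _ => hf y) hint'
  rw [setIntegral_cell]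
  simp only [hdiv] at key
  rw [key]
  refine Finset.sum_eq_zero fun i _ => sub_eq_zero.2 ?_
  congr 1 with y
  -- Opposite faces of the cell differ by one period, so their boundary integrals cancel.
  have hsh : Λ.symm (Fin.insertNth i (1 : ℝ) y)
      = Λ.symm (Fin.insertNth i (-1 : ℝ) y) + (2 : ℝ) • unitVec i := by
    ext j
    rcases Fin.eq_self_or_eq_succAbove i j with rfl | ⟨k, rfl⟩
    · simp [Λ, unitVec]; norm_num
    · simp [Λ, unitVec, Fin.succAbove_ne]
  change Λ (V (Λ.symm _)) i = Λ (V (Λ.symm _)) i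
  rw [hsh, hper]

/-- The representative in `[-1,1)^N` of a point of the torus. -/
noncomputable def wrap (x : Space N) : Space N :=
  WithLp.toLp 2 fun i => toIcoMod (two_pos : (0 : ℝ) < 2) (-1) (x i)

lemma measurable_wrap : Measurable (wrap : Space N → Space N) := by
  refine (PiLp.continuous_toLp 2 _).measurable.comp (measurable_pi_lambda _ fun i => ?_)
  have h1 : Measurable (fun a : ℝ => toIcoMod (two_pos : (0 : ℝ) < 2) (-1) a) := by
    have : (fun a : ℝ => toIcoMod (two_pos : (0 : ℝ) < 2) (-1) a)
        = fun a => -1 + Int.fract ((a - -1) / 2) * 2 := by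
      ext a; rw [toIcoMod_eq_add_fract_mul]
    rw [this]
    fun_prop
  exact h1.comp (by fun_prop)

lemma wrap_mem_cell (x : Space N) : wrap x ∈ cell N := fun i => by
  have := toIcoMod_mem_Ico (two_pos : (0 : ℝ) < 2) (-1) (x i)
  refine ⟨this.1, ?_⟩
  have h2 := this.2
  change toIcoMod (two_pos : (0 : ℝ) < 2) (-1) (x i) ≤ 1
  linarith

lemma isPeriodic_wrap : IsPeriodic (wrap : Space N → Space N) := fun i x => by
  ext j
  by_cases h : j = i
  · subst h
    simp [wrap, unitVec]
  · simp [wrap, unitVec, h]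

/-- Only cell points with some coordinate equal to `1` are moved, and the half-open and closed boxes
differ by a null set. -/
lemma ae_wrap_eq (N : ℕ) : ∀ᵐ x ∂(cellMeasure N), wrap x = x := by
  have h : ∀ᵐ y ∂(volume.restrict (Icc (fun _ => -1) (fun _ => 1) : Set (Fin N → ℝ))),
      ∀ i, y i ∈ Ico (-1 : ℝ) 1 := by
    have h2 : (pi univ fun _ => Ico (-1) 1 : Set (Fin N → ℝ)) =ᵐ[volume]
      Icc (fun _ => -1) (fun _ => 1) :=
        Measure.univ_pi_Ico_ae_eq_Icc (f := fun _ => -1) (g := fun _ => 1)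
    rw [← Measure.restrict_congr_set h2]
    refine (ae_restrict_mem (MeasurableSet.univ_pi fun _ => measurableSet_Ico)).mono ?_
    intro y hy i
    exact hy i trivial
  have hmp := (PiLp.volume_preserving_ofLp (Fin N)).restrict_preimage_emb
    (MeasurableEquiv.toLp 2 (Fin N → ℝ)).symm.measurableEmbedding
    (Icc (fun _ => -1) (fun _ => 1))
  rw [← cell_eq_preimage] at hmp
  have := hmp.quasiMeasurePreserving.ae h
  filter_upwards [this] with x hx
  ext i
  have hi := hx i
  have h3 : Ico (-1 : ℝ) 1 = Ico (-1) (-1 + 2) := by norm_num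
  exact (toIcoMod_eq_self (two_pos : (0 : ℝ) < 2)).2 (h3 ▸ hi)

end Cell

/-! ### Space-time derivatives and smoothing of `C¹` test functions. -/

section TestFunctions

variable {N : ℕ} {F : Type*} [NormedAddCommGroup F] [NormedSpace ℝ F]

/-- The space-time derivative. -/
noncomputable def stDeriv (φ : ℝ → Space N → F) (t : ℝ) (x : Space N) : ℝ × Space N →L[ℝ] F :=
  fderiv ℝ (Function.uncurry φ) (t, x)

/-- The spatial divergence, read off from the space-time derivative of a vector field. -/
noncomputable def spaceDiv (L : ℝ × Space N →L[ℝ] Space N) : ℝ := ∑ j, L (0, unitVec j) j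

lemma hasDerivAt_slice {φ : ℝ → Space N → F} {t : ℝ} {x : Space N}
    (h : DifferentiableAt ℝ (Function.uncurry φ) (t, x)) :
    HasDerivAt (fun s => φ s x) (stDeriv φ t x (1, 0)) t := by
  have h1 : HasFDerivAt (fun s : ℝ => (s, x)) (ContinuousLinearMap.inl ℝ ℝ (Space N)) t :=
    hasFDerivAt_prodMk_left t x
  have h2 : HasFDerivAt (fun s => φ s x)
      ((stDeriv φ t x).comp (ContinuousLinearMap.inl ℝ ℝ (Space N))) t :=
    HasFDerivAt.comp (g := Function.uncurry φ) t h.hasFDerivAt h1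
  simpa using h2.hasDerivAt

lemma hasFDerivAt_slice {φ : ℝ → Space N → F} {t : ℝ} {x : Space N}
    (h : DifferentiableAt ℝ (Function.uncurry φ) (t, x)) :
    HasFDerivAt (φ t) ((stDeriv φ t x).comp (ContinuousLinearMap.inr ℝ ℝ (Space N))) x :=
  HasFDerivAt.comp (g := Function.uncurry φ) x h.hasFDerivAt (hasFDerivAt_prodMk_right t x)

lemma fderiv_slice_apply {φ : ℝ → Space N → F} {t : ℝ} {x : Space N}
    (h : DifferentiableAt ℝ (Function.uncurry φ) (t, x)) (v : Space N) :
    fderiv ℝ (φ t) x v = stDeriv φ t x (0, v) := by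
  rw [(hasFDerivAt_slice h).fderiv]; rfl

lemma divergence_slice {φ : ℝ → Space N → Space N} {t : ℝ} {x : Space N}
    (h : DifferentiableAt ℝ (Function.uncurry φ) (t, x)) :
    divergence (φ t) x = spaceDiv (stDeriv φ t x) := by
  simp only [divergence, spaceDiv, fderiv_slice_apply h]

lemma stDeriv_add (φ : ℝ → Space N → F) (t : ℝ) (x v : Space N) :
    stDeriv φ t x (1, v) = stDeriv φ t x (1, 0) + stDeriv φ t x (0, v) := by
  rw [← map_add]; simp

lemma abs_spaceDiv_le {L : ℝ × Space N →L[ℝ] Space N} {K : ℝ} (hL : ‖L‖ ≤ K) :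
    |spaceDiv L| ≤ N * K := by
  refine (Finset.abs_sum_le_sum_abs _ _).trans ?_
  calc ∑ j, |L (0, unitVec j) j| ≤ ∑ _j : Fin N, K := by
        refine Finset.sum_le_sum fun j _ => ?_
        have h1 : |L (0, unitVec j) j| ≤ ‖L (0, unitVec j)‖ := by
          simpa using PiLp.norm_apply_le (L (0, unitVec j)) j
        have h2 := L.le_opNorm (0, unitVec j)
        have h3 : ‖((0 : ℝ), (unitVec j : Space N))‖ = 1 := by
          simp [Prod.norm_def, unitVec]
        rw [h3, mul_one] at h2
        exact h1.trans (h2.trans hL)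
    _ = N * K := by simp

lemma continuous_spaceDiv : Continuous (spaceDiv : (ℝ × Space N →L[ℝ] Space N) → ℝ) := by
  unfold spaceDiv
  fun_prop

/-- Test functions that are locally Lipschitz and bounded, uniformly in time, and continuously
differentiable for times in `(a,b)`. -/
structure IsC1Test (a b : ℝ) (φ : ℝ → Space N → F) : Prop where
  continuous : Continuous (Function.uncurry φ)
  lipschitz : ∀ R : ℝ, ∃ K, LipschitzOnWith K (Function.uncurry φ) (univ ×ˢ Metric.ball 0 R)
  bounded : ∀ R : ℝ, ∃ C, ∀ t, ∀ x ∈ Metric.ball (0 : Space N) R, ‖φ t x‖ ≤ C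
  periodic : ∀ t, IsPeriodic (φ t)
  contDiffAt : ∀ t ∈ Ioo a b, ∀ x, ContDiffAt ℝ 1 (Function.uncurry φ) (t, x)

lemma IsC1Test.exists_norm_le {a b : ℝ} {φ : ℝ → Space N → F} (h : IsC1Test a b φ) :
    ∃ C, ∀ t, ∀ x ∈ cell N, ‖φ t x‖ ≤ C := by
  obtain ⟨R, -, hR⟩ := exists_cell_subset_ball N
  obtain ⟨C, hC⟩ := h.bounded R
  exact ⟨C, fun t x hx => hC t x (hR hx)⟩

/-- The local Lipschitz constant bounds `fderiv` at every time, even where differentiability may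
fail and `fderiv` takes its default value `0`. -/
lemma IsC1Test.exists_norm_stDeriv_le {a b : ℝ} {φ : ℝ → Space N → F} (h : IsC1Test a b φ) :
    ∃ C, ∀ t, ∀ x ∈ cell N, ‖stDeriv φ t x‖ ≤ C := by
  obtain ⟨R, -, hR⟩ := exists_cell_subset_ball N
  obtain ⟨K, hK⟩ := h.lipschitz R
  refine ⟨K, fun t x hx => ?_⟩
  refine norm_fderiv_le_of_lipschitzOn ℝ ?_ hK
  exact prod_mem_nhds univ_mem (Metric.isOpen_ball.mem_nhds (hR hx))

lemma measurable_stDeriv [CompleteSpace F] (φ : ℝ → Space N → F) :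
    Measurable fun z : ℝ × Space N => stDeriv φ z.1 z.2 :=
  measurable_fderiv ℝ (Function.uncurry φ)

lemma measurable_stDeriv_apply [CompleteSpace F] [MeasurableSpace F] [BorelSpace F]
    (φ : ℝ → Space N → F) {v : ℝ × Space N → ℝ × Space N} (hv : Measurable v) :
    Measurable fun z : ℝ × Space N => stDeriv φ z.1 z.2 (v z) :=
  (ContinuousLinearMap.measurable_apply₂ (𝕜 := ℝ) (E := ℝ × Space N) (F := F)).comp
    ((measurable_stDeriv φ).prodMk hv)

lemma measurable_spaceDiv_stDeriv (φ : ℝ → Space N → Space N) :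
    Measurable fun z : ℝ × Space N => spaceDiv (stDeriv φ z.1 z.2) :=
  continuous_spaceDiv.measurable.comp (measurable_stDeriv φ)

instance isAddHaarMeasure_spaceTime (N : ℕ) :
    (volume : Measure (ℝ × Space N)).IsAddHaarMeasure :=
  inferInstanceAs (((volume : Measure ℝ).prod (volume : Measure (Space N))).IsAddHaarMeasure)

/-- The mollified test function. -/
noncomputable def mollifyTest (n : ℕ) (φ : ℝ → Space N → F) : ℝ → Space N → F :=
  fun t x => mollify volume n (Function.uncurry φ) (t, x)

lemma IsC1Test.isTest_mollify [CompleteSpace F] {a b : ℝ} {φ : ℝ → Space N → F}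
    (h : IsC1Test a b φ) (n : ℕ) : IsTest (mollifyTest n φ) where
  smooth := contDiff_mollify h.continuous.locallyIntegrable
  periodic t i x := by
    have := mollify_periodic (μ := volume) (n := n) (f := Function.uncurry φ)
      (c := ((0 : ℝ), (2 : ℝ) • unitVec i)) (fun z => by
        have := h.periodic z.1 i z.2
        simpa [Function.uncurry] using this) (t, x)
    simpa [mollifyTest] using this

lemma IsC1Test.mollify_tendsto [CompleteSpace F] {a b : ℝ} {φ : ℝ → Space N → F}
    (h : IsC1Test a b φ) (t : ℝ) (x : Space N) :
    Tendsto (fun n => mollifyTest n φ t x) atTop (𝓝 (φ t x)) :=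
  BarotropicEuler.mollify_tendsto h.continuous (t, x)

lemma IsC1Test.stDeriv_mollify_tendsto [CompleteSpace F] {a b : ℝ} {φ : ℝ → Space N → F}
    (h : IsC1Test a b φ) {t : ℝ} (ht : t ∈ Ioo a b) (x : Space N) :
    Tendsto (fun n => stDeriv (mollifyTest n φ) t x) atTop (𝓝 (stDeriv φ t x)) :=
  fderiv_mollify_tendsto h.continuous.locallyIntegrable
    ((h.contDiffAt t ht x).hasStrictFDerivAt (by simp))

lemma IsC1Test.exists_norm_mollify_le {a b : ℝ} {φ : ℝ → Space N → F} (h : IsC1Test a b φ) :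
    ∃ C, ∀ n t, ∀ x ∈ cell N, ‖mollifyTest n φ t x‖ ≤ C := by
  obtain ⟨R, -, hR⟩ := exists_cell_subset_ball N
  obtain ⟨C, hC⟩ := h.bounded (R + 1)
  refine ⟨C, fun n t x hx => norm_mollify_le fun y hy => hC y.1 y.2 ?_⟩
  have h1 := hR hx
  have h2 : dist y.2 x < 1 := (le_max_right _ _).trans_lt hy
  rw [Metric.mem_ball] at h1 ⊢
  linarith [dist_triangle y.2 x 0]

lemma IsC1Test.exists_norm_stDeriv_mollify_le [CompleteSpace F] {a b : ℝ} {φ : ℝ → Space N → F}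
    (h : IsC1Test a b φ) :
    ∃ C, ∀ n t, ∀ x ∈ cell N, ‖stDeriv (mollifyTest n φ) t x‖ ≤ C := by
  obtain ⟨R, -, hR⟩ := exists_cell_subset_ball N
  -- One unit of room is for the radius of the mollifier, the other for the `δ = 1` in
  -- `norm_fderiv_mollify_sub_le`.
  obtain ⟨K, hK⟩ := h.lipschitz (R + 2)
  refine ⟨K, fun n t x hx => ?_⟩
  have := norm_fderiv_mollify_sub_le (n := n) (μ := volume) (x := ((t, x) : ℝ × Space N))
    h.continuous.locallyIntegrable 0 K.2 (s := univ ×ˢ Metric.ball 0 (R + 2))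
    (fun y hy z hz => by simpa [dist_eq_norm] using hK.dist_le_mul y hy z hz) one_pos ?_
  · rw [sub_zero] at this
    exact this
  · intro y hy
    refine ⟨trivial, ?_⟩
    have h1 := hR hx
    have h2 : dist y.2 x < 1 + (shrinkingBump (ℝ × Space N) n).rOut :=
      (le_max_right _ _).trans_lt hy
    have h3 := shrinkingBump_rOut_le (E := ℝ × Space N) n
    rw [Metric.mem_ball] at h1 ⊢
    linarith [dist_triangle y.2 x 0]

/-- Freezing a function of time outside `[a,b]`. -/
def clampTime {α : Type*} (a b : ℝ) (g : ℝ → α) : ℝ → α := fun t => g (max a (min t b))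

lemma clampTime_of_mem {α : Type*} {a b : ℝ} (g : ℝ → α) {t : ℝ} (ht : t ∈ Icc a b) :
    clampTime a b g t = g t := by
  rw [clampTime, min_eq_left ht.2, max_eq_right ht.1]

lemma clamp_mem {a b : ℝ} (hab : a ≤ b) (t : ℝ) : max a (min t b) ∈ Icc a b :=
  ⟨le_max_left _ _, max_le hab (min_le_right _ _)⟩

lemma clampTime_eventuallyEq {a b : ℝ} (g : ℝ → Space N → F) {t : ℝ} (ht : t ∈ Ioo a b)
    (x : Space N) :
    Function.uncurry (clampTime a b g) =ᶠ[𝓝 (t, x)] Function.uncurry g := by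
  have : ∀ᶠ z : ℝ × Space N in 𝓝 (t, x), z.1 ∈ Ioo a b :=
    continuous_fst.continuousAt.eventually (isOpen_Ioo.mem_nhds ht)
  filter_upwards [this] with z hz
  simp only [Function.uncurry, clampTime_of_mem g (Ioo_subset_Icc_self hz)]

lemma stDeriv_clampTime {a b : ℝ} (g : ℝ → Space N → F) {t : ℝ} (ht : t ∈ Ioo a b)
    (x : Space N) : stDeriv (clampTime a b g) t x = stDeriv g t x :=
  (clampTime_eventuallyEq g ht x).fderiv_eq

/-- Clamping time is 1-Lipschitz, so the extension inherits the Lipschitz constants of `g` on the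
compact convex sets `[a,b]` times a ball. It may have corners at `a` and `b`, which is why
`IsC1Test` asks for `C¹` only in between. -/
lemma isC1Test_clampTime {a b : ℝ} (hab : a < b) {g : ℝ → Space N → F}
    (hg : ContDiffOn ℝ 1 (Function.uncurry g) (Icc a b ×ˢ univ))
    (hper : ∀ t ∈ Icc a b, IsPeriodic (g t)) : IsC1Test a b (clampTime a b g) := by
  let κ : ℝ × Space N → ℝ × Space N := fun z => (max a (min z.1 b), z.2)
  have hκ : LipschitzWith 1 κ := by
    refine LipschitzWith.of_dist_le_mul fun z w => ?_
    simp only [NNReal.coe_one, one_mul, κ]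
    refine max_le_max ?_ le_rfl
    change |max a (min z.1 b) - max a (min w.1 b)| ≤ |z.1 - w.1|
    refine (abs_max_sub_max_le_max _ _ _ _).trans (max_le (by simp) ?_)
    exact (abs_min_sub_min_le_max _ _ _ _).trans (max_le le_rfl (by simp))
  have hmem : ∀ z, κ z ∈ Icc a b ×ˢ (univ : Set (Space N)) := fun z =>
    ⟨clamp_mem hab.le _, trivial⟩
  have hcl : ∀ R, IsCompact (Icc a b ×ˢ Metric.closedBall (0 : Space N) R) := fun R =>
    isCompact_Icc.prod (isCompact_closedBall _ _)
  have hsub : ∀ R, Icc a b ×ˢ Metric.closedBall (0 : Space N) R ⊆ Icc a b ×ˢ univ := fun R =>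
    prod_mono_right (subset_univ _)
  refine ⟨?_, fun R => ?_, fun R => ?_, fun t => hper _ (clamp_mem hab.le t), fun t ht x => ?_⟩
  · exact hg.continuousOn.comp_continuous hκ.continuous hmem
  · obtain ⟨K, hK⟩ := (hg.mono (hsub R)).exists_lipschitzOnWith (by simp)
      ((convex_Icc a b).prod (convex_closedBall 0 R)) (hcl R)
    refine ⟨K * 1, ?_⟩
    refine hK.comp (f := κ) hκ.lipschitzOnWith ?_
    intro z hz
    exact ⟨clamp_mem hab.le _, Metric.ball_subset_closedBall hz.2⟩
  · obtain ⟨C, hC⟩ := (hcl R).exists_bound_of_continuousOn (hg.continuousOn.mono (hsub R))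
    exact ⟨C, fun t x hx => hC (κ (t, x))
      ⟨clamp_mem hab.le _, Metric.ball_subset_closedBall hx⟩⟩
  · refine ContDiffAt.congr_of_eventuallyEq ?_ (clampTime_eventuallyEq g ht x)
    exact hg.contDiffAt (prod_mem_nhds (Icc_mem_nhds ht.1 ht.2) univ_mem)

lemma IsTest.differentiableAt {φ : ℝ → Space N → F} (h : IsTest φ) (z : ℝ × Space N) :
    DifferentiableAt ℝ (Function.uncurry φ) z :=
  h.smooth.differentiable (by simp) z

end TestFunctions

/-! ### Bounded representatives and the weak equations with `C¹` tests. -/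

section WeakForm

variable {N : ℕ}

/-- The measure `dt dx` on `(a,b] × Ω`. -/
noncomputable def stMeasure (N : ℕ) (a b : ℝ) : Measure (ℝ × Space N) :=
  (volume.restrict (Ioc a b)).prod (cellMeasure N)

instance (a b : ℝ) : IsFiniteMeasure (stMeasure N a b) := by
  unfold stMeasure; infer_instance

lemma ae_stMeasure_of_ae_ae {a b : ℝ} {P : ℝ × Space N → Prop}
    (hP : MeasurableSet {z | P z})
    (h : ∀ᵐ t, t ∈ Ioo a b → ∀ᵐ x ∂(cellMeasure N), P (t, x)) :
    ∀ᵐ z ∂(stMeasure N a b), P z := by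
  have : ∀ᵐ t ∂(volume.restrict (Ioc a b)), ∀ᵐ x ∂(cellMeasure N), P (t, x) := by
    rw [← restrict_Ioo_eq_restrict_Ioc]
    exact (ae_restrict_iff' measurableSet_Ioo).2 h
  exact (Measure.ae_prod_iff_ae_ae hP).2 this

lemma ae_stMeasure_mem (a b : ℝ) :
    ∀ᵐ z ∂(stMeasure N a b), z.1 ∈ Ioo a b ∧ z.2 ∈ cell N := by
  have h1 : ∀ᵐ z ∂(stMeasure N a b), z.1 ∈ Ioo a b := by
    have : ∀ᵐ t ∂(volume.restrict (Ioc a b)), t ∈ Ioo a b := by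
      rw [← restrict_Ioo_eq_restrict_Ioc]; exact ae_restrict_mem measurableSet_Ioo
    exact Measure.quasiMeasurePreserving_fst.ae this
  have h2 : ∀ᵐ z ∂(stMeasure N a b), z.2 ∈ cell N :=
    Measure.quasiMeasurePreserving_snd.ae (ae_mem_cell N)
  exact h1.and h2

lemma integrable_cell_of_bound {F : Type*} [NormedAddCommGroup F] {f : Space N → F}
    (hf : AEStronglyMeasurable f (cellMeasure N)) {C : ℝ} (hC : ∀ x ∈ cell N, ‖f x‖ ≤ C) :
    Integrable f (cellMeasure N) :=
  Integrable.of_bound hf C ((ae_mem_cell N).mono hC)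

lemma integrable_stMeasure_of_bound {a b : ℝ} {f : ℝ × Space N → ℝ}
    (hf : AEStronglyMeasurable f (stMeasure N a b)) {C : ℝ}
    (hC : ∀ t ∈ Ioo a b, ∀ x ∈ cell N, ‖f (t, x)‖ ≤ C) : Integrable f (stMeasure N a b) :=
  Integrable.of_bound hf C ((ae_stMeasure_mem a b).mono fun z hz => hC z.1 hz.1 z.2 hz.2)

lemma intervalIntegral_eq_stMeasure {a b : ℝ} (hab : a ≤ b) {f : ℝ → Space N → ℝ}
    (hf : Integrable (Function.uncurry f) (stMeasure N a b)) :
    ∫ t in a..b, ∫ x, f t x ∂(cellMeasure N) = ∫ z, f z.1 z.2 ∂(stMeasure N a b) := by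
  rw [intervalIntegral.integral_of_le hab]
  exact (integral_prod (Function.uncurry f) hf).symm

lemma intervalIntegrable_of_stMeasure {a b : ℝ} (hab : a ≤ b) {f : ℝ → Space N → ℝ}
    (hf : Integrable (Function.uncurry f) (stMeasure N a b)) :
    IntervalIntegrable (fun t => ∫ x, f t x ∂(cellMeasure N)) volume a b :=
  (intervalIntegrable_iff_integrableOn_Ioc_of_le hab).2 hf.integral_prod_left

/-- Passage to the limit in a family of integrated conservation laws. -/
lemma conservation_limit {T a b τ : ℝ} (ha : 0 ≤ a) (hbT : b ≤ T) (hτ : τ ∈ Icc a b)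
    {S Q : ℕ → ℝ → Space N → ℝ} {S₀ Q₀ : ℝ → Space N → ℝ}
    (hS : ∀ n t, Measurable (S n t)) (hQ : ∀ n, Measurable (Function.uncurry (Q n)))
    {C : ℝ} (hSC : ∀ n t, ∀ x ∈ cell N, |S n t x| ≤ C) (hQC : ∀ n t, ∀ x ∈ cell N, |Q n t x| ≤ C)
    (hSlim : ∀ t x, Tendsto (fun n => S n t x) atTop (𝓝 (S₀ t x)))
    (hQlim : ∀ t ∈ Ioo a b, ∀ x, Tendsto (fun n => Q n t x) atTop (𝓝 (Q₀ t x)))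
    (hlaw : ∀ n, ∀ t ∈ Icc 0 T, ∫ x, (S n t x - S n 0 x) ∂(cellMeasure N)
      = ∫ s in (0 : ℝ)..t, ∫ x, Q n s x ∂(cellMeasure N)) :
    ∫ x, S₀ τ x ∂(cellMeasure N) - ∫ x, S₀ a x ∂(cellMeasure N)
      = ∫ z, Q₀ z.1 z.2 ∂(stMeasure N a τ) := by
  have hSi : ∀ n t, Integrable (S n t) (cellMeasure N) := fun n t =>
    integrable_cell_of_bound (hS n t).aestronglyMeasurable (hSC n t)
  have hQi : ∀ n a b, Integrable (Function.uncurry (Q n)) (stMeasure N a b) := fun n a b =>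
    integrable_stMeasure_of_bound (hQ n).aestronglyMeasurable fun t _ => hQC n t
  -- The laws all start at time `0`; subtracting the one at `a` from the one at `τ` localizes to
  -- `(a,τ]`, where the limit of `Q n` is known.
  have hn : ∀ n, ∫ x, S n τ x ∂(cellMeasure N) - ∫ x, S n a x ∂(cellMeasure N)
      = ∫ z, Q n z.1 z.2 ∂(stMeasure N a τ) := by
    intro n
    have h1 := hlaw n τ ⟨ha.trans hτ.1, hτ.2.trans hbT⟩
    have h2 := hlaw n a ⟨ha, (hτ.1.trans hτ.2).trans hbT⟩
    rw [integral_sub (hSi n _) (hSi n _)] at h1 h2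
    rw [← intervalIntegral_eq_stMeasure hτ.1 (hQi n a τ),
      ← intervalIntegral.integral_interval_sub_left
        (intervalIntegrable_of_stMeasure (ha.trans hτ.1) (hQi n 0 τ))
        (intervalIntegrable_of_stMeasure ha (hQi n 0 a)), ← h1, ← h2]
    ring
  have hSl : ∀ t, Tendsto (fun n => ∫ x, S n t x ∂(cellMeasure N)) atTop
      (𝓝 (∫ x, S₀ t x ∂(cellMeasure N))) := fun t =>
    tendsto_integral_of_dominated_convergence (fun _ => C)
      (fun n => (hS n t).aestronglyMeasurable) (integrable_const C)
      (fun n => (ae_mem_cell N).mono (hSC n t)) (ae_of_all _ (hSlim t))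
  have hQl : Tendsto (fun n => ∫ z, Q n z.1 z.2 ∂(stMeasure N a τ)) atTop
      (𝓝 (∫ z, Q₀ z.1 z.2 ∂(stMeasure N a τ))) := by
    refine tendsto_integral_of_dominated_convergence (fun _ => C)
      (fun n => (hQ n).aestronglyMeasurable) (integrable_const C)
      (fun n => (ae_stMeasure_mem a τ).mono fun z hz => hQC n z.1 z.2 hz.2) ?_
    filter_upwards [ae_stMeasure_mem a τ] with z hz
    exact hQlim z.1 ⟨hz.1.1, hz.1.2.trans_le hτ.2⟩ z.2
  refine tendsto_nhds_unique ((hSl τ).sub (hSl a)) ?_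
  simpa only [hn] using hQl

/-- Measurable states with pointwise bounds. -/
structure IsBoundedState (C : ℝ) (ρ : ℝ → Space N → ℝ) (u : ℝ → Space N → Space N) : Prop where
  measurable_density : Measurable (Function.uncurry ρ)
  measurable_velocity : Measurable (Function.uncurry u)
  nonneg : ∀ t x, 0 ≤ ρ t x
  le : ∀ t x, ρ t x ≤ C
  norm_le : ∀ t x, ‖u t x‖ ≤ C

lemma IsBoundedState.const_nonneg {C : ℝ} {ρ : ℝ → Space N → ℝ} {u : ℝ → Space N → Space N}
    (h : IsBoundedState C ρ u) : 0 ≤ C :=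
  (h.nonneg 0 0).trans (h.le 0 0)

/-- Nothing is known about `p` at negative arguments, so it is replaced by the continuous function
`z ↦ p (max z 0)`. -/
lemma measurable_comp_of_continuousOn_Ici {α : Type*} [MeasurableSpace α] {p : ℝ → ℝ}
    (hp : ContinuousOn p (Ici 0)) {f : α → ℝ} (hf : Measurable f) (h0 : ∀ a, 0 ≤ f a) :
    Measurable fun a => p (f a) := by
  have hc : Continuous fun z => p (max z 0) :=
    hp.comp_continuous (by fun_prop) fun z => mem_Ici.2 (le_max_right _ _)
  have := hc.measurable.comp hf
  convert this using 2 with a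
  simp [max_eq_left (h0 a)]

lemma exists_bound_Icc {p : ℝ → ℝ} (hp : ContinuousOn p (Ici 0)) (C : ℝ) :
    ∃ M, 0 ≤ M ∧ ∀ z, 0 ≤ z → z ≤ C → |p z| ≤ M := by
  obtain ⟨M, hM⟩ := isCompact_Icc.exists_bound_of_continuousOn
    (hp.mono (Icc_subset_Ici_self : Icc 0 C ⊆ Ici 0))
  exact ⟨max M 0, le_max_right _ _, fun z h0 h1 => (hM z ⟨h0, h1⟩).trans (le_max_left _ _)⟩

/-- The integrand on the right-hand side of the weak continuity equation. -/
noncomputable def massFlux (ρ : ℝ → Space N → ℝ) (u : ℝ → Space N → Space N)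
    (φ : ℝ → Space N → ℝ) (t : ℝ) (x : Space N) : ℝ :=
  ρ t x * stDeriv φ t x (1, u t x)

/-- The integrand on the right-hand side of the weak momentum equation. -/
noncomputable def momentumFlux (p : ℝ → ℝ) (ρ : ℝ → Space N → ℝ) (u : ℝ → Space N → Space N)
    (φ : ℝ → Space N → Space N) (t : ℝ) (x : Space N) : ℝ :=
  ρ t x * ⟪u t x, stDeriv φ t x (1, u t x)⟫ + p (ρ t x) * spaceDiv (stDeriv φ t x)

section Bounds

variable {C : ℝ} {ρ : ℝ → Space N → ℝ} {u : ℝ → Space N → Space N} (h : IsBoundedState C ρ u)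
include h

lemma IsBoundedState.measurable_arg : Measurable fun z : ℝ × Space N => ((1 : ℝ), u z.1 z.2) :=
  measurable_const.prodMk h.measurable_velocity

lemma IsBoundedState.measurable_massFlux (φ : ℝ → Space N → ℝ) :
    Measurable (Function.uncurry (massFlux ρ u φ)) :=
  h.measurable_density.mul (measurable_stDeriv_apply φ h.measurable_arg)

lemma IsBoundedState.measurable_momentumFlux {p : ℝ → ℝ} (hp : ContinuousOn p (Ici 0))
    (φ : ℝ → Space N → Space N) : Measurable (Function.uncurry (momentumFlux p ρ u φ)) :=
  (h.measurable_density.mul (h.measurable_velocity.inner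
    (measurable_stDeriv_apply φ h.measurable_arg))).add
    ((measurable_comp_of_continuousOn_Ici hp h.measurable_density fun z => h.nonneg z.1 z.2).mul
      (measurable_spaceDiv_stDeriv φ))

lemma IsBoundedState.norm_stDeriv_apply_le {F : Type*} [NormedAddCommGroup F] [NormedSpace ℝ F]
    {L : ℝ × Space N →L[ℝ] F} {K : ℝ} (hL : ‖L‖ ≤ K) (t : ℝ) (x : Space N) :
    ‖L (1, u t x)‖ ≤ K * (1 + C) := by
  refine (L.le_opNorm _).trans ?_
  have h1 : ‖((1 : ℝ), u t x)‖ ≤ 1 + C := by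
    rw [Prod.norm_def]
    have := h.norm_le t x
    have := h.const_nonneg
    refine max_le ?_ ?_ <;> simp <;> linarith
  exact mul_le_mul hL h1 (norm_nonneg _) ((norm_nonneg _).trans hL)

lemma IsBoundedState.abs_massFlux_le {φ : ℝ → Space N → ℝ} {K t : ℝ} {x : Space N}
    (hL : ‖stDeriv φ t x‖ ≤ K) : |massFlux ρ u φ t x| ≤ C * (K * (1 + C)) := by
  rw [massFlux, abs_mul, abs_of_nonneg (h.nonneg t x)]
  exact mul_le_mul (h.le t x) (h.norm_stDeriv_apply_le hL t x) (abs_nonneg _) h.const_nonneg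

lemma IsBoundedState.abs_momentumFlux_le {p : ℝ → ℝ} {M : ℝ}
    (hM : ∀ z, 0 ≤ z → z ≤ C → |p z| ≤ M) {φ : ℝ → Space N → Space N} {K t : ℝ} {x : Space N}
    (hL : ‖stDeriv φ t x‖ ≤ K) :
    |momentumFlux p ρ u φ t x| ≤ C * (C * (K * (1 + C))) + M * (N * K) := by
  have hpρ := hM _ (h.nonneg t x) (h.le t x)
  refine (abs_add_le _ _).trans (add_le_add ?_ ?_)
  · rw [abs_mul, abs_of_nonneg (h.nonneg t x)]
    refine mul_le_mul (h.le t x) ?_ (abs_nonneg _) h.const_nonneg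
    refine (abs_real_inner_le_norm _ _).trans ?_
    exact mul_le_mul (h.norm_le t x) (h.norm_stDeriv_apply_le hL t x) (norm_nonneg _)
      h.const_nonneg
  · rw [abs_mul]
    exact mul_le_mul hpρ (abs_spaceDiv_le hL) (abs_nonneg _) ((abs_nonneg _).trans hpρ)

end Bounds

/-- Weak solutions with pointwise bounds, in terms of space-time derivatives of the tests. -/
structure IsBoundedWeakSolution (p : ℝ → ℝ) (T C : ℝ) (ρ : ℝ → Space N → ℝ)
    (u : ℝ → Space N → Space N) : Prop extends IsBoundedState C ρ u where
  mass : ∀ φ : ℝ → Space N → ℝ, IsTest φ → ∀ τ ∈ Icc 0 T,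
    ∫ x, (ρ τ x * φ τ x - ρ 0 x * φ 0 x) ∂(cellMeasure N) =
      ∫ t in (0 : ℝ)..τ, ∫ x, massFlux ρ u φ t x ∂(cellMeasure N)
  momentum : ∀ φ : ℝ → Space N → Space N, IsTest φ → ∀ τ ∈ Icc 0 T,
    ∫ x, (⟪ρ τ x • u τ x, φ τ x⟫ - ⟪ρ 0 x • u 0 x, φ 0 x⟫) ∂(cellMeasure N) =
      ∫ t in (0 : ℝ)..τ, ∫ x, momentumFlux p ρ u φ t x ∂(cellMeasure N)

lemma massFlux_eq {ρ : ℝ → Space N → ℝ} {u : ℝ → Space N → Space N} {φ : ℝ → Space N → ℝ}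
    {t : ℝ} {x : Space N} (h : DifferentiableAt ℝ (Function.uncurry φ) (t, x)) :
    massFlux ρ u φ t x
      = ρ t x * deriv (fun s => φ s x) t + ρ t x * fderiv ℝ (φ t) x (u t x) := by
  rw [(hasDerivAt_slice h).deriv, fderiv_slice_apply h, massFlux, stDeriv_add]
  ring

lemma momentumFlux_eq {p : ℝ → ℝ} {ρ : ℝ → Space N → ℝ} {u : ℝ → Space N → Space N}
    {φ : ℝ → Space N → Space N} {t : ℝ} {x : Space N}
    (h : DifferentiableAt ℝ (Function.uncurry φ) (t, x)) :
    momentumFlux p ρ u φ t x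
      = ⟪ρ t x • u t x, deriv (fun s => φ s x) t⟫
        + ρ t x * ⟪u t x, fderiv ℝ (φ t) x (u t x)⟫ + p (ρ t x) * divergence (φ t) x := by
  rw [(hasDerivAt_slice h).deriv, fderiv_slice_apply h, divergence_slice h, momentumFlux,
    stDeriv_add, inner_add_right, real_inner_smul_left]
  ring

/-- Modification on null sets turns a weak solution into one with pointwise bounds. -/
lemma IsWeakSolution.exists_bounded {p : ℝ → ℝ} {T : ℝ}
    {ρ : ℝ → Space N → ℝ} {u : ℝ → Space N → Space N} (h : IsWeakSolution p T ρ u) :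
    ∃ C ρ' u', IsBoundedWeakSolution p T C ρ' u' ∧
      ∀ t ∈ Icc 0 T, ∀ᵐ x ∂(cellMeasure N), ρ' t x = ρ t x ∧ u' t x = u t x := by
  obtain ⟨C₀, hC₀⟩ := h.bounded
  set C := max C₀ 0
  -- Truncation changes each slice with time in `[0,T]` only on a null set, hence none of the
  -- integrals, but makes the bounds hold at every point and every real time.
  let ρ' : ℝ → Space N → ℝ := fun t x => max 0 (min (ρ t x) C)
  let u' : ℝ → Space N → Space N := fun t x => if ‖u t x‖ ≤ C then u t x else 0
  have heq : ∀ t ∈ Icc 0 T, ∀ᵐ x ∂(cellMeasure N), ρ' t x = ρ t x ∧ u' t x = u t x := by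
    intro t ht
    filter_upwards [hC₀ t ht] with x hx
    refine ⟨?_, if_pos (hx.2.2.trans (le_max_left _ _))⟩
    change max 0 (min (ρ t x) C) = ρ t x
    rw [min_eq_left (hx.2.1.trans (le_max_left _ _)), max_eq_right hx.1]
  have hst : IsBoundedState C ρ' u' := by
    refine ⟨measurable_const.max (h.measurable_density.min measurable_const), ?_,
      fun t x => le_max_left _ _, fun t x => max_le (le_max_right _ _) (min_le_right _ _),
      fun t x => ?_⟩
    · exact Measurable.ite (measurableSet_le h.measurable_velocity.norm measurable_const)
        h.measurable_velocity measurable_const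
    · change ‖if ‖u t x‖ ≤ C then u t x else 0‖ ≤ C
      split_ifs with hx
      · exact hx
      · simp [C]
  refine ⟨C, ρ', u', ⟨hst, fun φ hφ τ hτ => ?_, fun φ hφ τ hτ => ?_⟩, heq⟩
  · have h0 : (0 : ℝ) ∈ Icc 0 T := ⟨le_rfl, hτ.1.trans hτ.2⟩
    convert h.continuity φ hφ τ hτ using 1
    · refine integral_congr_ae ?_
      filter_upwards [heq τ hτ, heq 0 h0] with x hx hx0
      rw [hx.1, hx0.1]
    · refine intervalIntegral.integral_congr fun t ht => ?_
      rw [uIcc_of_le hτ.1] at ht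
      refine integral_congr_ae ?_
      filter_upwards [heq t ⟨ht.1, ht.2.trans hτ.2⟩] with x hx
      rw [massFlux_eq (hφ.differentiableAt _), hx.1, hx.2]
  · have h0 : (0 : ℝ) ∈ Icc 0 T := ⟨le_rfl, hτ.1.trans hτ.2⟩
    convert h.momentum φ hφ τ hτ using 1
    · refine integral_congr_ae ?_
      filter_upwards [heq τ hτ, heq 0 h0] with x hx hx0
      rw [hx.1, hx0.1, hx.2, hx0.2]
    · refine intervalIntegral.integral_congr fun t ht => ?_
      rw [uIcc_of_le hτ.1] at ht
      refine integral_congr_ae ?_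
      filter_upwards [heq t ⟨ht.1, ht.2.trans hτ.2⟩] with x hx
      rw [momentumFlux_eq (hφ.differentiableAt _), hx.1, hx.2]

lemma measurable_slice {α : Type*} [MeasurableSpace α] {f : ℝ → Space N → α}
    (hf : Measurable (Function.uncurry f)) (t : ℝ) : Measurable (f t) :=
  hf.comp measurable_prodMk_left

lemma IsTest.measurable {F : Type*} [NormedAddCommGroup F] [NormedSpace ℝ F] [MeasurableSpace F]
    [BorelSpace F] {φ : ℝ → Space N → F} (h : IsTest φ) (t : ℝ) : Measurable (φ t) := by
  have := h.smooth.continuous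
  exact (this.comp (by fun_prop : Continuous fun x : Space N => (t, x))).measurable

variable {p : ℝ → ℝ} {T C a b τ : ℝ} {ρ : ℝ → Space N → ℝ} {u : ℝ → Space N → Space N}

/-- The weak continuity equation for continuously differentiable test functions. -/
lemma IsBoundedWeakSolution.mass_of_isC1Test (h : IsBoundedWeakSolution p T C ρ u)
    (ha : 0 ≤ a) (hbT : b ≤ T) (hτ : τ ∈ Icc a b) {φ : ℝ → Space N → ℝ} (hφ : IsC1Test a b φ) :
    ∫ x, ρ τ x * φ τ x ∂(cellMeasure N) - ∫ x, ρ a x * φ a x ∂(cellMeasure N)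
      = ∫ z, massFlux ρ u φ z.1 z.2 ∂(stMeasure N a τ) := by
  obtain ⟨C₁, hC₁⟩ := hφ.exists_norm_mollify_le
  obtain ⟨K, hK⟩ := hφ.exists_norm_stDeriv_mollify_le
  refine conservation_limit (S := fun n t x => ρ t x * mollifyTest n φ t x)
    (S₀ := fun t x => ρ t x * φ t x) (Q := fun n => massFlux ρ u (mollifyTest n φ))
    (Q₀ := massFlux ρ u φ) (C := max (C * C₁) (C * (K * (1 + C)))) ha hbT hτ
    (fun n t => (measurable_slice h.measurable_density t).mul ((hφ.isTest_mollify n).measurable t))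
    (fun n => h.measurable_massFlux _) (fun n t x hx => ?_)
    (fun n t x hx => (h.abs_massFlux_le (hK n t x hx)).trans (le_max_right _ _))
    (fun t x => (hφ.mollify_tendsto t x).const_mul _) (fun t ht x => ?_)
    (fun n t ht => h.mass _ (hφ.isTest_mollify n) t ht)
  · refine le_max_of_le_left ?_
    rw [abs_mul, abs_of_nonneg (h.nonneg t x)]
    exact mul_le_mul (h.le t x) (hC₁ n t x hx) (abs_nonneg _) h.const_nonneg
  · have := hφ.stDeriv_mollify_tendsto ht x
    have h2 : Continuous fun L : ℝ × Space N →L[ℝ] ℝ => ρ t x * L (1, u t x) := by fun_prop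
    exact (h2.tendsto _).comp this

/-- The weak momentum equation for continuously differentiable test functions. -/
lemma IsBoundedWeakSolution.momentum_of_isC1Test (h : IsBoundedWeakSolution p T C ρ u)
    (hp : ContinuousOn p (Ici 0))
    (ha : 0 ≤ a) (hbT : b ≤ T) (hτ : τ ∈ Icc a b) {φ : ℝ → Space N → Space N}
    (hφ : IsC1Test a b φ) :
    ∫ x, ⟪ρ τ x • u τ x, φ τ x⟫ ∂(cellMeasure N) - ∫ x, ⟪ρ a x • u a x, φ a x⟫ ∂(cellMeasure N)
      = ∫ z, momentumFlux p ρ u φ z.1 z.2 ∂(stMeasure N a τ) := by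
  obtain ⟨C₁, hC₁⟩ := hφ.exists_norm_mollify_le
  obtain ⟨K, hK⟩ := hφ.exists_norm_stDeriv_mollify_le
  obtain ⟨M, -, hM⟩ := exists_bound_Icc hp C
  refine conservation_limit (S := fun n t x => ⟪ρ t x • u t x, mollifyTest n φ t x⟫)
    (S₀ := fun t x => ⟪ρ t x • u t x, φ t x⟫)
    (Q := fun n => momentumFlux p ρ u (mollifyTest n φ))
    (Q₀ := momentumFlux p ρ u φ)
    (C := max (C * C * C₁) (C * (C * (K * (1 + C))) + M * (N * K))) ha hbT hτ
    (fun n t => ((measurable_slice h.measurable_density t).smul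
      (measurable_slice h.measurable_velocity t)).inner ((hφ.isTest_mollify n).measurable t))
    (fun n => h.measurable_momentumFlux hp _) (fun n t x hx => ?_)
    (fun n t x hx => (h.abs_momentumFlux_le hM (hK n t x hx)).trans (le_max_right _ _))
    (fun t x => tendsto_const_nhds.inner (hφ.mollify_tendsto t x)) (fun t ht x => ?_)
    (fun n t ht => h.momentum _ (hφ.isTest_mollify n) t ht)
  · refine le_max_of_le_left ((abs_real_inner_le_norm _ _).trans ?_)
    refine mul_le_mul ?_ (hC₁ n t x hx) (norm_nonneg _) (mul_nonneg h.const_nonneg h.const_nonneg)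
    rw [norm_smul, Real.norm_of_nonneg (h.nonneg t x)]
    exact mul_le_mul (h.le t x) (h.norm_le t x) (norm_nonneg _) h.const_nonneg
  · have := hφ.stDeriv_mollify_tendsto ht x
    have h2 : Continuous fun L : ℝ × Space N →L[ℝ] Space N =>
        ρ t x * ⟪u t x, L (1, u t x)⟫ + p (ρ t x) * spaceDiv L := by
      have := continuous_spaceDiv (N := N)
      fun_prop
    exact (h2.tendsto _).comp this

end WeakForm

/-! ### Functions of class `C¹` on a closed time interval: integrated balance laws. -/

section Periodic

variable {N : ℕ} {F : Type*} [NormedAddCommGroup F] [NormedSpace ℝ F] {a b : ℝ}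

/-- Functions of class `C¹` on `[a,b] × Ω`. -/
structure IsC1Periodic (a b : ℝ) (g : ℝ → Space N → F) : Prop where
  contDiffOn : ContDiffOn ℝ 1 (Function.uncurry g) (Icc a b ×ˢ univ)
  periodic : ∀ t ∈ Icc a b, IsPeriodic (g t)

lemma IsTest.isC1Periodic {φ : ℝ → Space N → F} (h : IsTest φ) : IsC1Periodic a b φ :=
  ⟨(h.smooth.of_le (by exact_mod_cast le_top)).contDiffOn, fun t _ => h.periodic t⟩

lemma IsC1Periodic.clamp {g : ℝ → Space N → F} (h : IsC1Periodic a b g) (hab : a < b) :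
    IsC1Test a b (clampTime a b g) :=
  isC1Test_clampTime hab h.contDiffOn h.periodic

lemma IsC1Periodic.differentiableAt {g : ℝ → Space N → F} (h : IsC1Periodic a b g) {t : ℝ}
    (ht : t ∈ Ioo a b) (x : Space N) : DifferentiableAt ℝ (Function.uncurry g) (t, x) :=
  (h.contDiffOn.contDiffAt (prod_mem_nhds (Icc_mem_nhds ht.1 ht.2) univ_mem)).differentiableAt
    (by simp)

lemma IsC1Periodic.exists_norm_le {g : ℝ → Space N → F} (h : IsC1Periodic a b g) (hab : a < b) :
    ∃ C, ∀ t ∈ Icc a b, ∀ x ∈ cell N, ‖g t x‖ ≤ C := by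
  obtain ⟨C, hC⟩ := (h.clamp hab).exists_norm_le
  exact ⟨C, fun t ht x hx => by simpa [clampTime_of_mem g ht] using hC t x hx⟩

lemma IsC1Periodic.exists_norm_stDeriv_le {g : ℝ → Space N → F} (h : IsC1Periodic a b g)
    (hab : a < b) : ∃ C, ∀ t ∈ Ioo a b, ∀ x ∈ cell N, ‖stDeriv g t x‖ ≤ C := by
  obtain ⟨C, hC⟩ := (h.clamp hab).exists_norm_stDeriv_le
  exact ⟨C, fun t ht x hx => by simpa [stDeriv_clampTime g ht] using hC t x hx⟩

lemma IsC1Periodic.continuous_slice {g : ℝ → Space N → F} (h : IsC1Periodic a b g) {t : ℝ}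
    (ht : t ∈ Icc a b) : Continuous (g t) :=
  h.contDiffOn.continuousOn.comp_continuous (f := fun x => (t, x)) (by fun_prop)
    fun _ => ⟨ht, trivial⟩

lemma IsC1Periodic.mul {f g : ℝ → Space N → ℝ} (hf : IsC1Periodic a b f)
    (hg : IsC1Periodic a b g) : IsC1Periodic a b fun t x => f t x * g t x :=
  ⟨hf.contDiffOn.mul hg.contDiffOn, fun t ht i x => by
    simp only [hf.periodic t ht i x, hg.periodic t ht i x]⟩

lemma IsC1Periodic.sub {f g : ℝ → Space N → F} (hf : IsC1Periodic a b f)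
    (hg : IsC1Periodic a b g) : IsC1Periodic a b fun t x => f t x - g t x :=
  ⟨hf.contDiffOn.sub hg.contDiffOn, fun t ht i x => by
    simp only [hf.periodic t ht i x, hg.periodic t ht i x]⟩

lemma IsC1Periodic.add {f g : ℝ → Space N → F} (hf : IsC1Periodic a b f)
    (hg : IsC1Periodic a b g) : IsC1Periodic a b fun t x => f t x + g t x :=
  ⟨hf.contDiffOn.add hg.contDiffOn, fun t ht i x => by
    simp only [hf.periodic t ht i x, hg.periodic t ht i x]⟩

lemma IsC1Periodic.smul {f : ℝ → Space N → ℝ} {g : ℝ → Space N → F} (hf : IsC1Periodic a b f)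
    (hg : IsC1Periodic a b g) : IsC1Periodic a b fun t x => f t x • g t x :=
  ⟨hf.contDiffOn.smul hg.contDiffOn, fun t ht i x => by
    simp only [hf.periodic t ht i x, hg.periodic t ht i x]⟩

lemma IsC1Periodic.inner {f g : ℝ → Space N → Space N} (hf : IsC1Periodic a b f)
    (hg : IsC1Periodic a b g) : IsC1Periodic a b fun t x => ⟪f t x, g t x⟫ :=
  ⟨hf.contDiffOn.inner ℝ hg.contDiffOn, fun t ht i x => by
    simp only [hf.periodic t ht i x, hg.periodic t ht i x]⟩

lemma IsC1Periodic.comp {f : ℝ → Space N → ℝ} (hf : IsC1Periodic a b f) {q : ℝ → ℝ} {s : Set ℝ}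
    (hq : ContDiffOn ℝ 1 q s) (hs : ∀ t ∈ Icc a b, ∀ x, f t x ∈ s) :
    IsC1Periodic a b fun t x => q (f t x) :=
  ⟨hq.comp hf.contDiffOn fun z hz => hs z.1 hz.1 z.2, fun t ht i x => by
    simp only [hf.periodic t ht i x]⟩

lemma integrable_slice {g : ℝ → Space N → ℝ} (h : IsC1Periodic a b g) (hab : a < b) {t : ℝ}
    (ht : t ∈ Icc a b) : Integrable (g t) (cellMeasure N) := by
  obtain ⟨C, hC⟩ := h.exists_norm_le hab
  exact integrable_cell_of_bound (h.continuous_slice ht).aestronglyMeasurable (hC t ht)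

lemma integrable_stDeriv_apply {g : ℝ → Space N → ℝ} (h : IsC1Periodic a b g) (hab : a < b)
    {τ : ℝ} (hτ : τ ≤ b) (v : ℝ × Space N) :
    Integrable (fun z => stDeriv g z.1 z.2 v) (stMeasure N a τ) := by
  obtain ⟨C, hC⟩ := h.exists_norm_stDeriv_le hab
  refine integrable_stMeasure_of_bound (C := C * ‖v‖)
    (measurable_stDeriv_apply g measurable_const).aestronglyMeasurable fun t ht x hx => ?_
  exact ((stDeriv g t x).le_opNorm v).trans
    (mul_le_mul_of_nonneg_right (hC t ⟨ht.1, ht.2.trans_le hτ⟩ x hx) (norm_nonneg _))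

lemma integrable_spaceDiv {W : ℝ → Space N → Space N} (h : IsC1Periodic a b W) (hab : a < b)
    {τ : ℝ} (hτ : τ ≤ b) :
    Integrable (fun z => spaceDiv (stDeriv W z.1 z.2)) (stMeasure N a τ) := by
  obtain ⟨C, hC⟩ := h.exists_norm_stDeriv_le hab
  exact integrable_stMeasure_of_bound
    (measurable_spaceDiv_stDeriv W).aestronglyMeasurable fun t ht x hx =>
      abs_spaceDiv_le (hC t ⟨ht.1, ht.2.trans_le hτ⟩ x hx)

/-- The fundamental theorem of calculus in time, integrated over the torus. -/
lemma integral_time_deriv {g : ℝ → Space N → ℝ} (h : IsC1Periodic a b g) (hab : a < b) {τ : ℝ}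
    (hτ : τ ∈ Icc a b) :
    ∫ z, stDeriv g z.1 z.2 (1, 0) ∂(stMeasure N a τ)
      = ∫ x, g τ x ∂(cellMeasure N) - ∫ x, g a x ∂(cellMeasure N) := by
  have hi := integrable_stDeriv_apply h hab hτ.2 (1, 0)
  obtain ⟨C, hC⟩ := h.exists_norm_stDeriv_le hab
  rw [stMeasure, integral_prod_symm _ hi, ← integral_sub (integrable_slice h hab hτ)
    (integrable_slice h hab ⟨le_rfl, hab.le⟩)]
  refine integral_congr_ae ((ae_mem_cell N).mono fun x hx => ?_)
  have hint : IntervalIntegrable (fun t => stDeriv g t x (1, 0)) volume a τ := by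
    rw [intervalIntegrable_iff_integrableOn_Ioc_of_le hτ.1, ← integrableOn_Icc_iff_integrableOn_Ioc,
      integrableOn_Icc_iff_integrableOn_Ioo]
    refine Integrable.of_bound (C := C * ‖((1 : ℝ), (0 : Space N))‖)
      (((measurable_stDeriv_apply g (v := fun _ => (1, 0)) measurable_const).comp
        measurable_prodMk_right).aestronglyMeasurable) ?_
    refine (ae_restrict_mem measurableSet_Ioo).mono fun t ht => ?_
    exact ((stDeriv g t x).le_opNorm _).trans
      (mul_le_mul_of_nonneg_right (hC t ⟨ht.1, ht.2.trans_le hτ.2⟩ x hx) (norm_nonneg _))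
  have := intervalIntegral.integral_eq_sub_of_hasDerivAt_of_le (f := fun t => g t x) hτ.1 ?_
    (fun t ht => hasDerivAt_slice (h.differentiableAt ⟨ht.1, ht.2.trans_le hτ.2⟩ x)) hint
  · rw [intervalIntegral.integral_of_le hτ.1] at this
    exact this
  · exact h.contDiffOn.continuousOn.comp (f := fun t => (t, x)) (by fun_prop)
      fun t ht => ⟨⟨ht.1, ht.2.trans hτ.2⟩, trivial⟩

lemma integral_spaceDiv_eq_zero {W : ℝ → Space N → Space N} (h : IsC1Periodic a b W) (hab : a < b)
    {τ : ℝ} (hτ : τ ≤ b) :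
    ∫ z, spaceDiv (stDeriv W z.1 z.2) ∂(stMeasure N a τ) = 0 := by
  have hi := integrable_spaceDiv h hab hτ
  obtain ⟨C, hC⟩ := h.exists_norm_stDeriv_le hab
  rw [stMeasure, integral_prod _ hi]
  refine integral_eq_zero_of_ae ?_
  rw [← restrict_Ioo_eq_restrict_Ioc]
  refine (ae_restrict_mem measurableSet_Ioo).mono fun t ht => ?_
  have ht' : t ∈ Ioo a b := ⟨ht.1, ht.2.trans_le hτ⟩
  have hdiv : divergence (W t) = fun x => spaceDiv (stDeriv W t x) := by
    ext x; exact divergence_slice (h.differentiableAt ht' x)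
  have := integral_divergence_eq_zero (V := W t)
    (fun x => (hasFDerivAt_slice (h.differentiableAt ht' x)).differentiableAt)
    (h.periodic t (Ioo_subset_Icc_self ht')) ?_
  · rwa [hdiv] at this
  · rw [hdiv]
    exact integrable_cell_of_bound ((measurable_spaceDiv_stDeriv W).comp
      measurable_prodMk_left).aestronglyMeasurable fun x hx => abs_spaceDiv_le (hC t ht' x hx)

/-- Integrated conservation law with density `f` and flux `W`. -/
lemma integral_conservation {f : ℝ → Space N → ℝ} {W : ℝ → Space N → Space N}
    (hf : IsC1Periodic a b f) (hW : IsC1Periodic a b W) (hab : a < b) {τ : ℝ} (hτ : τ ∈ Icc a b)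
    {Q : ℝ → Space N → ℝ}
    (hQ : ∀ t ∈ Ioo a b, ∀ x, stDeriv f t x (1, 0) + spaceDiv (stDeriv W t x) = Q t x) :
    ∫ x, f τ x ∂(cellMeasure N) - ∫ x, f a x ∂(cellMeasure N)
      = ∫ z, Q z.1 z.2 ∂(stMeasure N a τ) := by
  have : ∫ z, Q z.1 z.2 ∂(stMeasure N a τ)
      = ∫ z, (stDeriv f z.1 z.2 (1, 0) + spaceDiv (stDeriv W z.1 z.2)) ∂(stMeasure N a τ) := by
    refine integral_congr_ae ((ae_stMeasure_mem a τ).mono fun z hz => ?_)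
    exact (hQ z.1 ⟨hz.1.1, hz.1.2.trans_le hτ.2⟩ z.2).symm
  rw [this, integral_add (integrable_stDeriv_apply hf hab hτ.2 _) (integrable_spaceDiv hW hab hτ.2),
    integral_time_deriv hf hab hτ, integral_spaceDiv_eq_zero hW hab hτ.2, add_zero]

/-! ### Product and chain rules for space-time derivatives and divergences. -/

section Calculus

variable {t : ℝ} {x : Space N} {f g : ℝ → Space N → ℝ} {V W : ℝ → Space N → Space N}

lemma stDeriv_mul (hf : DifferentiableAt ℝ (Function.uncurry f) (t, x))
    (hg : DifferentiableAt ℝ (Function.uncurry g) (t, x)) (v : ℝ × Space N) :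
    stDeriv (fun t x => f t x * g t x) t x v
      = f t x * stDeriv g t x v + g t x * stDeriv f t x v := by
  have := (hf.hasFDerivAt.mul hg.hasFDerivAt).fderiv
  change (fderiv ℝ (Function.uncurry f * Function.uncurry g) (t, x)) v = _
  rw [this]; rfl

lemma stDeriv_inner (hV : DifferentiableAt ℝ (Function.uncurry V) (t, x))
    (hW : DifferentiableAt ℝ (Function.uncurry W) (t, x)) (v : ℝ × Space N) :
    stDeriv (fun t x => ⟪V t x, W t x⟫) t x v
      = ⟪V t x, stDeriv W t x v⟫ + ⟪stDeriv V t x v, W t x⟫ :=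
  fderiv_inner_apply ℝ hV hW v

lemma stDeriv_comp {q : ℝ → ℝ} {q' : ℝ} (hq : HasDerivAt q q' (f t x))
    (hf : DifferentiableAt ℝ (Function.uncurry f) (t, x)) (v : ℝ × Space N) :
    stDeriv (fun t x => q (f t x)) t x v = q' * stDeriv f t x v := by
  have := (HasDerivAt.comp_hasFDerivAt (f := Function.uncurry f) (t, x) hq hf.hasFDerivAt).fderiv
  change (fderiv ℝ (q ∘ Function.uncurry f) (t, x)) v = _
  rw [this]; rfl

lemma sum_apply_unitVec (L : Space N →L[ℝ] F) (v : Space N) : ∑ j, v j • L (unitVec j) = L v := by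
  have hv : v = ∑ j, v j • unitVec j := by
    have := (EuclideanSpace.basisFun (Fin N) ℝ).sum_repr v
    simpa [unitVec] using this.symm
  conv_rhs => rw [hv]
  simp

lemma spaceDiv_smul (hf : DifferentiableAt ℝ (Function.uncurry f) (t, x))
    (hV : DifferentiableAt ℝ (Function.uncurry V) (t, x)) :
    spaceDiv (stDeriv (fun t x => f t x • V t x) t x)
      = f t x * spaceDiv (stDeriv V t x) + stDeriv f t x (0, V t x) := by
  have h : stDeriv (fun t x => f t x • V t x) t x = f t x • stDeriv V t x
      + (stDeriv f t x).smulRight (V t x) := (hf.hasFDerivAt.smul hV.hasFDerivAt).fderiv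
  have h2 := sum_apply_unitVec ((stDeriv f t x).comp (ContinuousLinearMap.inr ℝ ℝ (Space N)))
    (V t x)
  simp only [ContinuousLinearMap.comp_apply, ContinuousLinearMap.inr_apply] at h2
  rw [h, ← h2, spaceDiv, spaceDiv, Finset.mul_sum, ← Finset.sum_add_distrib]
  refine Finset.sum_congr rfl fun j _ => ?_
  simp [mul_comm]

lemma spaceDiv_add (hV : DifferentiableAt ℝ (Function.uncurry V) (t, x))
    (hW : DifferentiableAt ℝ (Function.uncurry W) (t, x)) :
    spaceDiv (stDeriv (fun t x => V t x + W t x) t x)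
      = spaceDiv (stDeriv V t x) + spaceDiv (stDeriv W t x) := by
  have h : stDeriv (fun t x => V t x + W t x) t x = stDeriv V t x + stDeriv W t x :=
    (hV.hasFDerivAt.add hW.hasFDerivAt).fderiv
  simp [h, spaceDiv, Finset.sum_add_distrib]

lemma divergence_smul {f : Space N → ℝ} {V : Space N → Space N} (hf : DifferentiableAt ℝ f x)
    (hV : DifferentiableAt ℝ V x) :
    divergence (fun y => f y • V y) x = f x * divergence V x + fderiv ℝ f x (V x) := by
  have h : fderiv ℝ (fun y => f y • V y) x = f x • fderiv ℝ V x + (fderiv ℝ f x).smulRight (V x) :=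
    (hf.hasFDerivAt.smul hV.hasFDerivAt).fderiv
  rw [← sum_apply_unitVec (fderiv ℝ f x) (V x), divergence, divergence, h, Finset.mul_sum,
    ← Finset.sum_add_distrib]
  refine Finset.sum_congr rfl fun j _ => ?_
  simp [mul_comm]

/-- Splitting off `div (f V) • V` lets the continuity equation cancel this term in
`IsSmoothSolution.momentum_eq`. -/
lemma momentumFluxDiv_eq {f : Space N → ℝ} {V : Space N → Space N} (hf : DifferentiableAt ℝ f x)
    (hV : DifferentiableAt ℝ V x) :
    momentumFluxDiv f V x
      = f x • fderiv ℝ V x (V x) + divergence (fun y => f y • V y) x • V x := by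
  have hVj : ∀ j, HasFDerivAt (fun y => V y j) ((EuclideanSpace.proj j).comp (fderiv ℝ V x)) x :=
    fun j => (EuclideanSpace.proj (𝕜 := ℝ) j).hasFDerivAt.comp x hV.hasFDerivAt
  have h : ∀ j, fderiv ℝ (fun y => (f y * V y j) • V y) x (unitVec j)
      = f x • V x j • fderiv ℝ V x (unitVec j)
        + (f x * fderiv ℝ V x (unitVec j) j + V x j * fderiv ℝ f x (unitVec j)) • V x := by
    intro j
    have := ((hf.hasFDerivAt.mul (hVj j)).smul hV.hasFDerivAt).fderiv
    change fderiv ℝ ((f * fun y => V y j) • V) x (unitVec j) = _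
    rw [this]
    simp [mul_smul]
  rw [momentumFluxDiv, divergence_smul hf hV]
  simp only [h]
  rw [Finset.sum_add_distrib, ← Finset.smul_sum, sum_apply_unitVec, ← Finset.sum_smul,
    Finset.sum_add_distrib, ← Finset.mul_sum]
  have := sum_apply_unitVec (fderiv ℝ f x) (V x)
  simp only [smul_eq_mul] at this
  rw [this]
  rfl

end Calculus

end Periodic

/-! ### Smooth solutions: nonconservative and weak forms of the equations. -/

section SmoothSolution

variable {N : ℕ} {p : ℝ → ℝ} {a b : ℝ} {r : ℝ → Space N → ℝ} {U : ℝ → Space N → Space N}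

lemma IsSmoothSolution.density_c1 (h : IsSmoothSolution p a b r U) : IsC1Periodic a b r :=
  ⟨h.contDiffOn_density, h.periodic_density⟩

lemma IsSmoothSolution.velocity_c1 (h : IsSmoothSolution p a b r U) : IsC1Periodic a b U :=
  ⟨h.contDiffOn_velocity, h.periodic_velocity⟩

lemma IsPressure.hasDerivAt (hp : IsPressure p) {z : ℝ} (hz : 0 < z) :
    HasDerivAt p (deriv p z) z :=
  ((hp.contDiffOn.contDiffAt (Ioi_mem_nhds hz)).differentiableAt (by simp)).hasDerivAt

/-- The continuity equation in nonconservative form. -/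
lemma IsSmoothSolution.mass_eq (h : IsSmoothSolution p a b r U) {t : ℝ} (ht : t ∈ Ioo a b)
    (x : Space N) :
    stDeriv r t x (1, U t x) = -(r t x * spaceDiv (stDeriv U t x)) := by
  have hr := h.density_c1.differentiableAt ht x
  have hU := h.velocity_c1.differentiableAt ht x
  have := h.continuity t ht x
  rw [divergence_smul (hasFDerivAt_slice hr).differentiableAt
    (hasFDerivAt_slice hU).differentiableAt, (hasDerivAt_slice hr).deriv, divergence_slice hU,
    fderiv_slice_apply hr] at this
  rw [stDeriv_add]
  linarith

/-- The momentum equation in nonconservative form. -/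
lemma IsSmoothSolution.momentum_eq (hp : IsPressure p) (h : IsSmoothSolution p a b r U) {t : ℝ}
    (ht : t ∈ Ioo a b) (x v : Space N) :
    r t x * ⟪stDeriv U t x (1, U t x), v⟫ = -(deriv p (r t x) * stDeriv r t x (0, v)) := by
  have hr := h.density_c1.differentiableAt ht x
  have hU := h.velocity_c1.differentiableAt ht x
  have hpos := h.density_pos t (Ioo_subset_Icc_self ht) x
  have hc := h.continuity t ht x
  have hm := h.momentum t ht x
  have hgrad : ⟪gradient (fun y => p (r t y)) x, v⟫
      = deriv p (r t x) * stDeriv r t x (0, v) := by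
    rw [gradient, InnerProductSpace.toDual_symm_apply]
    have := ((hp.hasDerivAt hpos).comp_hasFDerivAt x (hasFDerivAt_slice hr)).fderiv
    change fderiv ℝ (p ∘ r t) x v = _
    rw [this]; rfl
  have hdt : deriv (fun s => r s x • U s x) t
      = r t x • stDeriv U t x (1, 0) + stDeriv r t x (1, 0) • U t x :=
    ((hasDerivAt_slice hr).smul (hasDerivAt_slice hU)).deriv
  rw [hdt, momentumFluxDiv_eq (hasFDerivAt_slice hr).differentiableAt
    (hasFDerivAt_slice hU).differentiableAt, fderiv_slice_apply hU] at hm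
  rw [(hasDerivAt_slice hr).deriv] at hc
  have := congrArg (fun w => ⟪w, v⟫) hm
  simp only [inner_add_left, real_inner_smul_left, inner_zero_left, hgrad] at this
  rw [stDeriv_add, inner_add_left]
  linear_combination this - ⟪U t x, v⟫ * hc

/-- A smooth solution satisfies the weak continuity equation. -/
lemma IsSmoothSolution.mass_weak (h : IsSmoothSolution p a b r U) (hab : a < b) {τ : ℝ}
    (hτ : τ ∈ Icc a b) {φ : ℝ → Space N → ℝ} (hφ : IsC1Periodic a b φ) :
    ∫ x, r τ x * φ τ x ∂(cellMeasure N) - ∫ x, r a x * φ a x ∂(cellMeasure N)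
      = ∫ z, massFlux r U φ z.1 z.2 ∂(stMeasure N a τ) := by
  have hf := h.density_c1.mul hφ
  refine integral_conservation hf (hf.smul h.velocity_c1) hab hτ fun t ht x => ?_
  have hr := h.density_c1.differentiableAt ht x
  have hU := h.velocity_c1.differentiableAt ht x
  have hφd := hφ.differentiableAt ht x
  rw [spaceDiv_smul (hf.differentiableAt ht x) hU, stDeriv_mul hr hφd, stDeriv_mul hr hφd, massFlux,
    stDeriv_add φ t x (U t x)]
  have hm := h.mass_eq ht x
  rw [stDeriv_add] at hm
  linear_combination φ t x * hm

/-- A smooth solution satisfies the weak momentum equation. -/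
lemma IsSmoothSolution.momentum_weak (hp : IsPressure p) (h : IsSmoothSolution p a b r U)
    (hab : a < b) {τ : ℝ} (hτ : τ ∈ Icc a b) {φ : ℝ → Space N → Space N}
    (hφ : IsC1Periodic a b φ) :
    ∫ x, ⟪r τ x • U τ x, φ τ x⟫ ∂(cellMeasure N) - ∫ x, ⟪r a x • U a x, φ a x⟫ ∂(cellMeasure N)
      = ∫ z, momentumFlux p r U φ z.1 z.2 ∂(stMeasure N a τ) := by
  simp only [real_inner_smul_left]
  have hg := h.velocity_c1.inner hφ
  have hf := h.density_c1.mul hg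
  have hpr := h.density_c1.comp hp.contDiffOn h.density_pos
  -- The flux is `r⟨U, φ⟩U + p(r)φ`. The divergence of its second part is `p(r) div φ` plus
  -- `∇p(r)·φ`, and the momentum equation cancels the latter.
  refine integral_conservation hf ((hf.smul h.velocity_c1).add (hpr.smul hφ)) hab hτ
    fun t ht x => ?_
  have hr := h.density_c1.differentiableAt ht x
  have hU := h.velocity_c1.differentiableAt ht x
  have hφd := hφ.differentiableAt ht x
  have hgd := hg.differentiableAt ht x
  rw [spaceDiv_add ((hf.smul h.velocity_c1).differentiableAt ht x)
    ((hpr.smul hφ).differentiableAt ht x), spaceDiv_smul (hf.differentiableAt ht x) hU,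
    spaceDiv_smul (hpr.differentiableAt ht x) hφd,
    stDeriv_comp (hp.hasDerivAt (h.density_pos t (Ioo_subset_Icc_self ht) x)) hr,
    stDeriv_mul hr hgd, stDeriv_mul hr hgd, stDeriv_inner hU hφd, stDeriv_inner hU hφd,
    momentumFlux, stDeriv_add φ t x (U t x), inner_add_right]
  have hm := h.mass_eq ht x
  have hmom := h.momentum_eq hp ht x (φ t x)
  rw [stDeriv_add] at hm hmom
  rw [inner_add_left] at hmom
  linear_combination ⟪U t x, φ t x⟫ * hm + hmom

lemma IsSmoothSolution.pressure_c1 (hp : IsPressure p) (h : IsSmoothSolution p a b r U) :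
    IsC1Periodic a b fun t x => p (r t x) :=
  h.density_c1.comp hp.contDiffOn h.density_pos

/-- The balance of the pressure along a smooth solution. -/
lemma IsSmoothSolution.pressure_balance (hp : IsPressure p) (h : IsSmoothSolution p a b r U)
    {t : ℝ} (ht : t ∈ Ioo a b) (x : Space N) :
    stDeriv (fun t x => p (r t x)) t x (1, 0)
        + spaceDiv (stDeriv (fun t x => p (r t x) • U t x) t x)
      = (p (r t x) - deriv p (r t x) * r t x) * spaceDiv (stDeriv U t x) := by
  have hr := h.density_c1.differentiableAt ht x
  have hU := h.velocity_c1.differentiableAt ht x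
  have hd := hp.hasDerivAt (h.density_pos t (Ioo_subset_Icc_self ht) x)
  rw [spaceDiv_smul ((h.pressure_c1 hp).differentiableAt ht x) hU, stDeriv_comp hd hr,
    stDeriv_comp hd hr]
  have hm := h.mass_eq ht x
  rw [stDeriv_add] at hm
  linear_combination deriv p (r t x) * hm

end SmoothSolution

/-! ### Convexity of the pressure potential and control of the pressure remainder. -/

section Pressure

variable {p : ℝ → ℝ}

/-- The derivative `P'` of the pressure potential. -/
noncomputable def potentialDeriv (p : ℝ → ℝ) (ρ : ℝ) : ℝ := (∫ z in (1 : ℝ)..ρ, p z / z ^ 2) + p ρ / ρ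

/-- The relative pressure potential `P(ρ) - P(r) - P'(r)(ρ - r)`. -/
noncomputable def relPotential (p : ℝ → ℝ) (ρ r : ℝ) : ℝ :=
  pressurePotential p ρ - pressurePotential p r - potentialDeriv p r * (ρ - r)

lemma pressurePotential_zero : pressurePotential p 0 = 0 := by simp [pressurePotential]

/-- The relation `p = r P' - P` is the source of the term `p(r)` in `relEnergy_eq`. -/
lemma pressurePotential_eq {r : ℝ} (hr : 0 < r) :
    pressurePotential p r = r * potentialDeriv p r - p r := by
  rw [pressurePotential, potentialDeriv]
  field_simp
  ring

lemma IsPressure.hasDerivAt_integral (hp : IsPressure p) {ρ : ℝ} (hρ : 0 < ρ) :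
    HasDerivAt (fun ρ => ∫ z in (1 : ℝ)..ρ, p z / z ^ 2) (p ρ / ρ ^ 2) ρ := by
  have hc : ContinuousOn (fun z => p z / z ^ 2) (Ioi 0) :=
    (hp.continuousOn.mono Ioi_subset_Ici_self).div (by fun_prop) fun z hz => by
      have : (0 : ℝ) < z := hz
      positivity
  refine intervalIntegral.integral_hasDerivAt_right ?_ ?_ (hc.continuousAt (Ioi_mem_nhds hρ))
  · refine (hc.mono fun z hz => ?_).intervalIntegrable
    exact (lt_min one_pos hρ).trans_le hz.1
  · exact hc.stronglyMeasurableAtFilter isOpen_Ioi ρ hρ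

lemma IsPressure.hasDerivAt_potential (hp : IsPressure p) {ρ : ℝ} (hρ : 0 < ρ) :
    HasDerivAt (pressurePotential p) (potentialDeriv p ρ) ρ := by
  have := (hasDerivAt_id ρ).mul (hp.hasDerivAt_integral hρ)
  refine this.congr_deriv ?_
  simp only [potentialDeriv, id]
  field_simp

/-- The term `p/ρ²` from the integral cancels against the quotient rule for `p/ρ`, leaving `P'' =
p'/ρ`. Thus `P'` is `C¹` although `p` is no better than `C¹`, and `P` is convex. -/
lemma IsPressure.hasDerivAt_potentialDeriv (hp : IsPressure p) {ρ : ℝ} (hρ : 0 < ρ) :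
    HasDerivAt (potentialDeriv p) (deriv p ρ / ρ) ρ := by
  have := (hp.hasDerivAt_integral hρ).add ((hp.hasDerivAt hρ).div (hasDerivAt_id ρ) hρ.ne')
  refine this.congr_deriv ?_
  simp only [id]
  field_simp
  ring

lemma IsPressure.continuousOn_deriv (hp : IsPressure p) : ContinuousOn (deriv p) (Ioi 0) :=
  hp.contDiffOn.continuousOn_deriv_of_isOpen isOpen_Ioi (by simp)

lemma IsPressure.contDiffOn_potentialDeriv (hp : IsPressure p) :
    ContDiffOn ℝ 1 (potentialDeriv p) (Ioi 0) := by
  rw [show (1 : WithTop ℕ∞) = 0 + 1 from (zero_add 1).symm,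
    contDiffOn_succ_iff_deriv_of_isOpen isOpen_Ioi]
  refine ⟨fun z hz => (hp.hasDerivAt_potentialDeriv hz).differentiableAt.differentiableWithinAt,
    by simp, contDiffOn_zero.2 ?_⟩
  refine ContinuousOn.congr (f := fun z => deriv p z / z) ?_ fun z hz =>
    (hp.hasDerivAt_potentialDeriv hz).deriv
  exact hp.continuousOn_deriv.div continuousOn_id fun z hz => ne_of_gt hz

lemma IsPressure.strictMonoOn (hp : IsPressure p) : StrictMonoOn p (Ici 0) :=
  strictMonoOn_of_deriv_pos (convex_Ici 0) hp.continuousOn fun z hz => by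
    rw [interior_Ici] at hz; exact hp.deriv_pos z hz

lemma IsPressure.pos (hp : IsPressure p) {z : ℝ} (hz : 0 < z) : 0 < p z := by
  have := hp.strictMonoOn (mem_Ici.2 le_rfl) (mem_Ici.2 hz.le) hz
  rwa [hp.map_zero] at this

/-- A function on an interval that increases away from `r`. -/
lemma le_of_deriv_mul_nonneg {G G' : ℝ → ℝ} {r ρ₁ ρ₂ : ℝ} (h1 : ρ₁ ∈ uIcc r ρ₂)
    (hG : ∀ z ∈ uIcc r ρ₂, HasDerivAt G (G' z) z)
    (hs : ∀ z ∈ uIcc r ρ₂, 0 ≤ G' z * (z - r)) : G ρ₁ ≤ G ρ₂ := by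
  rcases le_total r ρ₂ with h | h
  · rw [uIcc_of_le h] at *
    have : MonotoneOn G (Icc r ρ₂) := by
      refine monotoneOn_of_deriv_nonneg (convex_Icc _ _)
        (fun z hz => (hG z hz).continuousAt.continuousWithinAt)
        (fun z hz => (hG z (interior_subset hz)).differentiableAt.differentiableWithinAt)
        fun z hz => ?_
      rw [(hG z (interior_subset hz)).deriv]
      rw [interior_Icc] at hz
      exact nonneg_of_mul_nonneg_left (hs z (Ioo_subset_Icc_self hz)) (sub_pos.2 hz.1)
    exact this h1 ⟨h, le_rfl⟩ h1.2
  · rw [uIcc_of_ge h] at *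
    have : AntitoneOn G (Icc ρ₂ r) := by
      refine antitoneOn_of_deriv_nonpos (convex_Icc _ _)
        (fun z hz => (hG z hz).continuousAt.continuousWithinAt)
        (fun z hz => (hG z (interior_subset hz)).differentiableAt.differentiableWithinAt)
        fun z hz => ?_
      rw [(hG z (interior_subset hz)).deriv]
      rw [interior_Icc] at hz
      have h3 := hs z (Ioo_subset_Icc_self hz)
      have h4 : 0 < r - z := sub_pos.2 hz.2
      nlinarith
    exact this ⟨le_rfl, h⟩ h1 h1.1

lemma IsPressure.monotoneOn_potentialDeriv (hp : IsPressure p) :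
    MonotoneOn (potentialDeriv p) (Ioi 0) :=
  monotoneOn_of_deriv_nonneg (convex_Ioi 0)
    (fun z hz => (hp.hasDerivAt_potentialDeriv hz).continuousAt.continuousWithinAt)
    (fun z hz => (hp.hasDerivAt_potentialDeriv
      (interior_subset hz)).differentiableAt.differentiableWithinAt)
    fun z hz => by
      rw [interior_Ioi] at hz
      rw [(hp.hasDerivAt_potentialDeriv hz).deriv]
      exact div_nonneg (hp.deriv_pos z hz).le (le_of_lt hz)

lemma IsPressure.hasDerivAt_relPotential (hp : IsPressure p) {ρ : ℝ} (hρ : 0 < ρ) (r : ℝ) :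
    HasDerivAt (fun ρ => relPotential p ρ r) (potentialDeriv p ρ - potentialDeriv p r) ρ := by
  have := ((hp.hasDerivAt_potential hρ).sub_const (pressurePotential p r)).sub
    (((hasDerivAt_id ρ).sub_const r).const_mul (potentialDeriv p r))
  exact this.congr_deriv (by simp)

lemma relPotential_self (r : ℝ) : relPotential p r r = 0 := by simp [relPotential]

/-- At vacuum the derivative formulas are unavailable, so this explicit value replaces the
monotonicity argument there. -/
lemma relPotential_zero {r : ℝ} (hr : 0 < r) : relPotential p 0 r = p r := by
  rw [relPotential, pressurePotential_zero, pressurePotential_eq hr]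
  ring

lemma uIcc_subset_Ioi {a b : ℝ} (ha : 0 < a) (hb : 0 < b) : uIcc a b ⊆ Ioi 0 := fun _ hz =>
  (lt_min ha hb).trans_le hz.1

/-- The relative potential increases away from the diagonal. -/
lemma IsPressure.relPotential_mono (hp : IsPressure p) {r ρ₁ ρ₂ : ℝ} (hr : 0 < r) (h2 : 0 < ρ₂)
    (h1 : ρ₁ ∈ uIcc r ρ₂) : relPotential p ρ₁ r ≤ relPotential p ρ₂ r := by
  refine le_of_deriv_mul_nonneg (G := fun ρ => relPotential p ρ r) h1
    (fun z hz => hp.hasDerivAt_relPotential (uIcc_subset_Ioi hr h2 hz) r) fun z hz => ?_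
  have hz0 := uIcc_subset_Ioi hr h2 hz
  rcases le_total r z with h | h
  · exact mul_nonneg (sub_nonneg.2 (hp.monotoneOn_potentialDeriv hr hz0 h)) (sub_nonneg.2 h)
  · exact mul_nonneg_of_nonpos_of_nonpos
      (sub_nonpos.2 (hp.monotoneOn_potentialDeriv hz0 hr h)) (sub_nonpos.2 h)

lemma IsPressure.relPotential_nonneg (hp : IsPressure p) {r ρ : ℝ} (hr : 0 < r) (hρ : 0 ≤ ρ) :
    0 ≤ relPotential p ρ r := by
  rcases hρ.eq_or_lt with rfl | h
  · rw [relPotential_zero hr]; exact (hp.pos hr).le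
  · have := hp.relPotential_mono hr h left_mem_uIcc
    rwa [relPotential_self] at this

/-- The Taylor remainder of the pressure together with the squared distance. -/
noncomputable def pressureDefect (p : ℝ → ℝ) (ρ r : ℝ) : ℝ :=
  |p ρ - p r - deriv p r * (ρ - r)| + (ρ - r) ^ 2

/-- Since `P'' = p'/z ≥ m`, the derivative `P'(z) - P'(r)` of the relative potential grows at least
like `m(z - r)` in the direction away from `r`. The derivative of the Taylor remainder of `p` is at
most `K|z - r|`, and that of the square is `2(z - r)`. Comparing derivatives on the segment from `r`
to `ρ` gives the constant `(K + 2)/m` and avoids second derivatives of `p`. -/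
lemma IsPressure.pressureDefect_le_near (hp : IsPressure p) {l v : ℝ} (hl : 0 ≤ l) {K m : ℝ}
    (hK : 0 ≤ K) (hm : 0 < m)
    (hlip : ∀ z ∈ Ioo l v, ∀ w ∈ Ioo l v, |deriv p z - deriv p w| ≤ K * |z - w|)
    (hlow : ∀ z ∈ Ioo l v, m * z ≤ deriv p z) {ρ r : ℝ} (hρ : ρ ∈ Ioo l v) (hr : r ∈ Ioo l v) :
    pressureDefect p ρ r ≤ (K + 2) / m * relPotential p ρ r := by
  have hpos : ∀ z ∈ Ioo l v, 0 < z := fun z hz => hl.trans_lt hz.1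
  have hmono : MonotoneOn (fun z => potentialDeriv p z - m * z) (Ioo l v) := by
    have hd : ∀ z ∈ Ioo l v, HasDerivAt (fun z => potentialDeriv p z - m * z)
        (deriv p z / z - m) z := fun z hz => by
      exact ((hp.hasDerivAt_potentialDeriv (hpos z hz)).sub
        ((hasDerivAt_id z).const_mul m)).congr_deriv (by simp)
    refine monotoneOn_of_deriv_nonneg (convex_Ioo _ _)
      (fun z hz => (hd z hz).continuousAt.continuousWithinAt)
      (fun z hz => (hd z (interior_subset hz)).differentiableAt.differentiableWithinAt)
      fun z hz => ?_
    have hz' := interior_subset hz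
    rw [(hd z hz').deriv, sub_nonneg, le_div_iff₀ (hpos z hz')]
    exact hlow z hz'
  have hcoer : ∀ z ∈ Ioo l v,
      m * (z - r) ^ 2 ≤ (potentialDeriv p z - potentialDeriv p r) * (z - r) := fun z hz => by
    rcases le_total r z with h | h
    · have h1 := hmono hr hz h
      simp only at h1
      nlinarith [mul_nonneg (sub_nonneg.2 h1) (sub_nonneg.2 h)]
    · have h1 := hmono hz hr h
      simp only at h1
      nlinarith [mul_nonneg (sub_nonneg.2 h1) (sub_nonneg.2 h)]
  have hsub : uIcc r ρ ⊆ Ioo l v := (ordConnected_Ioo).uIcc_subset hr hρ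
  -- The values `s = 1` and `s = -1` recover the absolute value, which cannot itself be
  -- differentiated.
  have key : ∀ s : ℝ, |s| ≤ 1 →
      0 ≤ (K + 2) / m * relPotential p ρ r - s * (p ρ - p r - deriv p r * (ρ - r))
        - (ρ - r) ^ 2 := by
    intro s hs
    have hd : ∀ z ∈ uIcc r ρ, HasDerivAt (fun ρ => (K + 2) / m * relPotential p ρ r
        - s * (p ρ - p r - deriv p r * (ρ - r)) - (ρ - r) ^ 2)
        ((K + 2) / m * (potentialDeriv p z - potentialDeriv p r)
          - s * (deriv p z - deriv p r) - 2 * (z - r)) z := fun z hz => by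
      have hz0 := hpos z (hsub hz)
      have h1 := (hp.hasDerivAt_relPotential hz0 r).const_mul ((K + 2) / m)
      have h2 := (((hp.hasDerivAt hz0).sub_const (p r)).sub
        (((hasDerivAt_id z).sub_const r).const_mul (deriv p r))).const_mul s
      have h3 := ((hasDerivAt_id z).sub_const r).pow 2
      exact ((h1.sub h2).sub h3).congr_deriv (by simp)
    have := le_of_deriv_mul_nonneg (left_mem_uIcc) hd fun z hz => ?_
    · simpa [relPotential_self] using this
    · have h1 := hcoer z (hsub hz)
      have h2 := hlip z (hsub hz) r hr
      have h3 : s * (deriv p z - deriv p r) * (z - r) ≤ K * (z - r) ^ 2 := by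
        refine (le_abs_self _).trans ?_
        rw [abs_mul, abs_mul, ← sq_abs (z - r), sq, ← mul_assoc]
        refine mul_le_mul_of_nonneg_right ?_ (abs_nonneg _)
        calc |s| * |deriv p z - deriv p r| ≤ 1 * |deriv p z - deriv p r| :=
              mul_le_mul_of_nonneg_right hs (abs_nonneg _)
          _ ≤ K * |z - r| := by rwa [one_mul]
      have h4 : (K + 2) * (z - r) ^ 2
          ≤ (K + 2) / m * ((potentialDeriv p z - potentialDeriv p r) * (z - r)) := by
        have := mul_le_mul_of_nonneg_left h1 (div_nonneg (by linarith : 0 ≤ K + 2) hm.le)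
        rwa [← mul_assoc, div_mul_cancel₀ _ hm.ne'] at this
      linarith
  rw [pressureDefect]
  rcases abs_cases (p ρ - p r - deriv p r * (ρ - r)) with h | h
  · rw [h.1]; linarith [key 1 (by simp)]
  · rw [h.1]; linarith [key (-1) (by simp)]

/-- For `ρ` close to `r₀` the quadratic comparison applies. Otherwise the defect is at most a
constant `B`, while the relative potential, increasing away from `r`, is at least some `d > 0`; the
factor `B / d` then suffices. -/
lemma IsPressure.pressureDefect_le_locally (hp : IsPressure p) {r₀ : ℝ} (hr₀ : 0 < r₀)
    (hreg : ∃ K, ∃ s ∈ 𝓝 r₀, LipschitzOnWith K (deriv p) s) (C : ℝ) :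
    ∃ c, ∃ s ∈ 𝓝 r₀, ∀ r ∈ s, ∀ ρ, 0 ≤ ρ → ρ ≤ C →
      pressureDefect p ρ r ≤ c * relPotential p ρ r := by
  obtain ⟨K, s, hs, hlip⟩ := hreg
  -- With this choice `m * r₀` is a quarter of `p'(r₀)`, so `m * z < p'(z)` persists for `z` near
  -- `r₀`.
  set m := deriv p r₀ / (4 * r₀) with hm_def
  have hd0 := hp.deriv_pos r₀ hr₀
  have hm : 0 < m := by positivity
  have hev : ∀ᶠ z in 𝓝 r₀, z ∈ s ∧ 0 < z ∧ m * z < deriv p z := by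
    refine (eventually_mem_set.2 hs).and ((lt_mem_nhds hr₀).and ?_)
    have h1 : ContinuousAt (deriv p) r₀ := hp.continuousOn_deriv.continuousAt (Ioi_mem_nhds hr₀)
    have h2 : ContinuousAt (fun z => m * z) r₀ := by fun_prop
    refine h2.eventually_lt h1 ?_
    rw [hm_def]
    field_simp
    linarith
  obtain ⟨δ, hδ, hball⟩ := Metric.eventually_nhds_iff_ball.1 hev
  set ε := δ / 2 with hε_def
  have hε : 0 < ε := half_pos hδ
  have hJ : ∀ z ∈ Ioo (r₀ - δ) (r₀ + δ), z ∈ s ∧ 0 < z ∧ m * z < deriv p z := fun z hz =>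
    hball z (by rw [Real.ball_eq_Ioo]; exact hz)
  -- Every point of the interval is positive; a negative left end would put a nonpositive point
  -- inside it.
  have hl : 0 ≤ r₀ - δ := by
    by_contra hneg
    rcases le_total 0 (r₀ - δ / 2) with h | h
    · have := (hJ ((r₀ - δ) / 2 ⊓ 0) ⟨?_, ?_⟩).2.1
      · exact absurd this (not_lt.2 inf_le_right)
      · exact lt_min (by linarith) (by linarith)
      · exact (inf_le_right).trans_lt (by linarith)
    · have := (hJ (r₀ - δ / 2) ⟨by linarith, by linarith⟩).2.1
      linarith
  have near : ∀ ρ ∈ Ioo (r₀ - δ) (r₀ + δ), ∀ r ∈ Ioo (r₀ - δ) (r₀ + δ),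
      pressureDefect p ρ r ≤ (K + 2) / m * relPotential p ρ r := fun ρ hρ r hr =>
    hp.pressureDefect_le_near hl K.2 hm
      (fun z hz w hw => by simpa [Real.dist_eq] using hlip.dist_le_mul z (hJ z hz).1 w (hJ w hw).1)
      (fun z hz => (hJ z hz).2.2.le) hρ hr
  set k := ((K : ℝ) + 2) / m with hk_def
  have hk : 0 < k := by have := K.2; positivity
  obtain ⟨M, hM0, hM⟩ := exists_bound_Icc hp.continuousOn (max C (r₀ + δ))
  obtain ⟨D, hD⟩ : ∃ D, ∀ r ∈ Icc (r₀ - ε / 2) (r₀ + ε / 2), |deriv p r| ≤ D := by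
    refine isCompact_Icc.exists_bound_of_continuousOn (hp.continuousOn_deriv.mono fun z hz => ?_)
    exact (hJ z ⟨by linarith [hz.1], by linarith [hz.2]⟩).2.1
  -- For positive `ρ` outside the interval, one of `r₀ ± ε` separates `ρ` from `r` and is at
  -- distance at least `ε / 2` from `r`; the first entry is the quadratic lower bound there. The
  -- second entry covers `ρ = 0`, where the relative potential is `p r ≥ p (r₀ - ε)`.
  set d := min ((ε / 2) ^ 2 / k) (p (r₀ - ε)) with hd_def
  have hrε : 0 < r₀ - ε := (hJ _ ⟨by linarith, by linarith⟩).2.1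
  have hd : 0 < d := lt_min (by positivity) (hp.pos hrε)
  set B := (M + M + D * (max C (r₀ + δ))) + (max C (r₀ + δ)) ^ 2 with hB_def
  refine ⟨max k (B / d), Icc (r₀ - ε / 2) (r₀ + ε / 2), Icc_mem_nhds (by linarith) (by linarith),
    fun r hr ρ hρ0 hρC => ?_⟩
  have hrJ : r ∈ Ioo (r₀ - δ) (r₀ + δ) := ⟨by linarith [hr.1], by linarith [hr.2]⟩
  have hrpos := (hJ r hrJ).2.1
  have hrel := hp.relPotential_nonneg hrpos hρ0
  by_cases hρ : ρ ∈ Ioo (r₀ - δ) (r₀ + δ)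
  · exact (near ρ hρ r hrJ).trans (mul_le_mul_of_nonneg_right (le_max_left _ _) hrel)
  have hsq : ∀ ρ' ∈ Ioo (r₀ - δ) (r₀ + δ), (ε / 2) ^ 2 ≤ (ρ' - r) ^ 2 →
      (ε / 2) ^ 2 / k ≤ relPotential p ρ' r := fun ρ' hρ' h => by
    rw [div_le_iff₀ hk, mul_comm]
    refine h.trans (le_trans ?_ (near ρ' hρ' r hrJ))
    exact le_add_of_nonneg_left (abs_nonneg _)
  have hdrel : d ≤ relPotential p ρ r := by
    rcases hρ0.eq_or_lt with rfl | hρpos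
    · rw [relPotential_zero hrpos]
      refine (min_le_right _ _).trans (hp.strictMonoOn.monotoneOn hrε.le hrpos.le ?_)
      linarith [hr.1]
    · refine (min_le_left _ _).trans ?_
      by_cases hge : r₀ + δ ≤ ρ
      · refine (hsq (r₀ + ε) ⟨by linarith, by linarith⟩ ?_).trans
          (hp.relPotential_mono hrpos hρpos ?_)
        · refine pow_le_pow_left₀ (by positivity) ?_ 2
          linarith [hr.2]
        · rw [uIcc_of_le (by linarith [hr.2])]
          exact ⟨by linarith [hr.2], by linarith⟩
      · have hle : ρ ≤ r₀ - δ := by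
          by_contra hlt
          exact hρ ⟨not_le.1 hlt, not_le.1 hge⟩
        refine (hsq (r₀ - ε) ⟨by linarith, by linarith⟩ ?_).trans
          (hp.relPotential_mono hrpos hρpos ?_)
        · rw [← neg_sq (r₀ - ε - r)]
          refine pow_le_pow_left₀ (by positivity) ?_ 2
          linarith [hr.1]
        · rw [uIcc_of_ge (by linarith [hr.1])]
          exact ⟨by linarith, by linarith [hr.1]⟩
  have hdist : |ρ - r| ≤ max C (r₀ + δ) := by
    rw [abs_le]
    constructor
    · have := le_max_right C (r₀ + δ)
      linarith [hrJ.2]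
    · have := le_max_left C (r₀ + δ)
      linarith
  have hdef : pressureDefect p ρ r ≤ B := by
    refine add_le_add ?_ ?_
    · refine (abs_sub _ _).trans (add_le_add ((abs_sub _ _).trans (add_le_add ?_ ?_)) ?_)
      · exact hM ρ hρ0 (hρC.trans (le_max_left _ _))
      · exact hM r hrpos.le (hrJ.2.le.trans (le_max_right _ _))
      · rw [abs_mul]
        exact mul_le_mul (hD r hr) hdist (abs_nonneg _) ((abs_nonneg _).trans (hD r hr))
    · rw [← sq_abs]
      exact pow_le_pow_left₀ (abs_nonneg _) hdist 2
  have hB : 0 ≤ B := by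
    refine le_trans ?_ hdef
    exact add_nonneg (abs_nonneg _) (sq_nonneg _)
  calc pressureDefect p ρ r ≤ B := hdef
    _ = B / d * d := (div_mul_cancel₀ _ hd.ne').symm
    _ ≤ max k (B / d) * relPotential p ρ r :=
      mul_le_mul (le_max_right _ _) hdrel hd.le (hk.le.trans (le_max_left _ _))

lemma IsPressure.exists_pressureDefect_le (hp : IsPressure p) {S : Set ℝ} (hS : IsCompact S)
    (hpos : ∀ r ∈ S, 0 < r)
    (hreg : ∀ r ∈ S, ∃ K, ∃ s ∈ 𝓝 r, LipschitzOnWith K (deriv p) s) (C : ℝ) :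
    ∃ c, ∀ r ∈ S, ∀ ρ, 0 ≤ ρ → ρ ≤ C → pressureDefect p ρ r ≤ c * relPotential p ρ r := by
  -- Positivity is moved into the property because the sets in the compactness induction need not
  -- consist of positive numbers, and enlarging the constant needs a nonnegative relative potential.
  suffices h : ∃ c, ∀ r ∈ S, 0 < r → ∀ ρ, 0 ≤ ρ → ρ ≤ C →
      pressureDefect p ρ r ≤ c * relPotential p ρ r from
    h.imp fun c hc r hr => hc r hr (hpos r hr)
  refine hS.induction_on (p := fun S => ∃ c, ∀ r ∈ S, 0 < r → ∀ ρ, 0 ≤ ρ → ρ ≤ C →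
    pressureDefect p ρ r ≤ c * relPotential p ρ r) ⟨0, by simp⟩ ?_ ?_ ?_
  · rintro s t hst ⟨c, hc⟩
    exact ⟨c, fun r hr => hc r (hst hr)⟩
  · rintro s t ⟨c, hc⟩ ⟨c', hc'⟩
    refine ⟨max c c', fun r hr hr0 ρ h0 hC => ?_⟩
    have hrel := hp.relPotential_nonneg hr0 h0
    rcases hr with hr | hr
    · exact (hc r hr hr0 ρ h0 hC).trans (mul_le_mul_of_nonneg_right (le_max_left _ _) hrel)
    · exact (hc' r hr hr0 ρ h0 hC).trans (mul_le_mul_of_nonneg_right (le_max_right _ _) hrel)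
  · intro r hr
    obtain ⟨c, s, hs, hc⟩ := hp.pressureDefect_le_locally (hpos r hr) (hreg r hr) C
    exact ⟨s, mem_nhdsWithin_of_mem_nhds hs, c, fun r hr _ => hc r hr⟩

/-- The pressure potential is bounded on bounded sets of densities. -/
lemma IsPressure.exists_potential_bound (hp : IsPressure p) (C : ℝ) :
    ∃ M, ∀ z, 0 ≤ z → z ≤ C → |pressurePotential p z| ≤ M := by
  obtain ⟨M, hM0, hM⟩ := exists_bound_Icc hp.continuousOn (max C 1)
  -- Near vacuum the integral is only known to be `O(1/z)`; the prefactor `z` in the potential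
  -- compensates.
  have hint : ∀ z, 0 < z → z ≤ max C 1 →
      |∫ w in (1 : ℝ)..z, p w / w ^ 2| ≤ M * |∫ w in (1 : ℝ)..z, (w ^ 2)⁻¹| := by
    intro z hz hzC
    have hsub : uIcc 1 z ⊆ Ioi 0 := uIcc_subset_Ioi one_pos hz
    have hc : ContinuousOn (fun w : ℝ => M * (w ^ 2)⁻¹) (uIcc 1 z) := by
      refine continuousOn_const.mul (ContinuousOn.inv₀ (by fun_prop) fun w hw => ?_)
      have : (0 : ℝ) < w := hsub hw
      positivity
    have h := intervalIntegral.norm_integral_le_abs_of_norm_le (f := fun w => p w / w ^ 2)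
      (g := fun w => M * (w ^ 2)⁻¹) (a := 1) (b := z) (μ := volume) ?_ hc.intervalIntegrable
    · rw [intervalIntegral.integral_const_mul, abs_mul, abs_of_nonneg hM0] at h
      exact h
    · refine (ae_restrict_mem measurableSet_uIoc).mono fun w hw => ?_
      have hw' := uIoc_subset_uIcc hw
      have hw0 : (0 : ℝ) < w := hsub hw'
      have hwC : w ≤ max C 1 := hw'.2.trans (max_le (le_max_right _ _) hzC)
      rw [Real.norm_eq_abs, abs_div, abs_of_pos (by positivity : 0 < w ^ 2), div_eq_mul_inv]
      exact mul_le_mul_of_nonneg_right (hM w hw0.le hwC) (by positivity)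
  refine ⟨M * (max C 1 + 1), fun z hz hzC => ?_⟩
  rcases hz.eq_or_lt with rfl | hz0
  · rw [pressurePotential_zero, abs_zero]
    have := le_max_right C 1
    positivity
  have hcalc : ∫ w in (1 : ℝ)..z, (w ^ 2)⁻¹ = 1 - z⁻¹ := by
    have h := intervalIntegral.integral_eq_sub_of_hasDerivAt (f := fun w : ℝ => -w⁻¹)
      (f' := fun w => (w ^ 2)⁻¹) (a := 1) (b := z) (fun w hw => ?_) ?_
    · rw [h]; simp; ring
    · have hw0 : (0 : ℝ) < w := uIcc_subset_Ioi one_pos hz0 hw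
      exact (hasDerivAt_inv hw0.ne').neg.congr_deriv (by simp)
    · refine ContinuousOn.intervalIntegrable (ContinuousOn.inv₀ (by fun_prop) fun w hw => ?_)
      have : (0 : ℝ) < w := uIcc_subset_Ioi one_pos hz0 hw
      positivity
  have h1 := hint z hz0 (hzC.trans (le_max_left _ _))
  rw [hcalc] at h1
  rw [pressurePotential, abs_mul, abs_of_pos hz0]
  calc z * |∫ w in (1 : ℝ)..z, p w / w ^ 2| ≤ z * (M * |1 - z⁻¹|) :=
        mul_le_mul_of_nonneg_left h1 hz
    _ = M * |z - 1| := by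
        rw [mul_left_comm, ← abs_of_pos hz0, ← abs_mul, abs_of_pos hz0, mul_sub,
          mul_inv_cancel₀ hz0.ne', mul_one]
    _ ≤ M * (max C 1 + 1) := by
        refine mul_le_mul_of_nonneg_left ?_ hM0
        rw [abs_le]
        constructor <;> linarith [le_max_left C 1, le_max_right C 1]

lemma IsPressure.measurable_potential (hp : IsPressure p) {α : Type*} [MeasurableSpace α]
    {f : α → ℝ} (hf : Measurable f) (h0 : ∀ a, 0 ≤ f a) :
    Measurable fun a => pressurePotential p (f a) := by
  have hm : Measurable ((Ioi (0 : ℝ)).piecewise (pressurePotential p) fun _ => 0) :=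
    ContinuousOn.measurable_piecewise
      (fun z hz => (hp.hasDerivAt_potential hz).continuousAt.continuousWithinAt)
      continuousOn_const measurableSet_Ioi
  convert hm.comp hf using 2 with a
  rcases (h0 a).eq_or_lt with h | h
  · simp [← h, pressurePotential_zero]
  · simp [h]

end Pressure

/-! ### Essential right limits and weakly decreasing functions of time. -/

section WeaklyDecreasing

/-- Right neighbourhoods have positive measure. This makes essential right limits unique, so the
right energy of the competitor can be identified. -/
instance neBot_nhdsGT_inf_ae (s : ℝ) : NeBot (𝓝[>] s ⊓ ae volume) := by
  rw [inf_neBot_iff]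
  intro A hA B hB
  obtain ⟨v, hv, hsub⟩ := mem_nhdsGT_iff_exists_Ioo_subset.1 hA
  by_contra h
  have h1 : Ioo s v ⊆ Bᶜ := fun z hz hzB => h ⟨z, hsub hz, hzB⟩
  have h2 : volume (Ioo s v) = 0 := measure_mono_null h1 hB
  rw [Real.volume_Ioo, ENNReal.ofReal_eq_zero] at h2
  have : s < v := hv
  linarith

lemma exists_ae_of_eventually_inf {s : ℝ} {q : ℝ → Prop}
    (h : ∀ᶠ y in 𝓝[>] s ⊓ ae volume, q y) :
    ∃ v, s < v ∧ ∀ᵐ y, y ∈ Ioo s v → q y := by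
  obtain ⟨A, hA, B, hB, hAB⟩ := mem_inf_iff_superset.1 h
  obtain ⟨v, hv, hsub⟩ := mem_nhdsGT_iff_exists_Ioo_subset.1 hA
  refine ⟨v, hv, ?_⟩
  filter_upwards [hB] with y hy hyI
  exact hAB ⟨hsub hyI, hy⟩

/-- By evenness of the bump, mollification is integration against a translate of it, the form in
which the derivative of a smooth step appears. -/
lemma mollify_real_eq {f : ℝ → ℝ} (n : ℕ) (x : ℝ) :
    mollify volume n f x = ∫ y, (shrinkingBump ℝ n).normed volume (y - x) * f y := by
  rw [mollify_apply, ← integral_sub_left_eq_self _ volume x]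
  refine integral_congr_ae (ae_of_all _ fun y => ?_)
  simp only [smul_eq_mul, sub_sub_cancel]
  rw [← (shrinkingBump ℝ n).normed_neg, neg_sub]

lemma mollify_real_integrable {f : ℝ → ℝ} (hf : LocallyIntegrable f volume) (n : ℕ) (x : ℝ) :
    Integrable fun y => (shrinkingBump ℝ n).normed volume (y - x) * f y := by
  have := (mollify_integrable (n := n) hf x).comp_sub_left x
  refine this.congr (ae_of_all _ fun y => ?_)
  simp only [smul_eq_mul, sub_sub_cancel]
  rw [← (shrinkingBump ℝ n).normed_neg, neg_sub]

lemma normed_shrinkingBump_eq_zero {n : ℕ} {z : ℝ} (h : 1 / ((n : ℝ) + 1) ≤ |z|) :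
    (shrinkingBump ℝ n).normed volume z = 0 := by
  rw [← Function.notMem_support, ContDiffBump.support_normed_eq, Metric.mem_ball, dist_zero_right,
    Real.norm_eq_abs, not_lt]
  exact h

/-- A smooth nondecreasing step, the primitive of a mollifier. -/
noncomputable def smoothStep (n : ℕ) (y : ℝ) : ℝ :=
  ∫ z in (-1 : ℝ)..y, (shrinkingBump ℝ n).normed volume z

lemma hasDerivAt_smoothStep (n : ℕ) (y : ℝ) :
    HasDerivAt (smoothStep n) ((shrinkingBump ℝ n).normed volume y) y :=
  intervalIntegral.integral_hasDerivAt_right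
    ((shrinkingBump ℝ n).continuous_normed.intervalIntegrable _ _)
    ((shrinkingBump ℝ n).continuous_normed.stronglyMeasurableAtFilter _ _)
    (shrinkingBump ℝ n).continuous_normed.continuousAt

lemma contDiff_smoothStep (n : ℕ) : ContDiff ℝ ∞ (smoothStep n) := by
  rw [contDiff_infty_iff_deriv]
  refine ⟨fun y => (hasDerivAt_smoothStep n y).differentiableAt, ?_⟩
  have : deriv (smoothStep n) = (shrinkingBump ℝ n).normed volume := by
    ext y; exact (hasDerivAt_smoothStep n y).deriv
  rw [this]
  exact (shrinkingBump ℝ n).contDiff_normed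

lemma monotone_smoothStep (n : ℕ) : Monotone (smoothStep n) :=
  monotone_of_deriv_nonneg (fun y => (hasDerivAt_smoothStep n y).differentiableAt) fun y => by
    rw [(hasDerivAt_smoothStep n y).deriv]
    exact (shrinkingBump ℝ n).nonneg_normed y

lemma smoothStep_eq_zero {n : ℕ} {y : ℝ} (h : y ≤ -(1 / ((n : ℝ) + 1))) : smoothStep n y = 0 := by
  have h1 := shrinkingBump_rOut_le (E := ℝ) n
  rw [shrinkingBump_rOut] at h1
  have h2 : (0 : ℝ) < 1 / ((n : ℝ) + 1) := by positivity
  rw [smoothStep, intervalIntegral.integral_congr (g := fun _ => 0), intervalIntegral.integral_zero]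
  intro z hz
  have h3 : z ≤ -(1 / ((n : ℝ) + 1)) := hz.2.trans (max_le (by linarith) h)
  refine normed_shrinkingBump_eq_zero ?_
  rw [abs_of_neg (by linarith)]
  linarith

/-- Only constancy to the right of the bump matters: the value cancels in a difference of two
translated steps. -/
lemma smoothStep_eq_right {n : ℕ} {y : ℝ} (h : 1 / ((n : ℝ) + 1) ≤ y) :
    smoothStep n y = smoothStep n (1 / ((n : ℝ) + 1)) := by
  have hi : ∀ a b, IntervalIntegrable ((shrinkingBump ℝ n).normed volume) volume a b := fun a b =>
    (shrinkingBump ℝ n).continuous_normed.intervalIntegrable a b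
  rw [smoothStep, smoothStep,
    ← intervalIntegral.integral_add_adjacent_intervals (hi _ (1 / ((n : ℝ) + 1))) (hi _ y),
    intervalIntegral.integral_congr (a := 1 / ((n : ℝ) + 1)) (g := fun _ => 0),
    intervalIntegral.integral_zero, add_zero]
  intro z hz
  rw [uIcc_of_le h] at hz
  exact normed_shrinkingBump_eq_zero (hz.1.trans (le_abs_self z))

/-- A function that decreases in the weak sense lies below each of its essential right limits at
all later times. -/
lemma ae_le_of_weakly_decreasing {E : ℝ → ℝ} {s T e : ℝ} (hs : 0 ≤ s)
    (hint : IntegrableOn E (Ioc 0 T))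
    (hE : ∀ ψ : ℝ → ℝ, ContDiff ℝ ∞ ψ → (∀ t, 0 ≤ ψ t) → ψ 0 = 0 →
      (∃ T' < T, ∀ t, T' ≤ t → ψ t = 0) → 0 ≤ ∫ t in (0 : ℝ)..T, E t * deriv ψ t)
    (hlim : Tendsto E (𝓝[>] s ⊓ ae volume) (𝓝 e)) : ∀ᵐ t, t ∈ Ioo s T → E t ≤ e := by
  set E₁ := (Ioc 0 T).indicator E with hE₁
  have hE₁i : Integrable E₁ := (integrable_indicator_iff measurableSet_Ioc).2 hint
  have hloc : LocallyIntegrable E₁ := hE₁i.locallyIntegrable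
  filter_upwards [ae_mollify_tendsto hloc] with t ht htI
  have ht0 : E₁ t = E t := 
    indicator_of_mem (show t ∈ Ioc 0 T from ⟨hs.trans_lt htI.1, htI.2.le⟩) _
  rw [ht0] at ht
  refine le_of_forall_pos_le_add fun δ hδ => ?_
  obtain ⟨v, hv, hae⟩ := exists_ae_of_eventually_inf
    (hlim.eventually (ge_mem_nhds (show e < e + δ by linarith)))
  refine le_of_tendsto ht ?_
  have hsmall : ∀ᶠ n : ℕ in atTop, 1 / ((n : ℝ) + 1) < min (v - s) (min (t - s) (T - t)) / 4 :=
    tendsto_one_div_add_atTop_nhds_zero_nat.eventually (gt_mem_nhds (by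
      have := htI.1
      have := htI.2
      have : 0 < min (v - s) (min (t - s) (T - t)) :=
        lt_min (by linarith) (lt_min (by linarith) (by linarith))
      linarith))
  filter_upwards [hsmall] with n hn
  set ε := 1 / ((n : ℝ) + 1) with hε_def
  have hε : 0 < ε := by positivity
  have h1 : 4 * ε < v - s := by
    have := min_le_left (v - s) (min (t - s) (T - t)); linarith
  have h2 : 4 * ε < t - s := by
    have := (min_le_right (v - s) _).trans (min_le_left (t - s) (T - t)); linarith
  have h3 : 4 * ε < T - t := by
    have := (min_le_right (v - s) _).trans (min_le_right (t - s) (T - t)); linarith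
  -- The bump around `c` is supported in `[s + ε, s + 3ε]`, inside the interval `(s, v)` where `E ≤
  -- e + δ` almost everywhere; moreover `c < t`.
  set c := s + 2 * ε with hc
  set η := (shrinkingBump ℝ n).normed volume with hη
  have hder : ∀ y, HasDerivAt (fun y => smoothStep n (y - c) - smoothStep n (y - t))
      (η (y - c) - η (y - t)) y := fun y =>
    ((hasDerivAt_smoothStep n (y - c)).comp_sub_const y c).sub
      ((hasDerivAt_smoothStep n (y - t)).comp_sub_const y t)
  have hsm : ContDiff ℝ ∞ fun y => smoothStep n (y - c) - smoothStep n (y - t) :=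
    ((contDiff_smoothStep n).comp (contDiff_id.sub contDiff_const)).sub
      ((contDiff_smoothStep n).comp (contDiff_id.sub contDiff_const))
  -- The test function is a smoothed indicator of `(c, t)`. Its derivative is the bump at `c` minus
  -- the bump at `t`, so the weak inequality compares the mollified `E` at these two times.
  have key := hE _ hsm
    (fun y => sub_nonneg.2 (monotone_smoothStep n (by linarith)))
    (by
      rw [smoothStep_eq_zero (by rw [← hε_def]; linarith),
        smoothStep_eq_zero (by rw [← hε_def]; linarith), sub_zero])
    ⟨t + ε, by linarith, fun y hy => by
      rw [smoothStep_eq_right (by rw [← hε_def]; linarith),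
        smoothStep_eq_right (y := y - t) (by rw [← hε_def]; linarith), sub_self]⟩
  have hT : 0 ≤ T := by linarith [htI.1, htI.2]
  have heq : ∫ y in (0 : ℝ)..T, E y * deriv (fun y => smoothStep n (y - c) - smoothStep n (y - t)) y
      = mollify volume n E₁ c - mollify volume n E₁ t := by
    rw [mollify_real_eq, mollify_real_eq, ← integral_sub (mollify_real_integrable hloc n c)
      (mollify_real_integrable hloc n t), intervalIntegral.integral_of_le hT,
      ← integral_indicator measurableSet_Ioc]
    refine integral_congr_ae (ae_of_all _ fun y => ?_)
    by_cases hy : y ∈ Ioc 0 T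
    · simp only [indicator_of_mem hy, hE₁, (hder y).deriv]
      ring
    · simp [indicator_of_notMem hy, hE₁]
  have hc_le : mollify volume n E₁ c ≤ e + δ := by
    rw [mollify_real_eq]
    have hone : ∫ y, η (y - c) * (e + δ) = e + δ := by
      rw [integral_mul_const, integral_sub_right_eq_self (f := η), hη,
        ContDiffBump.integral_normed, one_mul]
    rw [← hone]
    refine integral_mono_ae (mollify_real_integrable hloc n c)
      (((shrinkingBump ℝ n).integrable_normed.comp_sub_right c).mul_const _) ?_
    filter_upwards [hae] with y hy
    by_cases hyc : |y - c| < ε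
    · rw [abs_lt] at hyc
      have hyI : y ∈ Ioc 0 T := ⟨by linarith, by linarith⟩
      have := hy ⟨by linarith, by linarith⟩
      rw [hE₁, indicator_of_mem hyI]
      exact mul_le_mul_of_nonneg_left this ((shrinkingBump ℝ n).nonneg_normed _)
    · rw [normed_shrinkingBump_eq_zero (not_lt.1 hyc)]
      simp [hη, normed_shrinkingBump_eq_zero (not_lt.1 hyc)]
  rw [heq] at key
  linarith

end WeaklyDecreasing

/-! ### Bounds and decay of the total energy of an admissible solution. -/

section Energy

variable {N : ℕ} {p : ℝ → ℝ} {T C : ℝ} {ρ : ℝ → Space N → ℝ} {u : ℝ → Space N → Space N}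

lemma IsBoundedState.measurable_energy (h : IsBoundedState C ρ u) (hp : IsPressure p) :
    Measurable fun z : ℝ × Space N => energyDensity p (ρ z.1 z.2) (u z.1 z.2) :=
  ((measurable_const.mul h.measurable_density).mul (h.measurable_velocity.norm.pow_const 2)).add
    (hp.measurable_potential h.measurable_density fun z => h.nonneg z.1 z.2)

lemma IsBoundedState.exists_energy_le (h : IsBoundedState C ρ u) (hp : IsPressure p) :
    ∃ M, ∀ t x, |energyDensity p (ρ t x) (u t x)| ≤ M := by
  obtain ⟨M, hM⟩ := hp.exists_potential_bound C
  refine ⟨1 / 2 * C * C ^ 2 + M, fun t x => (abs_add_le _ _).trans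
    (add_le_add ?_ (hM _ (h.nonneg t x) (h.le t x)))⟩
  have h0 := h.nonneg t x
  rw [abs_of_nonneg (by positivity)]
  have := h.le t x
  have := h.const_nonneg
  have := h.norm_le t x
  gcongr

lemma IsBoundedState.integrable_energy (h : IsBoundedState C ρ u) (hp : IsPressure p) (t : ℝ) :
    Integrable (fun x => energyDensity p (ρ t x) (u t x)) (cellMeasure N) := by
  obtain ⟨M, hM⟩ := h.exists_energy_le hp
  exact Integrable.of_bound ((h.measurable_energy hp).comp
    measurable_prodMk_left).aestronglyMeasurable M (ae_of_all _ (hM t))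

lemma IsBoundedState.integrableOn_totalEnergy (h : IsBoundedState C ρ u) (hp : IsPressure p)
    (a b : ℝ) : IntegrableOn (totalEnergy p ρ u) (Ioc a b) := by
  obtain ⟨M, hM⟩ := h.exists_energy_le hp
  have hi : Integrable (fun z : ℝ × Space N => energyDensity p (ρ z.1 z.2) (u z.1 z.2))
      (stMeasure N a b) :=
    Integrable.of_bound (h.measurable_energy hp).aestronglyMeasurable M
      (ae_of_all _ fun z => hM z.1 z.2)
  exact hi.integral_prod_left

/-- The energy of an admissible solution decreases in the weak sense. -/
lemma IsAdmissible.weakly_decreasing (h : IsAdmissible p T ρ u) {ψ : ℝ → ℝ}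
    (hψ : ContDiff ℝ ∞ ψ) (hpos : ∀ t, 0 ≤ ψ t) (h0 : ψ 0 = 0)
    (hT : ∃ T' < T, ∀ t, T' ≤ t → ψ t = 0) :
    0 ≤ ∫ t in (0 : ℝ)..T, totalEnergy p ρ u t * deriv ψ t := by
  obtain ⟨T', hT', hz⟩ := hT
  have := h.energy_inequality (fun t _ => ψ t)
    ⟨hψ.comp contDiff_fst, fun _ _ _ => rfl⟩ (fun t _ _ => hpos t)
    ⟨T', hT', fun t ht _ => hz t ht⟩
  simp only [fderiv_fun_const, Pi.zero_apply, _root_.zero_apply, mul_zero, add_zero,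
    h0, integral_zero, integral_mul_const] at this
  exact this

lemma totalEnergy_congr {ρ' : ℝ → Space N → ℝ} {u' : ℝ → Space N → Space N} {t : ℝ}
    (h : ∀ᵐ x ∂(cellMeasure N), ρ' t x = ρ t x ∧ u' t x = u t x) :
    totalEnergy p ρ' u' t = totalEnergy p ρ u t := by
  refine integral_congr_ae ?_
  filter_upwards [h] with x hx
  rw [hx.1, hx.2]

/-- Integrability in time is available for the bounded representative, whose energy agrees with that
of `[ρ, u]` at every time in `[0,T]`; decay is then `ae_le_of_weakly_decreasing`. -/
lemma IsAdmissible.ae_totalEnergy_le (h : IsAdmissible p T ρ u) (hp : IsPressure p)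
    {ρ' : ℝ → Space N → ℝ} {u' : ℝ → Space N → Space N} (hb : IsBoundedState C ρ' u')
    (heq : ∀ t ∈ Icc 0 T, ∀ᵐ x ∂(cellMeasure N), ρ' t x = ρ t x ∧ u' t x = u t x)
    {s e : ℝ} (hs : 0 ≤ s) (he : IsRightEnergy p ρ u s e) :
    ∀ᵐ t, t ∈ Ioo s T → totalEnergy p ρ' u' t ≤ e := by
  by_cases hsT : s < T
  swap
  · exact ae_of_all _ fun t ht => absurd (ht.1.trans ht.2) hsT
  refine ae_le_of_weakly_decreasing hs (hb.integrableOn_totalEnergy hp 0 T)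
    (fun ψ h1 h2 h3 h4 => ?_) ?_
  · have := h.weakly_decreasing h1 h2 h3 h4
    rw [intervalIntegral.integral_congr (g := fun t => totalEnergy p ρ u t * deriv ψ t)]
    · exact this
    · intro t ht
      rw [uIcc_of_le (hs.trans hsT.le)] at ht
      simp only [totalEnergy_congr (p := p) (heq t ht)]
  · refine Tendsto.congr' ?_ he
    have : ∀ᶠ t in 𝓝[>] s, t ∈ Icc 0 T := by
      filter_upwards [Ioo_mem_nhdsGT hsT] with t ht
      exact ⟨hs.trans ht.1.le, ht.2.le⟩
    filter_upwards [mem_inf_of_left this] with t ht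
    exact (totalEnergy_congr (heq t ht)).symm

end Energy

/-! ### The glued competitor and the use of maximal dissipation. -/

section Competitor

variable {N : ℕ} {p : ℝ → ℝ} {T C a b : ℝ} {ρ r : ℝ → Space N → ℝ} {u U : ℝ → Space N → Space N}

/-- A weak solution in the sense of pointwise bounds is a weak solution. -/
lemma IsBoundedWeakSolution.isWeakSolution (h : IsBoundedWeakSolution p T C ρ u)
    (hpos : ∀ᵐ x ∂(cellMeasure N), 0 < ρ 0 x) : IsWeakSolution p T ρ u where
  measurable_density := h.measurable_density
  measurable_velocity := h.measurable_velocity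
  bounded := ⟨C, fun t _ => ae_of_all _ fun x => ⟨h.nonneg t x, h.le t x, h.norm_le t x⟩⟩
  initial_pos := hpos
  continuity φ hφ τ hτ := by
    rw [h.mass φ hφ τ hτ]
    simp only [massFlux_eq (hφ.differentiableAt _)]
  momentum φ hφ τ hτ := by
    rw [h.momentum φ hφ τ hτ]
    simp only [momentumFlux_eq (hφ.differentiableAt _)]

open Classical in
/-- Extension of a function on `[a,b] × Ω`, constant in time and by zero in space. -/
noncomputable def cellExtend {F : Type*} [Zero F] (a b : ℝ) (g : ℝ → Space N → F) :
    ℝ → Space N → F :=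
  fun t x => if x ∈ cell N then clampTime a b g t x else 0

lemma cellExtend_of_mem {F : Type*} [Zero F] {g : ℝ → Space N → F} {t : ℝ} (ht : t ∈ Icc a b)
    {x : Space N} (hx : x ∈ cell N) : cellExtend a b g t x = g t x := by
  rw [cellExtend, if_pos hx, clampTime_of_mem g ht]

lemma IsC1Periodic.measurable_cellExtend {F : Type*} [NormedAddCommGroup F] [NormedSpace ℝ F]
    [MeasurableSpace F] [BorelSpace F] {g : ℝ → Space N → F} (h : IsC1Periodic a b g)
    (hab : a < b) : Measurable (Function.uncurry (cellExtend a b g)) :=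
  Measurable.ite (measurable_snd (measurableSet_cell N)) (h.clamp hab).continuous.measurable
    measurable_const

lemma IsC1Periodic.exists_norm_cellExtend_le {F : Type*} [NormedAddCommGroup F] [NormedSpace ℝ F]
    {g : ℝ → Space N → F} (h : IsC1Periodic a b g) (hab : a < b) :
    ∃ C, ∀ t x, ‖cellExtend a b g t x‖ ≤ C := by
  obtain ⟨C, hC⟩ := (h.clamp hab).exists_norm_le
  refine ⟨max C 0, fun t x => ?_⟩
  rw [cellExtend]
  split_ifs with hx
  · exact (hC t x hx).trans (le_max_left _ _)
  · simp

/-- The smooth solution is controlled only for times in `[a,b]`. Cutting off outside the cell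
destroys periodicity, which is harmless: weak states enter only through integrals over the cell. -/
lemma IsSmoothSolution.exists_boundedState (h : IsSmoothSolution p a b r U) (hab : a < b) :
    ∃ C, IsBoundedState C (cellExtend a b r) (cellExtend a b U) := by
  obtain ⟨C, hC⟩ := h.density_c1.exists_norm_cellExtend_le hab
  obtain ⟨C', hC'⟩ := h.velocity_c1.exists_norm_cellExtend_le hab
  refine ⟨max C C', h.density_c1.measurable_cellExtend hab, h.velocity_c1.measurable_cellExtend hab,
    fun t x => ?_, fun t x => ?_, fun t x => (hC' t x).trans (le_max_right _ _)⟩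
  · rw [cellExtend]
    split_ifs with hx
    · exact (h.density_pos _ (clamp_mem hab.le t) x).le
    · exact le_rfl
  · exact (le_abs_self _).trans ((hC t x).trans (le_max_left _ _))

open Classical in
/-- Concatenation in time. -/
noncomputable def glue {α : Type*} (a : ℝ) (f g : ℝ → α) : ℝ → α := fun t => if t ≤ a then f t else g t

lemma glue_of_le {α : Type*} {f g : ℝ → α} {t : ℝ} (h : t ≤ a) : glue a f g t = f t := if_pos h

lemma glue_of_lt {α : Type*} {f g : ℝ → α} {t : ℝ} (h : a < t) : glue a f g t = g t :=
  if_neg (not_le.2 h)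

lemma measurable_glue {F : Type*} [MeasurableSpace F] {f g : ℝ → Space N → F}
    (hf : Measurable (Function.uncurry f)) (hg : Measurable (Function.uncurry g)) :
    Measurable (Function.uncurry (glue a f g)) := by
  classical
  have : Function.uncurry (glue a f g)
      = fun z => if z.1 ≤ a then Function.uncurry f z else Function.uncurry g z := by
    ext ⟨t, x⟩
    by_cases h : t ≤ a <;> simp [glue, h]
  rw [this]
  exact Measurable.ite (measurable_fst measurableSet_Iic) hf hg

lemma IsBoundedState.glue {C' : ℝ} (h : IsBoundedState C ρ u) (h' : IsBoundedState C' r U) :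
    IsBoundedState (max C C') (glue a ρ r) (glue a u U) := by
  refine ⟨measurable_glue h.measurable_density h'.measurable_density,
    measurable_glue h.measurable_velocity h'.measurable_velocity, fun t x => ?_, fun t x => ?_,
    fun t x => ?_⟩ <;> rcases le_or_gt t a with ht | ht
  · rw [glue_of_le ht]; exact h.nonneg t x
  · rw [glue_of_lt ht]; exact h'.nonneg t x
  · rw [glue_of_le ht]; exact (h.le t x).trans (le_max_left _ _)
  · rw [glue_of_lt ht]; exact (h'.le t x).trans (le_max_right _ _)
  · rw [glue_of_le ht]; exact (h.norm_le t x).trans (le_max_left _ _)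
  · rw [glue_of_lt ht]; exact (h'.norm_le t x).trans (le_max_right _ _)

/-- Concatenation of integrated conservation laws at time `a`. -/
lemma conservation_glue {τ M : ℝ} (ha : 0 ≤ a) (hτ : a < τ) {S Q S' Q' : ℝ → Space N → ℝ}
    {Q₁ : ℝ → Space N → ℝ}
    (hS : ∀ t, Integrable (S t) (cellMeasure N)) (hS' : Integrable (S' τ) (cellMeasure N))
    (hQ₁ : Measurable (Function.uncurry Q₁)) (hQM : ∀ t ∈ Ioo 0 τ, ∀ x ∈ cell N, |Q₁ t x| ≤ M)
    (hl : ∀ t ≤ a, ∀ x ∈ cell N, Q₁ t x = Q t x)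
    (hr : ∀ t ∈ Ioo a τ, ∀ x ∈ cell N, Q₁ t x = Q' t x)
    (hlaw : ∫ x, (S a x - S 0 x) ∂(cellMeasure N)
      = ∫ s in (0 : ℝ)..a, ∫ x, Q s x ∂(cellMeasure N))
    (hlaw' : ∫ x, S' τ x ∂(cellMeasure N) - ∫ x, S' a x ∂(cellMeasure N)
      = ∫ z, Q' z.1 z.2 ∂(stMeasure N a τ))
    (heq : ∀ᵐ x ∂(cellMeasure N), S a x = S' a x) :
    ∫ x, (S' τ x - S 0 x) ∂(cellMeasure N)
      = ∫ s in (0 : ℝ)..τ, ∫ x, Q₁ s x ∂(cellMeasure N) := by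
  have hi : Integrable (Function.uncurry Q₁) (stMeasure N 0 a) :=
    integrable_stMeasure_of_bound hQ₁.aestronglyMeasurable fun t ht =>
      hQM t ⟨ht.1, ht.2.trans hτ⟩
  have hi' : Integrable (Function.uncurry Q₁) (stMeasure N a τ) :=
    integrable_stMeasure_of_bound hQ₁.aestronglyMeasurable fun t ht =>
      hQM t ⟨ha.trans_lt ht.1, ht.2⟩
  rw [← intervalIntegral.integral_add_adjacent_intervals (intervalIntegrable_of_stMeasure ha hi)
    (intervalIntegrable_of_stMeasure hτ.le hi'), intervalIntegral_eq_stMeasure hτ.le hi',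
    integral_sub hS' (hS 0)]
  rw [integral_sub (hS a) (hS 0), integral_congr_ae heq] at hlaw
  have h1 : ∫ s in (0 : ℝ)..a, ∫ x, Q₁ s x ∂(cellMeasure N)
      = ∫ s in (0 : ℝ)..a, ∫ x, Q s x ∂(cellMeasure N) := by
    refine intervalIntegral.integral_congr fun t ht => ?_
    rw [uIcc_of_le ha] at ht
    exact integral_congr_ae ((ae_mem_cell N).mono fun x hx => hl t ht.2 x hx)
  have h2 : ∫ z, Q₁ z.1 z.2 ∂(stMeasure N a τ) = ∫ z, Q' z.1 z.2 ∂(stMeasure N a τ) :=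
    integral_congr_ae ((ae_stMeasure_mem a τ).mono fun z hz => hr z.1 hz.1 z.2 hz.2)
  rw [h1, h2, ← hlaw, ← hlaw']
  ring

lemma massFlux_congr {φ : ℝ → Space N → ℝ} {t : ℝ} {x : Space N} (h1 : ρ t x = r t x)
    (h2 : u t x = U t x) : massFlux ρ u φ t x = massFlux r U φ t x := by
  rw [massFlux, massFlux, h1, h2]

lemma momentumFlux_congr {φ : ℝ → Space N → Space N} {t : ℝ} {x : Space N} (h1 : ρ t x = r t x)
    (h2 : u t x = U t x) : momentumFlux p ρ u φ t x = momentumFlux p r U φ t x := by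
  rw [momentumFlux, momentumFlux, h1, h2]

lemma IsBoundedState.integrable_density_mul (h : IsBoundedState C ρ u) {t : ℝ}
    {φ : Space N → ℝ} (hφ : Measurable φ) {K : ℝ} (hK : ∀ x ∈ cell N, ‖φ x‖ ≤ K) :
    Integrable (fun x => ρ t x * φ x) (cellMeasure N) := by
  refine integrable_cell_of_bound (C := C * K)
    ((measurable_slice h.measurable_density t).mul hφ).aestronglyMeasurable fun x hx => ?_
  rw [norm_mul, Real.norm_of_nonneg (h.nonneg t x)]
  exact mul_le_mul (h.le t x) (hK x hx) (norm_nonneg _) h.const_nonneg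

lemma IsBoundedState.integrable_momentum_inner (h : IsBoundedState C ρ u) {t : ℝ}
    {φ : Space N → Space N} (hφ : Measurable φ) {K : ℝ} (hK : ∀ x ∈ cell N, ‖φ x‖ ≤ K) :
    Integrable (fun x => ⟪ρ t x • u t x, φ x⟫) (cellMeasure N) := by
  refine integrable_cell_of_bound (C := C * C * K) (((measurable_slice h.measurable_density t).smul
    (measurable_slice h.measurable_velocity t)).inner hφ).aestronglyMeasurable fun x hx => ?_
  refine (norm_inner_le_norm _ _).trans ?_
  refine mul_le_mul ?_ (hK x hx) (norm_nonneg _) (mul_nonneg h.const_nonneg h.const_nonneg)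
  rw [norm_smul, Real.norm_of_nonneg (h.nonneg t x)]
  exact mul_le_mul (h.le t x) (h.norm_le t x) (norm_nonneg _) h.const_nonneg

lemma IsTest.exists_norm_le {F : Type*} [NormedAddCommGroup F] [NormedSpace ℝ F]
    {φ : ℝ → Space N → F} (h : IsTest φ) (t : ℝ) : ∃ K, ∀ x ∈ cell N, ‖φ t x‖ ≤ K := by
  obtain ⟨K, hK⟩ := (isCompact_cell N).exists_bound_of_continuousOn (f := φ t)
    (h.smooth.continuous.comp (by fun_prop : Continuous fun x : Space N => (t, x))).continuousOn
  exact ⟨K, hK⟩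

/-- Following a weak solution up to time `a` and a smooth solution afterwards gives a weak
solution. -/
lemma IsBoundedWeakSolution.glue_smooth (h : IsBoundedWeakSolution p T C ρ u) (hp : IsPressure p)
    (hsm : IsSmoothSolution p a b r U) (ha : 0 ≤ a) (hab : a < b) (hbT : b ≤ T)
    (heq : ∀ᵐ x ∂(cellMeasure N), ρ a x = r a x ∧ u a x = U a x) :
    ∃ C', IsBoundedWeakSolution p b C' (glue a ρ (cellExtend a b r))
      (glue a u (cellExtend a b U)) := by
  obtain ⟨C₁, hC₁⟩ := hsm.exists_boundedState hab
  have hst := h.toIsBoundedState.glue (a := a) hC₁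
  have h0b : 0 < b := ha.trans_lt hab
  refine ⟨max C C₁, hst, fun φ hφ τ hτ => ?_, fun φ hφ τ hτ => ?_⟩ <;>
    rcases le_or_gt τ a with hτa | hτa
  · simp only [glue_of_le hτa, glue_of_le ha]
    rw [h.mass φ hφ τ ⟨hτ.1, hτ.2.trans hbT⟩]
    refine intervalIntegral.integral_congr fun t ht => ?_
    rw [uIcc_of_le hτ.1] at ht
    exact integral_congr_ae (ae_of_all _ fun x => massFlux_congr
      (by rw [glue_of_le (ht.2.trans hτa)]) (by rw [glue_of_le (ht.2.trans hτa)]))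
  · obtain ⟨K, hK⟩ := (hφ.isC1Periodic (a := 0) (b := b)).exists_norm_stDeriv_le h0b
    simp only [glue_of_lt hτa, glue_of_le ha]
    refine conservation_glue (S := fun t x => ρ t x * φ t x) (Q := massFlux ρ u φ)
      (S' := fun t x => cellExtend a b r t x * φ t x)
      (Q' := massFlux r U φ) ha hτa (fun t => ?_) ?_ (hst.measurable_massFlux φ)
      (fun t ht x hx => hst.abs_massFlux_le (hK t ⟨ht.1, ht.2.trans_le hτ.2⟩ x hx))
      (fun t ht x _ => massFlux_congr (by rw [glue_of_le ht]) (by rw [glue_of_le ht]))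
      (fun t ht x hx => ?_) (h.mass φ hφ a ⟨ha, hab.le.trans hbT⟩) ?_ ?_
    · obtain ⟨L, hL⟩ := hφ.exists_norm_le t
      exact h.integrable_density_mul (hφ.measurable t) hL
    · obtain ⟨L, hL⟩ := hφ.exists_norm_le τ
      exact hC₁.integrable_density_mul (hφ.measurable τ) hL
    · have htI : t ∈ Icc a b := ⟨ht.1.le, ht.2.le.trans hτ.2⟩
      exact massFlux_congr (by rw [glue_of_lt ht.1, cellExtend_of_mem htI hx])
        (by rw [glue_of_lt ht.1, cellExtend_of_mem htI hx])
    · rw [← hsm.mass_weak hab ⟨hτa.le, hτ.2⟩ hφ.isC1Periodic]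
      congr 1 <;> refine integral_congr_ae ((ae_mem_cell N).mono fun x hx => ?_)
      · simp only [cellExtend_of_mem (⟨hτa.le, hτ.2⟩ : τ ∈ Icc a b) hx]
      · simp only [cellExtend_of_mem (⟨le_rfl, hab.le⟩ : a ∈ Icc a b) hx]
    · filter_upwards [heq, ae_mem_cell N] with x hx hxc
      rw [cellExtend_of_mem ⟨le_rfl, hab.le⟩ hxc, hx.1]
  · simp only [glue_of_le hτa, glue_of_le ha]
    rw [h.momentum φ hφ τ ⟨hτ.1, hτ.2.trans hbT⟩]
    refine intervalIntegral.integral_congr fun t ht => ?_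
    rw [uIcc_of_le hτ.1] at ht
    exact integral_congr_ae (ae_of_all _ fun x => momentumFlux_congr
      (by rw [glue_of_le (ht.2.trans hτa)]) (by rw [glue_of_le (ht.2.trans hτa)]))
  · obtain ⟨K, hK⟩ := (hφ.isC1Periodic (a := 0) (b := b)).exists_norm_stDeriv_le h0b
    obtain ⟨M, -, hM⟩ := exists_bound_Icc hp.continuousOn (max C C₁)
    simp only [glue_of_lt hτa, glue_of_le ha]
    refine conservation_glue (S := fun t x => ⟪ρ t x • u t x, φ t x⟫) (Q := momentumFlux p ρ u φ)
      (S' := fun t x => ⟪cellExtend a b r t x • cellExtend a b U t x, φ t x⟫)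
      (Q' := momentumFlux p r U φ) ha hτa (fun t => ?_) ?_
      (hst.measurable_momentumFlux hp.continuousOn φ)
      (fun t ht x hx => hst.abs_momentumFlux_le hM (hK t ⟨ht.1, ht.2.trans_le hτ.2⟩ x hx))
      (fun t ht x _ => momentumFlux_congr (by rw [glue_of_le ht]) (by rw [glue_of_le ht]))
      (fun t ht x hx => ?_) (h.momentum φ hφ a ⟨ha, hab.le.trans hbT⟩) ?_ ?_
    · obtain ⟨L, hL⟩ := hφ.exists_norm_le t
      exact h.integrable_momentum_inner (hφ.measurable t) hL
    · obtain ⟨L, hL⟩ := hφ.exists_norm_le τ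
      exact hC₁.integrable_momentum_inner (hφ.measurable τ) hL
    · have htI : t ∈ Icc a b := ⟨ht.1.le, ht.2.le.trans hτ.2⟩
      exact momentumFlux_congr (by rw [glue_of_lt ht.1, cellExtend_of_mem htI hx])
        (by rw [glue_of_lt ht.1, cellExtend_of_mem htI hx])
    · rw [← hsm.momentum_weak hp hab ⟨hτa.le, hτ.2⟩ hφ.isC1Periodic]
      congr 1 <;> refine integral_congr_ae ((ae_mem_cell N).mono fun x hx => ?_)
      · simp only [cellExtend_of_mem (⟨hτa.le, hτ.2⟩ : τ ∈ Icc a b) hx]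
      · simp only [cellExtend_of_mem (⟨le_rfl, hab.le⟩ : a ∈ Icc a b) hx]
    · filter_upwards [heq, ae_mem_cell N] with x hx hxc
      rw [cellExtend_of_mem ⟨le_rfl, hab.le⟩ hxc, cellExtend_of_mem ⟨le_rfl, hab.le⟩ hxc, hx.1, hx.2]

lemma IsPressure.contDiffOn_potential (hp : IsPressure p) :
    ContDiffOn ℝ 1 (pressurePotential p) (Ioi 0) := by
  rw [show (1 : WithTop ℕ∞) = 0 + 1 from (zero_add 1).symm,
    contDiffOn_succ_iff_deriv_of_isOpen isOpen_Ioi]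
  refine ⟨fun z hz => (hp.hasDerivAt_potential hz).differentiableAt.differentiableWithinAt,
    by simp, contDiffOn_zero.2 ?_⟩
  exact (hp.contDiffOn_potentialDeriv.continuousOn).congr fun z hz =>
    (hp.hasDerivAt_potential hz).deriv

lemma isC1Periodic_const {F : Type*} [NormedAddCommGroup F] [NormedSpace ℝ F] (c : F) :
    IsC1Periodic a b fun (_ : ℝ) (_ : Space N) => c :=
  ⟨contDiffOn_const, fun _ _ _ _ => rfl⟩

lemma IsSmoothSolution.energy_c1 (h : IsSmoothSolution p a b r U) (hp : IsPressure p) :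
    IsC1Periodic a b fun t x => energyDensity p (r t x) (U t x) := by
  have := (((isC1Periodic_const (1 / 2 : ℝ)).mul h.density_c1).mul
    (h.velocity_c1.inner h.velocity_c1)).add
    (h.density_c1.comp hp.contDiffOn_potential h.density_pos)
  simpa only [real_inner_self_eq_norm_sq, energyDensity] using this

lemma IsC1Periodic.continuousOn_integral {g : ℝ → Space N → ℝ} (h : IsC1Periodic a b g)
    (hab : a < b) : ContinuousOn (fun t => ∫ x, g t x ∂(cellMeasure N)) (Icc a b) := by
  have hc := (h.clamp hab).continuous
  obtain ⟨C, hC⟩ := (h.clamp hab).exists_norm_le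
  have : Continuous fun t => ∫ x, clampTime a b g t x ∂(cellMeasure N) := by
    refine continuous_of_dominated (bound := fun _ => C) (fun t => ?_)
      (fun t => (ae_mem_cell N).mono (hC t)) (integrable_const _) (ae_of_all _ fun x => ?_)
    · exact (hc.comp (by fun_prop : Continuous fun x : Space N => (t, x))).aestronglyMeasurable
    · exact hc.comp (by fun_prop : Continuous fun t : ℝ => (t, x))
  exact this.continuousOn.congr fun t ht => by simp only [clampTime_of_mem g ht]

/-- The principle of maximal dissipation prevents an initial jump of the energy: after time `a`
the energy does not exceed that of the smooth solution at time `a`. -/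
lemma IsAdmissible.ae_totalEnergy_le_smooth (hadm : IsAdmissible p T ρ u) (hp : IsPressure p)
    (hmax : MaximalDissipation p T ρ u) {ρ' : ℝ → Space N → ℝ} {u' : ℝ → Space N → Space N}
    (hb : IsBoundedWeakSolution p T C ρ' u')
    (heq : ∀ t ∈ Icc 0 T, ∀ᵐ x ∂(cellMeasure N), ρ' t x = ρ t x ∧ u' t x = u t x)
    (hsm : IsSmoothSolution p a b r U) (ha : 0 ≤ a) (hab : a < b) (hbT : b ≤ T)
    (hagree : ∀ᵐ x ∂(cellMeasure N), ρ' a x = r a x ∧ u' a x = U a x) :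
    ∀ᵐ t, t ∈ Ioo a b → totalEnergy p ρ' u' t ≤ totalEnergy p r U a := by
  obtain ⟨C', hC'⟩ := hb.glue_smooth hp hsm ha hab hbT hagree
  have hT0 : (0 : ℝ) ∈ Icc 0 T := ⟨le_rfl, ha.trans (hab.le.trans hbT)⟩
  have hcont : ContinuousOn (totalEnergy p r U) (Icc a b) :=
    (hsm.energy_c1 hp).continuousOn_integral hab
  have hgl : ∀ t ∈ Ioo a b, totalEnergy p (glue a ρ' (cellExtend a b r))
      (glue a u' (cellExtend a b U)) t = totalEnergy p r U t := by
    intro t ht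
    refine totalEnergy_congr ((ae_mem_cell N).mono fun x hx => ?_)
    rw [glue_of_lt ht.1, glue_of_lt ht.1, cellExtend_of_mem (Ioo_subset_Icc_self ht) hx,
      cellExtend_of_mem (Ioo_subset_Icc_self ht) hx]
    exact ⟨rfl, rfl⟩
  -- The energy of the competitor is continuous on `(a,b)`, so its right limits exist and equal the
  -- smooth energy.
  have hright : ∀ t ∈ Ioo a b, IsRightEnergy p (glue a ρ' (cellExtend a b r))
      (glue a u' (cellExtend a b U)) t (totalEnergy p r U t) := by
    intro t ht
    have h1 : Tendsto (totalEnergy p r U) (𝓝 t) (𝓝 (totalEnergy p r U t)) :=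
      hcont.continuousAt (Icc_mem_nhds ht.1 ht.2)
    have h2 : Tendsto (totalEnergy p (glue a ρ' (cellExtend a b r))
        (glue a u' (cellExtend a b U))) (𝓝 t) (𝓝 (totalEnergy p r U t)) := by
      refine h1.congr' ?_
      filter_upwards [Ioo_mem_nhds ht.1 ht.2] with s hs
      exact (hgl s hs).symm
    exact h2.mono_left (inf_le_left.trans nhdsWithin_le_nhds)
  obtain ⟨σ, hσ, hσlim, hσE⟩ := hmax a b _ _ ha hab hbT
    (hC'.isWeakSolution (by
      simp only [glue_of_le ha]
      filter_upwards [heq 0 hT0, hadm.weak.initial_pos] with x hx h0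
      rwa [hx.1]))
    (fun t ht => by
      simp only [glue_of_le ht.2]
      filter_upwards [heq t ⟨ht.1, ht.2.trans (hab.le.trans hbT)⟩] with x hx
      rw [hx.1, hx.2]
      exact ⟨rfl, rfl⟩)
    fun t ht => ⟨_, hright t ht⟩
  -- Maximal dissipation compares the right energies at `σ n`, and admissibility propagates the
  -- bound to almost every later time.
  have hn : ∀ n, ∀ᵐ t, t ∈ Ioo (σ n) T → totalEnergy p ρ' u' t ≤ totalEnergy p r U (σ n) := by
    intro n
    obtain ⟨e, e', he, he', hle⟩ := hσE n
    have : e' = totalEnergy p r U (σ n) := tendsto_nhds_unique he' (hright _ (hσ n))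
    filter_upwards [hadm.ae_totalEnergy_le hp hb.toIsBoundedState heq
      (ha.trans (hσ n).1.le) he] with t ht htI
    exact (ht htI).trans (hle.trans this.le)
  filter_upwards [ae_all_iff.2 hn] with t ht htI
  -- Continuity of the smooth energy up to the initial time `a` is what closes the jump.
  have hlim : Tendsto (fun n => totalEnergy p r U (σ n)) atTop (𝓝 (totalEnergy p r U a)) := by
    have h1 : Tendsto σ atTop (𝓝[Icc a b] a) :=
      tendsto_nhdsWithin_iff.2 ⟨hσlim, .of_forall fun n => Ioo_subset_Icc_self (hσ n)⟩
    exact Tendsto.comp (g := totalEnergy p r U) (hcont a ⟨le_rfl, hab.le⟩) h1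
  refine ge_of_tendsto hlim ?_
  filter_upwards [hσlim.eventually (gt_mem_nhds htI.1)] with n hn'
  exact ht n ⟨hn', htI.2.trans_le hbT⟩

end Competitor

/-! ### Grönwall's lemma without continuity. -/

section Gronwall

/-- Grönwall's lemma for integrable functions. -/
lemma ae_eq_zero_of_le_integral {f : ℝ → ℝ} {a b L : ℝ} (hab : a ≤ b) (hL : 0 ≤ L)
    (hf : IntegrableOn f (Ioc a b)) (h0 : ∀ t ∈ Ioo a b, 0 ≤ f t)
    (hle : ∀ᵐ t, t ∈ Ioo a b → f t ≤ L * ∫ s in a..t, f s) :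
    ∀ᵐ t, t ∈ Ioo a b → f t = 0 := by
  set f₁ := (Ioo a b).indicator f with hf₁
  have hf₁i : Integrable f₁ :=
    (integrable_indicator_iff measurableSet_Ioo).2 (hf.mono_set Ioo_subset_Ioc_self)
  have hf₁0 : ∀ t, 0 ≤ f₁ t := fun t => indicator_nonneg h0 t
  set F : ℝ → ℝ := fun t => ∫ s in a..t, f₁ s with hF
  have hFc : Continuous F := intervalIntegral.continuous_primitive
    (fun _ _ => hf₁i.intervalIntegrable) a
  -- Since `f` is merely integrable, its primitive `F` need not be differentiable everywhere. The
  -- second primitive is: integrating the hypothesis gives `G' = F ≤ L G` with `G a = 0`, to which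
  -- the classical lemma applies.
  set G : ℝ → ℝ := fun t => ∫ s in a..t, F s with hG
  have hGd : ∀ t, HasDerivAt G (F t) t := fun t =>
    intervalIntegral.integral_hasDerivAt_right (hFc.intervalIntegrable _ _)
      (hFc.stronglyMeasurableAtFilter _ _) hFc.continuousAt
  have hF0 : ∀ t, a ≤ t → 0 ≤ F t := fun t ht =>
    intervalIntegral.integral_nonneg ht fun s _ => hf₁0 s
  have hG0 : ∀ t, a ≤ t → 0 ≤ G t := fun t ht =>
    intervalIntegral.integral_nonneg ht fun s hs => hF0 s hs.1
  have hle₁ : ∀ᵐ t, a ≤ t → f₁ t ≤ L * F t := by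
    filter_upwards [hle] with t ht hat
    by_cases htI : t ∈ Ioo a b
    · rw [hf₁, indicator_of_mem htI]
      refine (ht htI).trans (le_of_eq ?_)
      congr 1
      rw [hF]
      simp only
      rw [intervalIntegral.integral_of_le htI.1.le, intervalIntegral.integral_of_le htI.1.le]
      refine setIntegral_congr_fun measurableSet_Ioc fun s hs => ?_
      simp only [hf₁]
      rw [indicator_of_mem (show s ∈ Ioo a b from ⟨hs.1, hs.2.trans_lt htI.2⟩)]
    · rw [hf₁, indicator_of_notMem htI]
      exact mul_nonneg hL (hF0 t hat)
  have hFG : ∀ t, a ≤ t → F t ≤ L * G t := fun t ht => by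
    simp only [hF, hG]
    rw [← intervalIntegral.integral_const_mul]
    refine intervalIntegral.integral_mono_ae_restrict ht hf₁i.intervalIntegrable
      ((continuous_const.mul hFc).intervalIntegrable _ _) ?_
    refine (ae_restrict_iff' measurableSet_Icc).2 ?_
    filter_upwards [hle₁] with s hs hsI
    exact hs hsI.1
  have hGz : G b = 0 := by
    have := norm_le_gronwallBound_of_norm_deriv_right_le (f := G) (f' := F) (δ := 0) (K := L)
      (ε := 0) (a := a) (b := b) (fun t _ => (hGd t).continuousAt.continuousWithinAt)
      (fun t _ => (hGd t).hasDerivWithinAt) (by simp [hG]) (fun t ht => by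
        rw [Real.norm_of_nonneg (hF0 t ht.1), Real.norm_of_nonneg (hG0 t ht.1), add_zero]
        exact hFG t ht.1) b ⟨hab, le_rfl⟩
    simpa [gronwallBound_ε0] using this
  have hFz : ∫ s in a..b, f₁ s = 0 :=
    le_antisymm ((hFG b hab).trans (by rw [hGz, mul_zero])) (hF0 b hab)
  rw [intervalIntegral.integral_of_le hab, integral_eq_zero_iff_of_nonneg hf₁0 hf₁i.integrableOn,
    ← restrict_Ioo_eq_restrict_Ioc, Filter.EventuallyEq, ae_restrict_iff' measurableSet_Ioo] at hFz
  filter_upwards [hFz] with t ht htI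
  have := ht htI
  rwa [hf₁, indicator_of_mem htI] at this

end Gronwall

/-! ### The relative energy inequality and uniqueness at almost every time. -/

section RelativeEnergy

variable {N : ℕ} {p : ℝ → ℝ} {T C a b : ℝ} {ρ r : ℝ → Space N → ℝ} {u U : ℝ → Space N → Space N}

/-- The relative energy of `[ρ, u]` with respect to `[r, U]`. -/
noncomputable def relEnergy (p : ℝ → ℝ) (ρ : ℝ → Space N → ℝ) (u : ℝ → Space N → Space N)
    (r : ℝ → Space N → ℝ) (U : ℝ → Space N → Space N) (t : ℝ) (x : Space N) : ℝ :=
  1 / 2 * ρ t x * ‖u t x - U t x‖ ^ 2 + relPotential p (ρ t x) (r t x)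

/-- The multiplier of the continuity equation in the relative energy identity. -/
noncomputable def massMultiplier (p : ℝ → ℝ) (r : ℝ → Space N → ℝ) (U : ℝ → Space N → Space N)
    (t : ℝ) (x : Space N) : ℝ :=
  1 / 2 * ⟪U t x, U t x⟫ - potentialDeriv p (r t x)

/-- Apart from the energy itself, everything is linear in `ρ` and `ρu` or depends on `r` alone, so
the evolution of these terms is known exactly. -/
lemma relEnergy_eq {t : ℝ} {x : Space N} (hr : 0 < r t x) :
    relEnergy p ρ u r U t x = energyDensity p (ρ t x) (u t x) - ⟪ρ t x • u t x, U t x⟫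
      + ρ t x * massMultiplier p r U t x + p (r t x) := by
  rw [relEnergy, relPotential, energyDensity, massMultiplier, pressurePotential_eq hr,
    real_inner_smul_left, norm_sub_sq_real, real_inner_self_eq_norm_sq]
  ring

lemma IsSmoothSolution.massMultiplier_c1 (h : IsSmoothSolution p a b r U) (hp : IsPressure p) :
    IsC1Periodic a b (massMultiplier p r U) :=
  ((isC1Periodic_const (1 / 2 : ℝ)).mul (h.velocity_c1.inner h.velocity_c1)).sub
    (h.density_c1.comp hp.contDiffOn_potentialDeriv h.density_pos)

/-- The rate of change of the relative energy. -/
noncomputable def relFlux (p : ℝ → ℝ) (ρ : ℝ → Space N → ℝ) (u : ℝ → Space N → Space N)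
    (r : ℝ → Space N → ℝ) (U : ℝ → Space N → Space N) (t : ℝ) (x : Space N) : ℝ :=
  massFlux ρ u (massMultiplier p r U) t x - momentumFlux p ρ u U t x
    + (stDeriv (fun t x => p (r t x)) t x (1, 0)
      + spaceDiv (stDeriv (fun t x => p (r t x) • U t x) t x))

/-- Put `u = U + w`. The smooth momentum equation makes `⟨w, DU(1,U)⟩` cancel the derivative of
`P'(r)` along `w`, and the smooth continuity equation replaces the derivative of `r` along `(1,U)`
by `-r div U`. What remains is quadratic in `w` or a Taylor remainder of `p`. -/
lemma IsSmoothSolution.relFlux_eq (h : IsSmoothSolution p a b r U) (hp : IsPressure p) {t : ℝ}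
    (ht : t ∈ Ioo a b) (x : Space N) :
    relFlux p ρ u r U t x
      = -(ρ t x * ⟪u t x - U t x, stDeriv U t x (0, u t x - U t x)⟫)
        - spaceDiv (stDeriv U t x)
          * (p (ρ t x) - p (r t x) - deriv p (r t x) * (ρ t x - r t x)) := by
  have hr := h.density_c1.differentiableAt ht x
  have hU := h.velocity_c1.differentiableAt ht x
  have hpos := h.density_pos t (Ioo_subset_Icc_self ht) x
  have hmult : ∀ v, stDeriv (massMultiplier p r U) t x v
      = ⟪U t x, stDeriv U t x v⟫ - deriv p (r t x) / r t x * stDeriv r t x v := by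
    intro v
    have h1 := (h.velocity_c1.inner h.velocity_c1).differentiableAt ht x
    have h2 := (h.density_c1.comp hp.contDiffOn_potentialDeriv h.density_pos).differentiableAt ht x
    have h3 : stDeriv (massMultiplier p r U) t x v
        = 1 / 2 * stDeriv (fun t x => ⟪U t x, U t x⟫) t x v
          - stDeriv (fun t x => potentialDeriv p (r t x)) t x v := by
      have := ((h1.hasFDerivAt.const_mul (1 / 2 : ℝ)).sub h2.hasFDerivAt).fderiv
      change fderiv ℝ (Function.uncurry (massMultiplier p r U)) (t, x) v = _
      refine (congrArg (fun L => L v) this).trans ?_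
      rfl
    rw [h3, stDeriv_inner hU hU, stDeriv_comp (hp.hasDerivAt_potentialDeriv hpos) hr,
      real_inner_comm (U t x)]
    ring
  have hsplit : ∀ L : ℝ × Space N →L[ℝ] Space N,
      L (1, u t x) = L (1, U t x) + L (0, u t x - U t x) := fun L => by
    rw [← map_add]; simp
  have hsplit' : ∀ L : ℝ × Space N →L[ℝ] ℝ,
      L (1, u t x) = L (1, U t x) + L (0, u t x - U t x) := fun L => by
    rw [← map_add]; simp
  have hmass := h.mass_eq ht x
  have hmom := h.momentum_eq hp ht x (u t x - U t x)
  have hmom' : ⟪stDeriv U t x (1, U t x), u t x - U t x⟫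
      = -(deriv p (r t x) / r t x * stDeriv r t x (0, u t x - U t x)) := by
    field_simp
    linarith
  rw [relFlux, h.pressure_balance hp ht x, massFlux, momentumFlux, hmult, hsplit, hsplit', hmass]
  rw [real_inner_comm, inner_sub_left] at hmom'
  simp only [inner_add_right, inner_sub_left]
  have hrr : deriv p (r t x) / r t x * (r t x * spaceDiv (stDeriv U t x))
      = deriv p (r t x) * spaceDiv (stDeriv U t x) := by
    field_simp
  linear_combination -(ρ t x) * hmom' + ρ t x * hrr

/-- The rate of change of the relative energy is controlled by the relative energy. -/
lemma IsSmoothSolution.exists_relFlux_le (h : IsSmoothSolution p a b r U) (hp : IsPressure p)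
    (hab : a < b) (hst : IsBoundedState C ρ u) :
    ∃ L, 0 ≤ L ∧ ∀ t ∈ Ioo a b, ∀ x ∈ cell N,
      relFlux p ρ u r U t x ≤ L * relEnergy p ρ u r U t x ∧
      (ρ t x - r t x) ^ 2 ≤ L * relPotential p (ρ t x) (r t x) := by
  have hcomp : IsCompact (Function.uncurry r '' (Icc a b ×ˢ cell N)) :=
    (isCompact_Icc.prod (isCompact_cell N)).image_of_continuousOn
      (h.contDiffOn_density.continuousOn.mono (prod_mono_right (subset_univ _)))
  obtain ⟨c₀, hc₀⟩ := hp.exists_pressureDefect_le hcomp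
    (by rintro _ ⟨z, hz, rfl⟩; exact h.density_pos z.1 hz.1 z.2)
    (by rintro _ ⟨z, hz, rfl⟩; exact h.flux_regular z.1 hz.1 z.2) C
  obtain ⟨K₀, hK₀⟩ := h.velocity_c1.exists_norm_stDeriv_le hab
  set c := max c₀ 0
  set K := max K₀ 0
  have hc : 0 ≤ c := le_max_right _ _
  have hK : 0 ≤ K := le_max_right _ _
  -- The summands serve the kinetic term, the pressure remainder multiplied by `div U`, and the
  -- squared density difference, respectively.
  refine ⟨2 * K + N * K * c + c, by positivity, fun t ht x hx => ?_⟩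
  have htI := Ioo_subset_Icc_self ht
  have hpos := h.density_pos t htI x
  have hrel := hp.relPotential_nonneg hpos (hst.nonneg t x)
  have hdef : pressureDefect p (ρ t x) (r t x) ≤ c * relPotential p (ρ t x) (r t x) :=
    (hc₀ _ ⟨(t, x), ⟨htI, hx⟩, rfl⟩ _ (hst.nonneg t x) (hst.le t x)).trans
      (mul_le_mul_of_nonneg_right (le_max_left _ _) hrel)
  have hNK : 0 ≤ (N : ℝ) * K := by positivity
  have habs : |p (ρ t x) - p (r t x) - deriv p (r t x) * (ρ t x - r t x)|
      ≤ c * relPotential p (ρ t x) (r t x) :=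
    le_trans (le_add_of_nonneg_right (sq_nonneg _)) hdef
  have hsq : (ρ t x - r t x) ^ 2 ≤ c * relPotential p (ρ t x) (r t x) :=
    le_trans (le_add_of_nonneg_left (abs_nonneg _)) hdef
  have hDU : ‖stDeriv U t x‖ ≤ K := (hK₀ t ht x hx).trans (le_max_left _ _)
  set w := u t x - U t x with hw
  have hkin : -(ρ t x * ⟪w, stDeriv U t x (0, w)⟫) ≤ 2 * K * (1 / 2 * ρ t x * ‖w‖ ^ 2) := by
    have h1 : |⟪w, stDeriv U t x (0, w)⟫| ≤ ‖w‖ * (K * ‖w‖) := by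
      refine (abs_real_inner_le_norm _ _).trans ?_
      refine mul_le_mul_of_nonneg_left ?_ (norm_nonneg _)
      have h2 := (stDeriv U t x).le_of_opNorm_le hDU (0, w)
      have h3 : ‖((0 : ℝ), w)‖ = ‖w‖ := by simp [Prod.norm_def]
      rwa [h3] at h2
    have h4 := mul_le_mul_of_nonneg_left ((neg_le_abs _).trans h1) (hst.nonneg t x)
    linarith
  have hdiv : -(spaceDiv (stDeriv U t x)
      * (p (ρ t x) - p (r t x) - deriv p (r t x) * (ρ t x - r t x)))
      ≤ N * K * (c * relPotential p (ρ t x) (r t x)) := by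
    refine (neg_le_abs _).trans ?_
    rw [abs_mul]
    exact mul_le_mul (abs_spaceDiv_le hDU) habs (abs_nonneg _) hNK
  have hkin0 : 0 ≤ 1 / 2 * ρ t x * ‖w‖ ^ 2 := by
    have := hst.nonneg t x
    positivity
  constructor
  · rw [h.relFlux_eq hp ht x, relEnergy, ← hw]
    have e1 : 0 ≤ (N * K * c + c) * (1 / 2 * ρ t x * ‖w‖ ^ 2) := by positivity
    have e2 : 0 ≤ (2 * K + c) * relPotential p (ρ t x) (r t x) := by positivity
    linarith
  · have : 0 ≤ (2 * K + N * K * c) * relPotential p (ρ t x) (r t x) := by positivity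
    linarith

lemma IsC1Periodic.aestronglyMeasurable {F : Type*} [NormedAddCommGroup F] [NormedSpace ℝ F]
    {g : ℝ → Space N → F} (h : IsC1Periodic a b g) (hab : a < b) {τ : ℝ} (hτ : τ ≤ b) :
    AEStronglyMeasurable (fun z : ℝ × Space N => g z.1 z.2) (stMeasure N a τ) := by
  refine ((h.clamp hab).continuous.aestronglyMeasurable (μ := stMeasure N a τ)).congr ?_
  filter_upwards [ae_stMeasure_mem a τ] with z hz
  simp only [Function.uncurry,
    clampTime_of_mem g (⟨hz.1.1.le, hz.1.2.le.trans hτ⟩ : z.1 ∈ Icc a b)]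

/-- Test functions of class `C¹` are admitted in the weak continuity equation. -/
lemma IsBoundedWeakSolution.mass_of_isC1Periodic (h : IsBoundedWeakSolution p T C ρ u)
    (ha : 0 ≤ a) (hab : a < b) (hbT : b ≤ T) {τ : ℝ} (hτ : τ ∈ Icc a b) {φ : ℝ → Space N → ℝ}
    (hφ : IsC1Periodic a b φ) :
    ∫ x, ρ τ x * φ τ x ∂(cellMeasure N) - ∫ x, ρ a x * φ a x ∂(cellMeasure N)
      = ∫ z, massFlux ρ u φ z.1 z.2 ∂(stMeasure N a τ) := by
  have := h.mass_of_isC1Test ha hbT hτ (hφ.clamp hab)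
  rw [clampTime_of_mem φ hτ, clampTime_of_mem φ ⟨le_rfl, hab.le⟩] at this
  rw [this]
  refine integral_congr_ae ((ae_stMeasure_mem a τ).mono fun z hz => ?_)
  simp only [massFlux]
  rw [stDeriv_clampTime φ ⟨hz.1.1, hz.1.2.trans_le hτ.2⟩]

/-- Test functions of class `C¹` are admitted in the weak momentum equation. -/
lemma IsBoundedWeakSolution.momentum_of_isC1Periodic (h : IsBoundedWeakSolution p T C ρ u)
    (hp : ContinuousOn p (Ici 0)) (ha : 0 ≤ a) (hab : a < b) (hbT : b ≤ T) {τ : ℝ}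
    (hτ : τ ∈ Icc a b) {φ : ℝ → Space N → Space N} (hφ : IsC1Periodic a b φ) :
    ∫ x, ⟪ρ τ x • u τ x, φ τ x⟫ ∂(cellMeasure N) - ∫ x, ⟪ρ a x • u a x, φ a x⟫ ∂(cellMeasure N)
      = ∫ z, momentumFlux p ρ u φ z.1 z.2 ∂(stMeasure N a τ) := by
  have := h.momentum_of_isC1Test hp ha hbT hτ (hφ.clamp hab)
  rw [clampTime_of_mem φ hτ, clampTime_of_mem φ ⟨le_rfl, hab.le⟩] at this
  rw [this]
  refine integral_congr_ae ((ae_stMeasure_mem a τ).mono fun z hz => ?_)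
  simp only [momentumFlux]
  rw [stDeriv_clampTime φ ⟨hz.1.1, hz.1.2.trans_le hτ.2⟩]

lemma IsBoundedState.integrable_massFlux (h : IsBoundedState C ρ u) (hab : a < b) {τ : ℝ}
    (hτ : τ ≤ b) {φ : ℝ → Space N → ℝ} (hφ : IsC1Periodic a b φ) :
    Integrable (fun z => massFlux ρ u φ z.1 z.2) (stMeasure N a τ) := by
  obtain ⟨K, hK⟩ := hφ.exists_norm_stDeriv_le hab
  exact integrable_stMeasure_of_bound (h.measurable_massFlux φ).aestronglyMeasurable
    fun t ht x hx => h.abs_massFlux_le (hK t ⟨ht.1, ht.2.trans_le hτ⟩ x hx)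

lemma IsBoundedState.integrable_momentumFlux (h : IsBoundedState C ρ u)
    (hp : ContinuousOn p (Ici 0)) (hab : a < b) {τ : ℝ}
    (hτ : τ ≤ b) {φ : ℝ → Space N → Space N} (hφ : IsC1Periodic a b φ) :
    Integrable (fun z => momentumFlux p ρ u φ z.1 z.2) (stMeasure N a τ) := by
  obtain ⟨K, hK⟩ := hφ.exists_norm_stDeriv_le hab
  obtain ⟨M, -, hM⟩ := exists_bound_Icc hp C
  exact integrable_stMeasure_of_bound (h.measurable_momentumFlux hp φ).aestronglyMeasurable
    fun t ht x hx => h.abs_momentumFlux_le hM (hK t ⟨ht.1, ht.2.trans_le hτ⟩ x hx)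

lemma IsSmoothSolution.integrable_relFlux (h : IsSmoothSolution p a b r U) (hp : IsPressure p)
    (hab : a < b) (hst : IsBoundedState C ρ u) {τ : ℝ} (hτ : τ ≤ b) :
    Integrable (fun z => relFlux p ρ u r U z.1 z.2) (stMeasure N a τ) :=
  ((hst.integrable_massFlux hab hτ (h.massMultiplier_c1 hp)).sub
    (hst.integrable_momentumFlux hp.continuousOn hab hτ h.velocity_c1)).add
    ((integrable_stDeriv_apply (h.pressure_c1 hp) hab hτ _).add
      (integrable_spaceDiv ((h.pressure_c1 hp).smul h.velocity_c1) hab hτ))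

lemma IsSmoothSolution.integrable_relEnergy (h : IsSmoothSolution p a b r U) (hp : IsPressure p)
    (hab : a < b) (hst : IsBoundedState C ρ u) {τ : ℝ} (hτ : τ ≤ b) :
    Integrable (fun z => relEnergy p ρ u r U z.1 z.2) (stMeasure N a τ) := by
  obtain ⟨M, hM⟩ := hst.exists_energy_le hp
  obtain ⟨K₁, hK₁⟩ := h.velocity_c1.exists_norm_le hab
  obtain ⟨K₂, hK₂⟩ := (h.massMultiplier_c1 hp).exists_norm_le hab
  obtain ⟨K₃, hK₃⟩ := (h.pressure_c1 hp).exists_norm_le hab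
  have hI : ∀ t ∈ Ioo a τ, t ∈ Icc a b := fun t ht => ⟨ht.1.le, ht.2.le.trans hτ⟩
  have h1 : Integrable (fun z : ℝ × Space N => energyDensity p (ρ z.1 z.2) (u z.1 z.2))
      (stMeasure N a τ) :=
    Integrable.of_bound (hst.measurable_energy hp).aestronglyMeasurable M
      (ae_of_all _ fun z => hM z.1 z.2)
  have h2 : Integrable (fun z : ℝ × Space N => ⟪ρ z.1 z.2 • u z.1 z.2, U z.1 z.2⟫)
      (stMeasure N a τ) := by
    refine integrable_stMeasure_of_bound (C := C * C * K₁)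
      ((hst.measurable_density.smul hst.measurable_velocity).aestronglyMeasurable.inner
        (h.velocity_c1.aestronglyMeasurable hab hτ)) fun t ht x hx => ?_
    refine (norm_inner_le_norm _ _).trans ?_
    refine mul_le_mul ?_ (hK₁ t (hI t ht) x hx) (norm_nonneg _)
      (mul_nonneg hst.const_nonneg hst.const_nonneg)
    rw [norm_smul, Real.norm_of_nonneg (hst.nonneg t x)]
    exact mul_le_mul (hst.le t x) (hst.norm_le t x) (norm_nonneg _) hst.const_nonneg
  have h3 : Integrable (fun z : ℝ × Space N => ρ z.1 z.2 * massMultiplier p r U z.1 z.2)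
      (stMeasure N a τ) := by
    refine integrable_stMeasure_of_bound (C := C * K₂)
      (hst.measurable_density.aestronglyMeasurable.mul
        ((h.massMultiplier_c1 hp).aestronglyMeasurable hab hτ)) fun t ht x hx => ?_
    rw [norm_mul, Real.norm_of_nonneg (hst.nonneg t x)]
    exact mul_le_mul (hst.le t x) (hK₂ t (hI t ht) x hx) (norm_nonneg _) hst.const_nonneg
  have h4 : Integrable (fun z : ℝ × Space N => p (r z.1 z.2)) (stMeasure N a τ) :=
    integrable_stMeasure_of_bound ((h.pressure_c1 hp).aestronglyMeasurable hab hτ)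
      fun t ht x hx => hK₃ t (hI t ht) x hx
  refine (((h1.sub h2).add h3).add h4).congr ((ae_stMeasure_mem a τ).mono fun z hz => ?_)
  exact (relEnergy_eq (h.density_pos z.1 (hI z.1 hz.1) z.2)).symm

/-- Decomposition of the integral of the relative energy, with integrability. -/
lemma IsSmoothSolution.integral_relEnergy (h : IsSmoothSolution p a b r U) (hp : IsPressure p)
    (hab : a < b) (hst : IsBoundedState C ρ u) {t : ℝ} (ht : t ∈ Icc a b) :
    Integrable (relEnergy p ρ u r U t) (cellMeasure N) ∧
    ∫ x, relEnergy p ρ u r U t x ∂(cellMeasure N)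
      = totalEnergy p ρ u t - ∫ x, ⟪ρ t x • u t x, U t x⟫ ∂(cellMeasure N)
        + ∫ x, ρ t x * massMultiplier p r U t x ∂(cellMeasure N)
        + ∫ x, p (r t x) ∂(cellMeasure N) := by
  obtain ⟨K₁, hK₁⟩ := h.velocity_c1.exists_norm_le hab
  obtain ⟨K₂, hK₂⟩ := (h.massMultiplier_c1 hp).exists_norm_le hab
  have h1 := hst.integrable_energy hp t
  have h2 := hst.integrable_momentum_inner (t := t)
    (h.velocity_c1.continuous_slice ht).measurable (hK₁ t ht)
  have h3 := hst.integrable_density_mul (t := t)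
    ((h.massMultiplier_c1 hp).continuous_slice ht).measurable (hK₂ t ht)
  have h4 := integrable_slice (h.pressure_c1 hp) hab ht
  have heq : relEnergy p ρ u r U t = fun x => energyDensity p (ρ t x) (u t x)
      - ⟪ρ t x • u t x, U t x⟫ + ρ t x * massMultiplier p r U t x + p (r t x) := by
    ext x; exact relEnergy_eq (h.density_pos t ht x)
  rw [heq]
  have h12 : Integrable (fun x => energyDensity p (ρ t x) (u t x) - ⟪ρ t x • u t x, U t x⟫)
    (cellMeasure N) := h1.sub h2
  have h123 : Integrable (fun x => energyDensity p (ρ t x) (u t x) - ⟪ρ t x • u t x, U t x⟫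
    + ρ t x * massMultiplier p r U t x) (cellMeasure N) := h12.add h3
  exact ⟨h123.add h4, by
    rw [integral_add h123 h4, integral_add h12 h3, integral_sub h1 h2]; rfl⟩

/-- The relative energy inequality. -/
lemma IsSmoothSolution.integral_relEnergy_le (h : IsSmoothSolution p a b r U) (hp : IsPressure p)
    (hb : IsBoundedWeakSolution p T C ρ u) (ha : 0 ≤ a) (hab : a < b) (hbT : b ≤ T)
    (hagree : ∀ᵐ x ∂(cellMeasure N), ρ a x = r a x ∧ u a x = U a x) {t : ℝ} (ht : t ∈ Icc a b)
    (hE : totalEnergy p ρ u t ≤ totalEnergy p r U a) :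
    ∫ x, relEnergy p ρ u r U t x ∂(cellMeasure N)
      ≤ ∫ z, relFlux p ρ u r U z.1 z.2 ∂(stMeasure N a t) := by
  have hst := hb.toIsBoundedState
  have haI : a ∈ Icc a b := ⟨le_rfl, hab.le⟩
  have e0 := (h.integral_relEnergy hp hab hst haI).2
  have e1 := (h.integral_relEnergy hp hab hst ht).2
  have e2 := hb.mass_of_isC1Periodic ha hab hbT ht (h.massMultiplier_c1 hp)
  have e3 := hb.momentum_of_isC1Periodic hp.continuousOn ha hab hbT ht h.velocity_c1
  have e4 := integral_conservation (h.pressure_c1 hp) ((h.pressure_c1 hp).smul h.velocity_c1) hab ht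
    (Q := fun t x => stDeriv (fun t x => p (r t x)) t x (1, 0)
      + spaceDiv (stDeriv (fun t x => p (r t x) • U t x) t x)) fun _ _ _ => rfl
  have ez : ∫ x, relEnergy p ρ u r U a x ∂(cellMeasure N) = 0 := by
    refine integral_eq_zero_of_ae ?_
    filter_upwards [hagree] with x hx
    rw [relEnergy, hx.1, hx.2, relPotential_self]
    simp
  have eE : totalEnergy p ρ u a = totalEnergy p r U a := totalEnergy_congr hagree
  have i1 := hst.integrable_massFlux hab ht.2 (h.massMultiplier_c1 hp)
  have i2 := hst.integrable_momentumFlux hp.continuousOn hab ht.2 h.velocity_c1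
  have i3 : Integrable (fun z : ℝ × Space N => stDeriv (fun t x => p (r t x)) z.1 z.2 (1, 0)
      + spaceDiv (stDeriv (fun t x => p (r t x) • U t x) z.1 z.2)) (stMeasure N a t) :=
    (integrable_stDeriv_apply (h.pressure_c1 hp) hab ht.2 _).add
      (integrable_spaceDiv ((h.pressure_c1 hp).smul h.velocity_c1) hab ht.2)
  have i12 : Integrable (fun z : ℝ × Space N => massFlux ρ u (massMultiplier p r U) z.1 z.2
    - momentumFlux p ρ u U z.1 z.2) (stMeasure N a t) := i1.sub i2
  have esum : ∫ z, relFlux p ρ u r U z.1 z.2 ∂(stMeasure N a t)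
      = ∫ z, massFlux ρ u (massMultiplier p r U) z.1 z.2 ∂(stMeasure N a t)
        - ∫ z, momentumFlux p ρ u U z.1 z.2 ∂(stMeasure N a t)
        + ∫ z, (stDeriv (fun t x => p (r t x)) z.1 z.2 (1, 0)
      + spaceDiv (stDeriv (fun t x => p (r t x) • U t x) z.1 z.2)) ∂(stMeasure N a t) := by
    rw [← integral_sub i1 i2, ← integral_add i12 i3]
    rfl
  -- All ingredients are identities except `hE`, which compares the energy at `t` with that at `a`.
  rw [esum, ← e2, ← e3, ← e4, e1]
  rw [ez, eE] at e0
  linarith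

/-- Weak-strong uniqueness at almost every time. -/
lemma IsSmoothSolution.ae_eq_of_energy_le (h : IsSmoothSolution p a b r U) (hp : IsPressure p)
    (hb : IsBoundedWeakSolution p T C ρ u) (ha : 0 ≤ a) (hab : a < b) (hbT : b ≤ T)
    (hagree : ∀ᵐ x ∂(cellMeasure N), ρ a x = r a x ∧ u a x = U a x)
    (hE : ∀ᵐ t, t ∈ Ioo a b → totalEnergy p ρ u t ≤ totalEnergy p r U a) :
    ∀ᵐ t, t ∈ Ioo a b → ∀ᵐ x ∂(cellMeasure N), ρ t x = r t x ∧ u t x = U t x := by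
  have hst := hb.toIsBoundedState
  obtain ⟨L, hL, hflux⟩ := h.exists_relFlux_le hp hab hst
  have hnn : ∀ t ∈ Icc a b, ∀ x, 0 ≤ relEnergy p ρ u r U t x := fun t ht x => by
    have h1 := hp.relPotential_nonneg (h.density_pos t ht x) (hst.nonneg t x)
    have h2 := hst.nonneg t x
    rw [relEnergy]
    positivity
  have hgron := ae_eq_zero_of_le_integral
    (f := fun t => ∫ x, relEnergy p ρ u r U t x ∂(cellMeasure N)) hab.le hL
    (h.integrable_relEnergy hp hab hst le_rfl).integral_prod_left
    (fun t ht => integral_nonneg (hnn t (Ioo_subset_Icc_self ht))) (by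
      filter_upwards [hE] with t ht htI
      refine (h.integral_relEnergy_le hp hb ha hab hbT hagree (Ioo_subset_Icc_self htI)
        (ht htI)).trans ?_
      have hi := h.integrable_relEnergy hp hab hst htI.2.le
      rw [intervalIntegral_eq_stMeasure htI.1.le hi, ← integral_const_mul]
      refine integral_mono_ae (h.integrable_relFlux hp hab hst htI.2.le) (hi.const_mul L) ?_
      filter_upwards [ae_stMeasure_mem a t] with z hz
      exact (hflux z.1 ⟨hz.1.1, hz.1.2.trans htI.2⟩ z.2 hz.2).1)
  filter_upwards [hgron] with t ht htI
  have htI' := Ioo_subset_Icc_self htI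
  have hz := (integral_eq_zero_iff_of_nonneg (hnn t htI')
    (h.integral_relEnergy hp hab hst htI').1).1 (ht htI)
  filter_upwards [hz, ae_mem_cell N] with x hx hxc
  have hpos := h.density_pos t htI' x
  have hrel := hp.relPotential_nonneg hpos (hst.nonneg t x)
  have hkin : 0 ≤ 1 / 2 * ρ t x * ‖u t x - U t x‖ ^ 2 := by
    have := hst.nonneg t x
    positivity
  have hsum : 1 / 2 * ρ t x * ‖u t x - U t x‖ ^ 2 + relPotential p (ρ t x) (r t x) = 0 := hx
  have hrel0 : relPotential p (ρ t x) (r t x) = 0 := by linarith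
  have hkin0 : 1 / 2 * ρ t x * ‖u t x - U t x‖ ^ 2 = 0 := by linarith
  -- Vanishing relative potential forces `ρ = r`; positivity of `r` then allows division in the
  -- kinetic term to obtain `u = U`.
  have hsq := (hflux t htI x hxc).2
  rw [hrel0, mul_zero] at hsq
  have hρ : ρ t x = r t x := sub_eq_zero.1 (pow_eq_zero_iff (two_ne_zero) |>.1
    (le_antisymm hsq (sq_nonneg _)))
  refine ⟨hρ, ?_⟩
  rw [hρ] at hkin0
  have : ‖u t x - U t x‖ ^ 2 = 0 := by
    rcases mul_eq_zero.1 hkin0 with h' | h'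
    · linarith
    · exact h'
  exact sub_eq_zero.1 (norm_eq_zero.1 (pow_eq_zero_iff two_ne_zero |>.1 this))

end RelativeEnergy

/-! ### Separation of bounded functions by smooth periodic tests. -/

section Orthogonality

variable {N : ℕ}

/-- A bounded function that is orthogonal to all smooth periodic functions vanishes. -/
lemma ae_eq_zero_of_forall_smooth_periodic {F : Type*} [NormedAddCommGroup F]
    [InnerProductSpace ℝ F] [FiniteDimensional ℝ F] [MeasurableSpace F] [BorelSpace F]
    {w : Space N → F} (hw : Measurable w) {C : ℝ} (hC : ∀ x ∈ cell N, ‖w x‖ ≤ C)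
    (horth : ∀ ψ : Space N → F, ContDiff ℝ ∞ ψ → IsPeriodic ψ →
      ∫ x, ⟪w x, ψ x⟫ ∂(cellMeasure N) = 0) : ∀ᵐ x ∂(cellMeasure N), w x = 0 := by
  have : CompleteSpace F := FiniteDimensional.complete ℝ F
  -- The mollified periodic extension of `w` is itself a legitimate test function. It converges to
  -- `w` almost everywhere on the cell, so orthogonality gives `∫ |w|² = 0`.
  set h : Space N → F := fun x => w (wrap x) with hh
  have hm : Measurable h := hw.comp measurable_wrap
  have hb : ∀ x, ‖h x‖ ≤ C := fun x => hC _ (wrap_mem_cell x)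
  have hloc : LocallyIntegrable h volume :=
    (locallyIntegrable_const C).mono hm.aestronglyMeasurable
      (ae_of_all _ fun x => (hb x).trans (le_abs_self C))
  have hper : IsPeriodic h := fun i x => by simp only [hh, isPeriodic_wrap i x]
  have hzero : ∀ n, ∫ x, ⟪w x, mollify volume n h x⟫ ∂(cellMeasure N) = 0 := fun n =>
    horth _ (contDiff_mollify hloc) fun i x => mollify_periodic (hper i) x
  have hlim : Tendsto (fun n => ∫ x, ⟪w x, mollify volume n h x⟫ ∂(cellMeasure N)) atTop
      (𝓝 (∫ x, ⟪w x, w x⟫ ∂(cellMeasure N))) := by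
    refine tendsto_integral_of_dominated_convergence (fun _ => C * C) (fun n =>
      (hw.inner (contDiff_mollify hloc).continuous.measurable).aestronglyMeasurable)
      (integrable_const _) (fun n => (ae_mem_cell N).mono fun x hx => ?_) ?_
    · refine (norm_inner_le_norm _ _).trans ?_
      exact mul_le_mul (hC x hx) (norm_mollify_le fun y _ => hb y) (norm_nonneg _)
        ((norm_nonneg _).trans (hC x hx))
    · filter_upwards [ae_restrict_of_ae (ae_mollify_tendsto hloc), ae_wrap_eq N] with x hx hwx
      have : h x = w x := by simp only [hh, hwx]
      rw [this] at hx
      exact tendsto_const_nhds.inner hx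
  have hint : ∫ x, ⟪w x, w x⟫ ∂(cellMeasure N) = 0 := by
    refine tendsto_nhds_unique hlim ?_
    simp only [hzero]
    exact tendsto_const_nhds
  have hi : Integrable (fun x => ⟪w x, w x⟫) (cellMeasure N) := by
    refine integrable_cell_of_bound (hw.inner hw).aestronglyMeasurable (C := C * C) fun x hx => ?_
    exact (norm_inner_le_norm _ _).trans
      (mul_le_mul (hC x hx) (hC x hx) (norm_nonneg _) ((norm_nonneg _).trans (hC x hx)))
  have := (integral_eq_zero_iff_of_nonneg (fun x => real_inner_self_nonneg) hi).1 hint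
  filter_upwards [this] with x hx
  exact inner_self_eq_zero.1 hx

end Orthogonality

/-! ### From almost every time to every time. -/

section AllTimes

variable {N : ℕ} {p : ℝ → ℝ} {T C a b : ℝ} {ρ r : ℝ → Space N → ℝ} {u U : ℝ → Space N → Space N}

lemma isTest_of_smooth_periodic {F : Type*} [NormedAddCommGroup F] [NormedSpace ℝ F]
    {ψ : Space N → F} (h : ContDiff ℝ ∞ ψ) (hper : IsPeriodic ψ) : IsTest fun _ : ℝ => ψ :=
  ⟨h.comp contDiff_snd, fun _ => hper⟩

/-- Equality at almost every time extends to every time by weak continuity. -/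
lemma IsBoundedWeakSolution.eq_of_ae_eq (hb : IsBoundedWeakSolution p T C ρ u) (hp : IsPressure p)
    (hsm : IsSmoothSolution p a b r U) (ha : 0 ≤ a) (hab : a < b) (hbT : b ≤ T)
    (hagree : ∀ᵐ x ∂(cellMeasure N), ρ a x = r a x ∧ u a x = U a x)
    (hae : ∀ᵐ t, t ∈ Ioo a b → ∀ᵐ x ∂(cellMeasure N), ρ t x = r t x ∧ u t x = U t x)
    {τ : ℝ} (hτ : τ ∈ Icc a b) :
    ∀ᵐ x ∂(cellMeasure N), ρ τ x = r τ x ∧ u τ x = U τ x := by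
  obtain ⟨C₁, hC₁⟩ := hsm.exists_boundedState hab
  have hst := hb.toIsBoundedState
  have haI : a ∈ Icc a b := ⟨le_rfl, hab.le⟩
  have hν : ∀ᵐ z ∂(stMeasure N a τ), ρ z.1 z.2 = r z.1 z.2 ∧ u z.1 z.2 = U z.1 z.2 := by
    -- Passing from slices to the product measure needs a measurable set of agreement; `r` and `U`
    -- are unconstrained outside `[a,b]`, so their extensions are used.
    have : ∀ᵐ z ∂(stMeasure N a τ), ρ z.1 z.2 = cellExtend a b r z.1 z.2 ∧
        u z.1 z.2 = cellExtend a b U z.1 z.2 := by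
      refine ae_stMeasure_of_ae_ae ((measurableSet_eq_fun hst.measurable_density
        hC₁.measurable_density).inter (measurableSet_eq_fun hst.measurable_velocity
          hC₁.measurable_velocity)) ?_
      filter_upwards [hae] with t ht htI
      have htI' : t ∈ Ioo a b := ⟨htI.1, htI.2.trans_le hτ.2⟩
      filter_upwards [ht htI', ae_mem_cell N] with x hx hxc
      rw [cellExtend_of_mem (Ioo_subset_Icc_self htI') hxc,
        cellExtend_of_mem (Ioo_subset_Icc_self htI') hxc]
      exact hx
    filter_upwards [this, ae_stMeasure_mem a τ] with z hz hzm
    have hzI : z.1 ∈ Icc a b := ⟨hzm.1.1.le, hzm.1.2.le.trans hτ.2⟩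
    rwa [cellExtend_of_mem hzI hzm.2, cellExtend_of_mem hzI hzm.2] at hz
  have hcell : ∀ᵐ x ∂(cellMeasure N), cellExtend a b r τ x = r τ x ∧
      cellExtend a b U τ x = U τ x :=
    (ae_mem_cell N).mono fun x hx => ⟨cellExtend_of_mem hτ hx, cellExtend_of_mem hτ hx⟩
  have hmr := measurable_slice hC₁.measurable_density τ
  have hmU := measurable_slice hC₁.measurable_velocity τ
  have hmρ := measurable_slice hst.measurable_density τ
  have hmu := measurable_slice hst.measurable_velocity τ
  have hdens : ∀ᵐ x ∂(cellMeasure N), ρ τ x - cellExtend a b r τ x = 0 := by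
    refine ae_eq_zero_of_forall_smooth_periodic (hmρ.sub hmr) (C := C + C₁) (fun x _ => ?_)
      fun ψ hψ hper => ?_
    · refine (norm_sub_le _ _).trans (add_le_add ?_ ?_)
      · rw [Real.norm_of_nonneg (hst.nonneg τ x)]; exact hst.le τ x
      · rw [Real.norm_of_nonneg (hC₁.nonneg τ x)]; exact hC₁.le τ x
    · have hφ := isTest_of_smooth_periodic hψ hper
      obtain ⟨K, hK⟩ := hφ.exists_norm_le 0
      have e1 := hb.mass_of_isC1Periodic ha hab hbT hτ hφ.isC1Periodic
      have e2 := hsm.mass_weak hab hτ hφ.isC1Periodic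
      -- Both solutions have the same flux up to `τ` and the same value at `a`, hence the same
      -- integral against `ψ` at the given time `τ`.
      have e3 : ∫ z, massFlux ρ u (fun _ => ψ) z.1 z.2 ∂(stMeasure N a τ)
          = ∫ z, massFlux r U (fun _ => ψ) z.1 z.2 ∂(stMeasure N a τ) :=
        integral_congr_ae (hν.mono fun z hz => massFlux_congr hz.1 hz.2)
      have e4 : ∫ x, ρ a x * ψ x ∂(cellMeasure N) = ∫ x, r a x * ψ x ∂(cellMeasure N) :=
        integral_congr_ae (hagree.mono fun x hx => by simp only [hx.1])
      have e5 : ∫ x, cellExtend a b r τ x * ψ x ∂(cellMeasure N)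
          = ∫ x, r τ x * ψ x ∂(cellMeasure N) :=
        integral_congr_ae (hcell.mono fun x hx => by simp only [hx.1])
      have e6 : ∫ x, ⟪ρ τ x - cellExtend a b r τ x, ψ x⟫ ∂(cellMeasure N)
          = ∫ x, (ρ τ x * ψ x - cellExtend a b r τ x * ψ x) ∂(cellMeasure N) := by
        congr 1 with x
        simp only [RCLike.inner_apply, conj_trivial]
        ring
      rw [e6, integral_sub (hst.integrable_density_mul hψ.continuous.measurable hK)
        (hC₁.integrable_density_mul hψ.continuous.measurable hK), e5]
      linarith
  have hmom : ∀ᵐ x ∂(cellMeasure N),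
      ρ τ x • u τ x - cellExtend a b r τ x • cellExtend a b U τ x = 0 := by
    refine ae_eq_zero_of_forall_smooth_periodic ((hmρ.smul hmu).sub (hmr.smul hmU))
      (C := C * C + C₁ * C₁) (fun x _ => ?_) fun ψ hψ hper => ?_
    · refine (norm_sub_le _ _).trans (add_le_add ?_ ?_)
      · rw [norm_smul, Real.norm_of_nonneg (hst.nonneg τ x)]
        exact mul_le_mul (hst.le τ x) (hst.norm_le τ x) (norm_nonneg _) hst.const_nonneg
      · rw [norm_smul, Real.norm_of_nonneg (hC₁.nonneg τ x)]
        exact mul_le_mul (hC₁.le τ x) (hC₁.norm_le τ x) (norm_nonneg _) hC₁.const_nonneg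
    · have hφ := isTest_of_smooth_periodic hψ hper
      obtain ⟨K, hK⟩ := hφ.exists_norm_le 0
      have e1 := hb.momentum_of_isC1Periodic hp.continuousOn ha hab hbT hτ hφ.isC1Periodic
      have e2 := hsm.momentum_weak hp hab hτ hφ.isC1Periodic
      have e3 : ∫ z, momentumFlux p ρ u (fun _ => ψ) z.1 z.2 ∂(stMeasure N a τ)
          = ∫ z, momentumFlux p r U (fun _ => ψ) z.1 z.2 ∂(stMeasure N a τ) :=
        integral_congr_ae (hν.mono fun z hz => momentumFlux_congr hz.1 hz.2)
      have e4 : ∫ x, ⟪ρ a x • u a x, ψ x⟫ ∂(cellMeasure N)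
          = ∫ x, ⟪r a x • U a x, ψ x⟫ ∂(cellMeasure N) :=
        integral_congr_ae (hagree.mono fun x hx => by simp only [hx.1, hx.2])
      have e5 : ∫ x, ⟪cellExtend a b r τ x • cellExtend a b U τ x, ψ x⟫ ∂(cellMeasure N)
          = ∫ x, ⟪r τ x • U τ x, ψ x⟫ ∂(cellMeasure N) :=
        integral_congr_ae (hcell.mono fun x hx => by simp only [hx.1, hx.2])
      simp only [inner_sub_left]
      rw [integral_sub (hst.integrable_momentum_inner hψ.continuous.measurable hK)
        (hC₁.integrable_momentum_inner hψ.continuous.measurable hK), e5]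
      linarith
  filter_upwards [hdens, hmom, hcell] with x hd hm hc
  rw [hc.1] at hd
  rw [hc.1, hc.2, sub_eq_zero.1 hd] at hm
  refine ⟨sub_eq_zero.1 hd, ?_⟩
  -- Equal momenta determine the velocity because the smooth density is positive.
  exact smul_right_injective _ (hsm.density_pos τ hτ x).ne' (sub_eq_zero.1 hm)

end AllTimes

end BarotropicEuler

open BarotropicEuler
theorem proposition5p1 (N : ℕ) (hN : N = 2 ∨ N = 3) (p : ℝ → ℝ) (hp : IsPressure p)
    (T : ℝ) (ρ : ℝ → Space N → ℝ) (u : ℝ → Space N → Space N)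
    (hadm : IsAdmissible p T ρ u) (hmax : MaximalDissipation p T ρ u)
    (τ₁ τ₂ : ℝ) (hτ₁ : 0 ≤ τ₁) (hτ : τ₁ < τ₂) (hτ₂ : τ₂ ≤ T)
    (r : ℝ → Space N → ℝ) (U : ℝ → Space N → Space N) (hsm : IsSmoothSolution p τ₁ τ₂ r U)
    (hagree : ∀ᵐ x ∂(cellMeasure N), ρ τ₁ x = r τ₁ x ∧ u τ₁ x = U τ₁ x) :
    ∀ t ∈ Set.Icc τ₁ τ₂, ∀ᵐ x ∂(cellMeasure N), ρ t x = r t x ∧ u t x = U t x := by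
  obtain ⟨C, ρ', u', hb, heq⟩ := hadm.weak.exists_bounded
  have hagree' : ∀ᵐ x ∂(cellMeasure N), ρ' τ₁ x = r τ₁ x ∧ u' τ₁ x = U τ₁ x := by
    filter_upwards [heq τ₁ ⟨hτ₁, hτ.le.trans hτ₂⟩, hagree] with x hx hxa
    rw [hx.1, hx.2]
    exact hxa
  -- Admissibility and maximal dissipation enter only here; the remainder uses the weak equations
  -- and this energy bound.
  have hE := hadm.ae_totalEnergy_le_smooth hp hmax hb heq hsm hτ₁ hτ hτ₂ hagree'
  have hae := hsm.ae_eq_of_energy_le hp hb hτ₁ hτ hτ₂ hagree' hE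
  intro t ht
  filter_upwards [hb.eq_of_ae_eq hp hsm hτ₁ hτ hτ₂ hagree' hae ht,
    heq t ⟨hτ₁.trans ht.1, ht.2.trans hτ₂⟩] with x hx hx'
  rw [← hx'.1, ← hx'.2]
  exact hx
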